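/- \textbf{Setting.} Let $M\subset\mathbb C^2$ be a real-analytic hypersurface near $p\in M$ and let $m\ge 2$. Local holomorphic coordinates $(z,w)$, $w=u+iv$, centred at $p$ are \emph{normal} if in them $M$ is $v=f(z,\bar z,u)$ with $f(z,0,u)=f(0,\bar z,u)=0$; $M$ is of \emph{$m$-infinite type} at $p$ if in such coordinates $f=u^m\psi$ with $\psi(z,\bar z,0)\not\equiv0$ (in particular $M$ is Levi-nonflat). Local holomorphic coordinates centred at $p$ are \emph{admissible} if in them $M$ is given by $$v=\tfrac12u^m\Bigl(\epsilon|z|^2+\sum_{k,l\ge2}h_{kl}(u)z^k\bar z^l\Bigr),\qquad \epsilon=\pm1 .\qquad (1)$$ (Such coordinates exist when $p$ is a generic infinite type point.) Writing (1) as $w=\Theta(z,\bar z,\bar w)$, the Segre varieties $w(z)=\Theta(z,\chi,\tau)$ are solutions of a unique ODE $w''=w^m\Phi\bigl(z,w,\tfrac{w'}{w^m}\bigr)$ with $\Phi$ holomorphic near $0$. Let $\alpha_j,\beta_j,\gamma_j$ be the coefficients of $z^j\zeta^2,z^j\zeta^3,z^j\zeta^4$ in $\Phi(z,0,\zeta)$.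 The point $p$ is \emph{non-resonant} if, in admissible coordinates, both matrices $$\begin{pmatrix}\alpha_0&3\beta_0&\alpha_1&0\\ \alpha_1&3\beta_1&2\alpha_2&\alpha_1\\ 2\beta_0&4\gamma_0&\beta_1&-\beta_0\\ 2\beta_1&2\beta_0\alpha_0+4\gamma_1&2\beta_2&0\end{pmatrix},\qquad \begin{pmatrix}3\beta_0&\alpha_1&0\\3\beta_1&2\alpha_2&\alpha_1\\4\gamma_0&\beta_1&-\beta_0\end{pmatrix}$$ are invertible. A formal real hypersurface (1) is in \emph{normal form} if $$h_{22}'=h_{23}'=h_{32}'\equiv0,\qquad h_{33}^{(j)}(0)=0\ \text{ for } j\notin\{0,m-1\}.$$ \textbf{Theorem.} Let $M\subset\mathbb C^2$ be a real-analytic Levi-nonflat hypersurface which is of $m$-infinite type at $p\in M$ for some $m\ge2$, and assume that $p$ is a non-resonant point for $M$. (i) There is a formal invertible transformation $\widehat H=(F,G):(\mathbb C^2,p)\to(\mathbb C^2,0)$ bringing $M$ into normal form; if $m$ is even, it can be chosen so that the normal form has $\epsilon=1$. (ii) Let $t\in\mathbb C^2\setminus T^{1,0}_pM$. Suppose that two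 formal invertible transformations $\widehat H=(F,G)$, $\widehat H'=(F',G')$ bring $M$ into normal form, that $d\widehat H|_p$ and $d\widehat H'|_p$ have the same restriction to $T^{1,0}_pM$, and that $\frac1{m!}\partial_t^mG(p)=\frac1{m!}\partial_t^mG'(p)$. Suppose moreover that $m$ is even and the two normal forms have the same sign $\epsilon$, or that ($m$ being arbitrary) $dG|_p(t)$ is a positive multiple of $dG'|_p(t)$. Then $\widehat H=\widehat H'$. In particular, in coordinates centred at $p$ with $T^{1,0}_pM=\{w=0\}$, $\widehat H$ is determined, up to this choice of sign, by $\lambda=F_z(0)$ and $\tau=\frac1{m!}\frac{\partial^mG}{\partial w^m}(0)$. (iii) In normal coordinates for $M$ at $p$, $\tau=\frac1{m!}\frac{\partial^mG}{\partial w^m}(0)$ is real for every formal invertible transformation bringing $M$ into normal form. -/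

import Mathlib

namespace FormalCR

open MvPowerSeries
open scoped ComplexConjugate

noncomputable section

/-! Formal power series, real-analytic germs, formal maps -/

/-- The exponent vector of `X 0 ^ a * X 1 ^ b`. -/
def exp2 (a b : ℕ) : Fin 2 →₀ ℕ := Finsupp.equivFunOnFinite.symm ![a, b]

/-- The exponent vector of `X 0 ^ a * X 1 ^ b * X 2 ^ c`. -/
def exp3 (a b c : ℕ) : Fin 3 →₀ ℕ := Finsupp.equivFunOnFinite.symm ![a, b, c]

/-- The exponent vector of `X 0 ^ a * X 1 ^ b * X 2 ^ c * X 3 ^ d`. -/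
def exp4 (a b c d : ℕ) : Fin 4 →₀ ℕ := Finsupp.equivFunOnFinite.symm ![a, b, c, d]

/-- A power series converges in some neighbourhood of the origin. -/
def IsConvergent {n : ℕ} (f : MvPowerSeries (Fin n) ℂ) : Prop :=
  ∃ r C : ℝ, 0 < r ∧ ∀ e : Fin n →₀ ℕ, ‖coeff e f‖ * r ^ e.degree ≤ C

/-- The series with conjugated coefficients. -/
def conjSeries {n : ℕ} (f : MvPowerSeries (Fin n) ℂ) : MvPowerSeries (Fin n) ℂ :=
  MvPowerSeries.map (starRingEnd ℂ) f

/-- The germ at `p` of the set `M ⊆ ℂ²` is the real-analytic hypersurface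
`{(p₁ + z, p₂ + w) : P(z, w, z̄, w̄) = 0}`, where `P` is a convergent power series in
`(z, w, z̄, w̄)` which is real-valued, vanishes at the origin and has nonzero differential there. -/
structure IsDefiningSeries (M : Set (ℂ × ℂ)) (p : ℂ × ℂ) (P : MvPowerSeries (Fin 4) ℂ) :
    Prop where
  convergent : IsConvergent P
  real : ∀ a b c d : ℕ, coeff (exp4 c d a b) P = conj (coeff (exp4 a b c d) P)
  zero : constantCoeff P = 0
  smooth : coeff (exp4 1 0 0 0) P ≠ 0 ∨ coeff (exp4 0 1 0 0) P ≠ 0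
  zeroSet : ∀ᶠ q in nhds p, q ∈ M ↔
    ∑' e : Fin 4 →₀ ℕ, coeff e P * (q.1 - p.1) ^ e 0 * (q.2 - p.2) ^ e 1 *
      conj (q.1 - p.1) ^ e 2 * conj (q.2 - p.2) ^ e 3 = 0

/-- A formal map `(ℂ², p) → (ℂ², 0)`: the components `H 0 = F`, `H 1 = G` are power series in
`(z - p₁, w - p₂)`. -/
abbrev FormalMap := Fin 2 → MvPowerSeries (Fin 2) ℂ

/-- `H` maps the base point to the origin and has invertible Jacobian there. -/
def IsInvertibleMap (H : FormalMap) : Prop :=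
  (∀ i, constantCoeff (H i) = 0) ∧
    coeff (exp2 1 0) (H 0) * coeff (exp2 0 1) (H 1) -
      coeff (exp2 0 1) (H 0) * coeff (exp2 1 0) (H 1) ≠ 0

/-- The complexification `(z, w, χ, τ) ↦ (F(z, w), G(z, w), F̄(χ, τ), Ḡ(χ, τ))` of `H = (F, G)`. -/
def complexify (H : FormalMap) : Fin 4 → MvPowerSeries (Fin 4) ℂ :=
  ![(H 0).subst ![X 0, X 1], (H 1).subst ![X 0, X 1],
    (conjSeries (H 0)).subst ![X 2, X 3], (conjSeries (H 1)).subst ![X 2, X 3]]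

/-- The defining series `v - f(z, z̄, u)`, `w = u + i v`, of the (formal) hypersurface
`v = f(z, z̄, u)`, as a series in `(z, w, χ, τ) = (z, w, z̄, w̄)`. -/
def graphSeries (f : MvPowerSeries (Fin 3) ℂ) : MvPowerSeries (Fin 4) ℂ :=
  C (1 / (2 * Complex.I)) * (X 1 - X 3) -
    f.subst (![X 0, X 2, C (1 / 2) * (X 1 + X 3)] : Fin 3 → MvPowerSeries (Fin 4) ℂ)

/-- `H` transforms the hypersurface `{P = 0}` into the hypersurface `v = f(z, z̄, u)`: the pull-back
of the defining series of the latter lies in the ideal generated by `P`. -/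
def MapsToGraph (H : FormalMap) (P : MvPowerSeries (Fin 4) ℂ) (f : MvPowerSeries (Fin 3) ℂ) :
    Prop :=
  P ∣ (graphSeries f).subst (complexify H)

/-- `f(z, z̄, u)` is real-valued. -/
def IsRealSeries (f : MvPowerSeries (Fin 3) ℂ) : Prop :=
  ∀ k l j : ℕ, coeff (exp3 l k j) f = conj (coeff (exp3 k l j) f)

/-! Hypersurfaces of infinite type -/

/-- `A` is a local holomorphic coordinate system centred at the base point, which is normal for
`{P = 0}`: in these coordinates the hypersurface is `v = f(z, z̄, u)`, with `f` real-analytic and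
`f(z, 0, u) = f(0, z̄, u) = 0`. -/
structure IsNormalCoordinates (P : MvPowerSeries (Fin 4) ℂ) (A : FormalMap)
    (f : MvPowerSeries (Fin 3) ℂ) : Prop where
  holomorphic : ∀ i, IsConvergent (A i)
  invertible : IsInvertibleMap A
  analytic : IsConvergent f
  real : IsRealSeries f
  normal : ∀ k l j : ℕ, coeff (exp3 k l j) f ≠ 0 → 1 ≤ k ∧ 1 ≤ l
  maps : MapsToGraph A P f

/-- The hypersurface `{P = 0}` is of `m`-infinite type at the base point: in normal coordinates it
is `v = u ^ m * ψ(z, z̄, u)` with `ψ(z, z̄, 0) ≢ 0` (in particular it is Levi-nonflat). -/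
def IsOfInfiniteType (m : ℕ) (P : MvPowerSeries (Fin 4) ℂ) : Prop :=
  1 ≤ m ∧ ∃ (A : FormalMap) (ψ : MvPowerSeries (Fin 3) ℂ),
    IsNormalCoordinates P A (X 2 ^ m * ψ) ∧ ∃ k l : ℕ, coeff (exp3 k l 0) ψ ≠ 0

/-- The series `½ u ^ m (ε z z̄ + h(z, z̄, u))`. -/
def admissibleSeries (m : ℕ) (ε : ℤˣ) (h : MvPowerSeries (Fin 3) ℂ) : MvPowerSeries (Fin 3) ℂ :=
  C (1 / 2) * X 2 ^ m * (C (((ε : ℤ) : ℂ)) * X 0 * X 1 + h)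

/-- `h` is real-valued and of the form `h = ∑_{k, l ≥ 2} h_{kl}(u) z ^ k z̄ ^ l`. -/
def IsAdmissibleTail (h : MvPowerSeries (Fin 3) ℂ) : Prop :=
  IsRealSeries h ∧ ∀ k l j : ℕ, coeff (exp3 k l j) h ≠ 0 → 2 ≤ k ∧ 2 ≤ l

/-- `A` is a local holomorphic coordinate system centred at the base point, which is admissible for
`{P = 0}`: in these coordinates the hypersurface is
`v = ½ u ^ m (ε |z|² + ∑_{k, l ≥ 2} h_{kl}(u) z ^ k z̄ ^ l)`, with real-analytic right-hand side. -/
structure IsAdmissibleCoordinates (m : ℕ) (P : MvPowerSeries (Fin 4) ℂ) (A : FormalMap) (ε : ℤˣ)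
    (h : MvPowerSeries (Fin 3) ℂ) : Prop where
  holomorphic : ∀ i, IsConvergent (A i)
  invertible : IsInvertibleMap A
  analytic : IsConvergent h
  admissible : IsAdmissibleTail h
  maps : MapsToGraph A P (admissibleSeries m ε h)

/-! The associated singular ODE and non-resonance -/

/-- `w = Θ(z, z̄, w̄)` is the complex defining equation of `v = f(z, z̄, u)`: `w = Θ(z, χ, τ)` solves
`(w - τ) / 2i = f(z, χ, (w + τ) / 2)`. -/
def IsComplexDefiningSeries (f Θ : MvPowerSeries (Fin 3) ℂ) : Prop :=
  constantCoeff Θ = 0 ∧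
    C (1 / (2 * Complex.I)) * (Θ - X 2) =
      f.subst (![X 0, X 1, C (1 / 2) * (Θ + X 2)] : Fin 3 → MvPowerSeries (Fin 3) ℂ)

/-- Every Segre variety `w(z) = Θ(z, χ, τ)` satisfies `w'' = w ^ m Φ(z, w, w' / w ^ m)`; here `Z` is
the power series `Θ_z / Θ ^ m`. -/
def IsAssociatedODE (m : ℕ) (Θ Φ : MvPowerSeries (Fin 3) ℂ) : Prop :=
  ∃ Z : MvPowerSeries (Fin 3) ℂ, constantCoeff Z = 0 ∧
    pderiv ℂ 0 Θ = Θ ^ m * Z ∧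
    pderiv ℂ 0 (pderiv ℂ 0 Θ) =
      Θ ^ m * Φ.subst (![X 0, Θ, Z] : Fin 3 → MvPowerSeries (Fin 3) ℂ)

/-- Non-resonance of the ODE `w'' = w ^ m Φ(z, w, w' / w ^ m)` in the case `m > 1`. The numbers
`α j`, `β j`, `γ j` are the coefficients of `z ^ j ζ ^ 2`, `z ^ j ζ ^ 3`, `z ^ j ζ ^ 4` in
`Φ(z, 0, ζ)`. -/
def IsNonresonantODE (Φ : MvPowerSeries (Fin 3) ℂ) : Prop :=
  let α : ℕ → ℂ := fun j => coeff (exp3 j 0 2) Φ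
  let β : ℕ → ℂ := fun j => coeff (exp3 j 0 3) Φ
  let γ : ℕ → ℂ := fun j => coeff (exp3 j 0 4) Φ
  IsUnit !![α 0, 3 * β 0, α 1, 0;
            α 1, 3 * β 1, 2 * α 2, α 1;
            2 * β 0, 4 * γ 0, β 1, -β 0;
            2 * β 1, 2 * β 0 * α 0 + 4 * γ 1, 2 * β 2, 0] ∧
  IsUnit !![3 * β 0, α 1, 0;
            3 * β 1, 2 * α 2, α 1;
            4 * γ 0, β 1, -β 0]

/-- The base point is a non-resonant point of the hypersurface `{P = 0}` of `m`-infinite type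
(`m > 1`): in admissible coordinates, the associated ODE is non-resonant. (The condition does not
depend on the choice of the admissible coordinates, and `Θ`, `Φ` are uniquely determined by the
latter.) -/
def IsNonresonantPoint (m : ℕ) (P : MvPowerSeries (Fin 4) ℂ) : Prop :=
  ∃ (A : FormalMap) (ε : ℤˣ) (h Θ Φ : MvPowerSeries (Fin 3) ℂ),
    IsAdmissibleCoordinates m P A ε h ∧
    IsComplexDefiningSeries (admissibleSeries m ε h) Θ ∧
    IsAssociatedODE m Θ Φ ∧ IsNonresonantODE Φ

/-! Normal form and the parameters of a normalizing transformation -/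

/-- `h` satisfies `h₂₂' = h₂₃' = h₃₂' ≡ 0` and `h₃₃^{(j)}(0) = 0` for `j ∉ {0, m - 1}`. -/
def IsNormalTail (m : ℕ) (h : MvPowerSeries (Fin 3) ℂ) : Prop :=
  (∀ j : ℕ, 1 ≤ j → coeff (exp3 2 2 j) h = 0 ∧ coeff (exp3 2 3 j) h = 0 ∧
    coeff (exp3 3 2 j) h = 0) ∧
  ∀ j : ℕ, j ≠ 0 → j + 1 ≠ m → coeff (exp3 3 3 j) h = 0

/-- `H` is a formal invertible transformation bringing `{P = 0}` into the normal form
`v = ½ u ^ m (ε |z|² + h(z, z̄, u))`. -/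
structure BringsToNormalForm (m : ℕ) (P : MvPowerSeries (Fin 4) ℂ) (H : FormalMap) (ε : ℤˣ)
    (h : MvPowerSeries (Fin 3) ℂ) : Prop where
  invertible : IsInvertibleMap H
  admissible : IsAdmissibleTail h
  normal : IsNormalTail m h
  maps : MapsToGraph H P (admissibleSeries m ε h)

/-- The complex tangent space `T^{1,0}` of `{P = 0}` at the base point. -/
def holomorphicTangent (P : MvPowerSeries (Fin 4) ℂ) : Set (Fin 2 → ℂ) :=
  {v | coeff (exp4 1 0 0 0) P * v 0 + coeff (exp4 0 1 0 0) P * v 1 = 0}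

/-- The differential of `g` at the base point, applied to `v`. -/
def differential (g : MvPowerSeries (Fin 2) ℂ) (v : Fin 2 → ℂ) : ℂ :=
  coeff (exp2 1 0) g * v 0 + coeff (exp2 0 1) g * v 1

/-- The derivative `(1 / m!) (d / ds) ^ m g(s t)` at `s = 0`, of order `m` in the direction `t`. -/
def directionalCoeff (m : ℕ) (g : MvPowerSeries (Fin 2) ℂ) (t : Fin 2 → ℂ) : ℂ :=
  ∑ a ∈ Finset.range (m + 1), coeff (exp2 a (m - a)) g * t 0 ^ a * t 1 ^ (m - a)

end

end FormalCR

open FormalCR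

/-! On the complexified hypersurface `v = f(z, χ, u)` the variables `(z, χ, u)` are free parameters,
and a formal map `K = (F, G)` sends it into `v = g` exactly when the single power series
`basicEquation f K g` vanishes. In admissible coordinates `f = ½ u^m ψ`, and this equation is
studied order by order in `u`.

Let two maps tangent to the identity differ by `(w^j F, w^(j+1) p + w^(m+j) q)`, with `p` a real
series in `w` alone and `p(0) = b`, and let their targets differ by `u^j η`. By
`basicEquation_sub_congr`, their basic equations differ modulo `u^(m+j+1)` by `½ u^(m+j)` times `(j
+ 1 - m) b ψ - i (q - q̄) - F ψ_z - F̄ ψ_χ - η`. Here `j + 1` comes from `Im w^(j+1)` and `m` from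
the factor `u^m` of the target. The coefficient of `b` vanishes at `j = m - 1`, so the coefficient
of `w^m` in `G` stays free: it is the parameter `τ`. In exchange the coefficient of `u^(m-1)` in
`h₃₃` is not normalized.

At `u = 0` this becomes a homological equation for Taylor coefficients. The column `χ^0` governs
`q`, the column `χ^1` gives the coefficients `F_k`, `k ≥ 2`, through `F_0`, and the coefficient of
`z χ` gives `Re F_1`. What is left is `κ = (j + 1 - m) b`, `F_0` and `Im F_1`, subject to the
equations of bidegree (2,2), (2,3), (3,2), (3,3), or only the first three, with `κ = 0`, when `j = m
- 1`. The Segre varieties are `w = τ + i τ^m ψ` to leading order, hence `Φ(z, 0, i ψ_z) = i ψ_zz` at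
`u = 0`; comparing powers of `χ` expresses `α, β, γ` by the jet of `ψ` (`associatedODE_jet`). The
two non-resonance matrices are then the matrices of these two systems, up to row operations and a
change of unknowns (`IsNonresonantODE.isNonresonantJet`). This gives `homological_surjective` and
`homological_injective`.

Existence is the iteration of `IsApproximateNormalization.exists_succ` followed by a limit; for even
`m` the map `w ↦ -w` corrects the sign. For uniqueness, the restriction to `χ = 0` shows that a
normalizing map preserves `w = 0` and that `G` is real and independent of `z` through order `m`
(`transverse_component`), which also contains the reality of `τ`. The leading order gives `F(z, 0) =
l z`, `G = c w + O(w²)` with `ε₀ = c^(m-1) ε |l|²`, so that rescaling makes the map tangent to the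
identity (`exists_tangent_rescaling`). The differential on the complex tangent space fixes `l`, the
relation and the sign hypothesis fix `c`, and `homological_injective` propagates agreement through
all orders, using `τ` only at `j = m - 1`. -/

namespace FormalCR

open MvPowerSeries
open scoped ComplexConjugate

noncomputable section

set_option linter.unusedSectionVars false

/-! ### Substitution of power series: orders, differences and Taylor expansion -/

section Substitution

variable {σ τ : Type*} [Finite σ]

theorem hasSubst_of_zero {a : σ → MvPowerSeries τ ℂ} (ha : ∀ i, constantCoeff (a i) = 0) :
    HasSubst a :=
  hasSubst_of_constantCoeff_zero ha

/-- This is what allows identities between substitutions to be checked on polynomial truncations. -/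
theorem order_le_order_subst {a : σ → MvPowerSeries τ ℂ} (ha : ∀ i, constantCoeff (a i) = 0)
    (f : MvPowerSeries σ ℂ) : f.order ≤ (f.subst a).order := by
  refine le_trans ?_ (le_order_subst (hasSubst_of_zero ha) f)
  have h1 : (1 : ℕ∞) ≤ ⨅ i, (a i).order :=
    le_iInf fun i => one_le_order_iff_constCoeff_eq_zero.mpr (ha i)
  calc f.order = 1 * f.order := (one_mul _).symm
    _ ≤ _ := mul_le_mul_left h1 _

theorem order_sub_truncTotal (f : MvPowerSeries σ ℂ) (k : ℕ) :
    (k : ℕ∞) ≤ (f - (truncTotal k f : MvPolynomial σ ℂ) : MvPowerSeries σ ℂ).order := by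
  refine nat_le_order fun d hd => ?_
  rw [map_sub, MvPolynomial.coeff_coe, coeff_truncTotal _ hd, sub_self]

theorem order_le_order_pderiv (f : MvPowerSeries σ ℂ) (i : σ) {k : ℕ}
    (hf : ((k + 1 : ℕ) : ℕ∞) ≤ f.order) : (k : ℕ∞) ≤ (pderiv ℂ i f).order := by
  refine nat_le_order fun d hd => ?_
  rw [coeff_pderiv, coeff_of_lt_order, zero_mul]
  refine lt_of_lt_of_le ?_ hf
  rw [map_add, Finsupp.degree_single]
  exact_mod_cast Nat.add_lt_add_right hd 1

theorem aeval_sub_aeval_dvd {A : Type*} [CommRing A] [Algebra ℂ A] {a b : σ → A} {d : A}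
    (h : ∀ i, d ∣ a i - b i) (p : MvPolynomial σ ℂ) :
    d ∣ MvPolynomial.aeval a p - MvPolynomial.aeval b p := by
  induction p using MvPolynomial.induction_on with
  | C c => simp
  | add p q hp hq =>
    have := dvd_add hp hq
    rw [map_add, map_add]
    convert this using 1
    ring
  | mul_X p i hp =>
    have := dvd_add (hp.mul_right (a i)) ((h i).mul_left (MvPolynomial.aeval b p))
    rw [map_mul, map_mul, MvPolynomial.aeval_X, MvPolynomial.aeval_X]
    convert this using 1
    ring

/-- Taylor's formula with quadratic remainder. Both sides obey a Leibniz rule up to a product of two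
differences, so induction on monomials suffices. -/
theorem aeval_taylor_dvd [Fintype σ] {A : Type*} [CommRing A] [Algebra ℂ A] {a b : σ → A} {d : A}
    (h : ∀ i, d ∣ a i - b i) (p : MvPolynomial σ ℂ) :
    d ^ 2 ∣ MvPolynomial.aeval a p - MvPolynomial.aeval b p -
      ∑ i, (a i - b i) * MvPolynomial.aeval b (MvPolynomial.pderiv i p) := by
  classical
  induction p using MvPolynomial.induction_on with
  | C c => simp
  | add p q hp hq =>
    have := dvd_add hp hq
    simp only [map_add, mul_add, Finset.sum_add_distrib]
    convert this using 1
    ring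
  | mul_X p j hp =>
    have h1 := aeval_sub_aeval_dvd h p
    have h2 : d ^ 2 ∣ (MvPolynomial.aeval a p - MvPolynomial.aeval b p) * (a j - b j) := by
      rw [sq]; exact mul_dvd_mul h1 (h j)
    have := dvd_add (hp.mul_right (b j)) h2
    have h3 : ∑ i, (a i - b i) * MvPolynomial.aeval b (MvPolynomial.pderiv i
        (p * MvPolynomial.X j)) =
        (∑ i, (a i - b i) * MvPolynomial.aeval b (MvPolynomial.pderiv i p)) * b j +
          MvPolynomial.aeval b p * (a j - b j) := by
      simp only [Derivation.leibniz, MvPolynomial.pderiv_X, smul_eq_mul, map_add, map_mul,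
        MvPolynomial.aeval_X, mul_add, Finset.sum_add_distrib]
      rw [add_comm, Finset.sum_mul]
      congr 1
      · exact Finset.sum_congr rfl fun i _ => by ring
      · rw [Finset.sum_eq_single j]
        · simp; ring
        · intro i _ hi
          simp [hi.symm]
        · simp
    rw [h3, map_mul, map_mul, MvPolynomial.aeval_X, MvPolynomial.aeval_X]
    convert this using 1
    ring

variable [Finite τ]

/-- A given coefficient of a substitution only sees a truncation of `f`, and for polynomials the
divisibility is algebraic. -/
theorem subst_sub_subst_dvd {a b : σ → MvPowerSeries τ ℂ} (ha : ∀ i, constantCoeff (a i) = 0)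
    (hb : ∀ i, constantCoeff (b i) = 0) {s : τ} {n : ℕ} (h : ∀ i, X s ^ n ∣ a i - b i)
    (f : MvPowerSeries σ ℂ) : X s ^ n ∣ f.subst a - f.subst b := by
  rw [X_pow_dvd_iff]
  intro e he
  set p := truncTotal (e.degree + 1) f
  have key : ∀ c : σ → MvPowerSeries τ ℂ, (∀ i, constantCoeff (c i) = 0) →
      coeff e (f.subst c) = coeff e (MvPolynomial.aeval c p) := by
    intro c hc
    rw [← subst_coe, ← sub_eq_zero, ← map_sub, ← subst_sub (hasSubst_of_zero hc)]
    refine coeff_of_lt_order (lt_of_lt_of_le ?_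
      ((order_sub_truncTotal f (e.degree + 1)).trans (order_le_order_subst hc _)))
    exact_mod_cast Nat.lt_succ_self _
  rw [map_sub, key a ha, key b hb, ← map_sub]
  exact X_pow_dvd_iff.mp (aeval_sub_aeval_dvd h p) e he

theorem subst_taylor_dvd [Fintype σ] {a b : σ → MvPowerSeries τ ℂ}
    (ha : ∀ i, constantCoeff (a i) = 0)
    (hb : ∀ i, constantCoeff (b i) = 0) {s : τ} {n : ℕ} (h : ∀ i, X s ^ n ∣ a i - b i)
    (f : MvPowerSeries σ ℂ) :
    X s ^ (2 * n) ∣ f.subst a - f.subst b - ∑ i, (a i - b i) * (pderiv ℂ i f).subst b := by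
  rw [X_pow_dvd_iff]
  intro e he
  set k := e.degree + 1 with hk
  -- One degree more than the coefficient itself requires, since the partial derivatives of the
  -- remainder lose one order.
  set p := truncTotal (k + 1) f with hp
  set r : MvPowerSeries σ ℂ := f - p with hr
  have hro : ((k + 1 : ℕ) : ℕ∞) ≤ r.order := order_sub_truncTotal f (k + 1)
  have hlt : ∀ g : MvPowerSeries τ ℂ, (k : ℕ∞) ≤ g.order → coeff e g = 0 := by
    intro g hg
    refine coeff_of_lt_order (lt_of_lt_of_le ?_ hg)
    exact_mod_cast Nat.lt_succ_self _
  have hf : f = p + r := by simp [hr]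
  have hsplit : f.subst a - f.subst b - ∑ i, (a i - b i) * (pderiv ℂ i f).subst b =
      (MvPolynomial.aeval a p - MvPolynomial.aeval b p -
        ∑ i, (a i - b i) * MvPolynomial.aeval b (MvPolynomial.pderiv i p)) +
      (r.subst a - r.subst b - ∑ i, (a i - b i) * (pderiv ℂ i r).subst b) := by
    rw [hf, subst_add (hasSubst_of_zero ha), subst_add (hasSubst_of_zero hb)]
    simp only [map_add, subst_add (hasSubst_of_zero hb), mul_add, Finset.sum_add_distrib,
      pderiv_coe, subst_coe]
    ring
  have hk1 : (k : ℕ∞) ≤ ((k + 1 : ℕ) : ℕ∞) := by exact_mod_cast Nat.le_succ k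
  have hrest : coeff e (r.subst a - r.subst b -
      ∑ i, (a i - b i) * (pderiv ℂ i r).subst b) = 0 := by
    rw [map_sub, map_sub, hlt _ (hk1.trans (hro.trans (order_le_order_subst ha r))),
      hlt _ (hk1.trans (hro.trans (order_le_order_subst hb r))), map_sum, Finset.sum_eq_zero]
    · simp
    · intro i _
      refine hlt _ ?_
      have h1 := (order_le_order_pderiv r i hro).trans (order_le_order_subst hb _)
      exact (h1.trans le_add_self).trans le_order_mul
  rw [hsplit, map_add, hrest, add_zero]
  refine X_pow_dvd_iff.mp ?_ e he
  rw [mul_comm 2 n, pow_mul]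
  exact aeval_taylor_dvd h p

theorem constantCoeff_subst_zero {a : σ → MvPowerSeries τ ℂ} (ha : ∀ i, constantCoeff (a i) = 0)
    (f : MvPowerSeries σ ℂ) : constantCoeff (f.subst a) = constantCoeff f := by
  have h := order_le_order_subst ha (f - C (constantCoeff f))
  have h1 : (1 : ℕ∞) ≤ (f - C (constantCoeff f)).order :=
    one_le_order_iff_constCoeff_eq_zero.mpr (by simp)
  have h2 := one_le_order_iff_constCoeff_eq_zero.mp (h1.trans h)
  rw [subst_sub (hasSubst_of_zero ha), map_sub, subst_C] at h2
  simpa [sub_eq_zero] using h2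

end Substitution

/-! ### The chain rule at the origin -/

section LinearPart

variable {σ τ : Type*} [Fintype σ] [Finite τ]

theorem linearCoeff_mul (i : τ) (f g : MvPowerSeries τ ℂ) :
    coeff (Finsupp.single i 1) (f * g) =
      coeff (Finsupp.single i 1) f * constantCoeff g +
        constantCoeff f * coeff (Finsupp.single i 1) g := by
  classical
  have h := coeff_pderiv (i := i) (f * g) 0
  have hf := coeff_pderiv (i := i) f 0
  have hg := coeff_pderiv (i := i) g 0
  simp only [zero_add, Finsupp.coe_zero, Pi.zero_apply, Nat.cast_zero, mul_one] at h hf hg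
  rw [← h, ← hf, ← hg, Derivation.leibniz]
  simp only [smul_eq_mul, coeff_zero_eq_constantCoeff_apply, map_add, map_mul]
  ring

/-- Subtracting the affine part of `f` leaves a series of order at least two, and substitution
cannot lower this order. -/
theorem linearCoeff_subst {a : σ → MvPowerSeries τ ℂ} (ha : ∀ i, constantCoeff (a i) = 0)
    (f : MvPowerSeries σ ℂ) (i : τ) :
    coeff (Finsupp.single i 1) (f.subst a) =
      ∑ s, coeff (Finsupp.single s 1) f * coeff (Finsupp.single i 1) (a s) := by
  classical
  have hX : ∀ s (k : σ), coeff (Finsupp.single s 1) (X k : MvPowerSeries σ ℂ) =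
      if s = k then 1 else 0 := by
    intro s k
    rw [coeff_X]
    simp [Finsupp.single_left_inj]
  set l : MvPowerSeries σ ℂ := C (constantCoeff f) +
    ∑ s, C (coeff (Finsupp.single s 1) f) * X s with hl
  have hord : ((2 : ℕ) : ℕ∞) ≤ (f - l).order := by
    refine nat_le_order fun d hd => ?_
    rcases Nat.lt_or_ge d.degree 1 with h | h
    · have h0 : d = 0 := (Finsupp.degree_eq_zero_iff d).mp (by omega)
      subst h0
      simp [hl]
    · have h1 : d.degree = 1 := by omega
      obtain ⟨k, rfl⟩ : ∃ k, d = Finsupp.single k 1 := by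
        obtain ⟨k, hk⟩ : ∃ k, d k ≠ 0 := by
          by_contra! h'
          have : d = 0 := Finsupp.ext h'
          simp [this] at h1
        refine ⟨k, ?_⟩
        have hle : Finsupp.single k 1 ≤ d := by
          rw [Finsupp.single_le_iff]; omega
        obtain ⟨c, rfl⟩ := exists_add_of_le hle
        rw [map_add, Finsupp.degree_single] at h1
        have : c = 0 := (Finsupp.degree_eq_zero_iff c).mp (by omega)
        simp [this]
      simp [hl, coeff_C, hX, Finset.sum_ite_eq]
  have h0 : coeff (Finsupp.single i 1) ((f - l).subst a) = 0 := by
    refine coeff_of_lt_order (lt_of_lt_of_le ?_ (hord.trans (order_le_order_subst ha _)))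
    rw [Finsupp.degree_single]
    norm_num
  have hs := hasSubst_of_zero ha
  rw [subst_sub hs, map_sub, sub_eq_zero] at h0
  rw [h0, hl, subst_add hs, map_add]
  rw [← substAlgHom_apply hs (∑ s, _), map_sum, map_sum]
  simp only [substAlgHom_apply, subst_mul hs, subst_C, subst_X hs]
  simp [coeff_C]

end LinearPart

/-! ### Adic limits with respect to one variable -/

section Limits

/-- The coefficient at `e` is constant from index `e s + 1` on, and the limit takes this stable
value. -/
theorem exists_limit {σ : Type*} (s : σ) (a : ℕ → MvPowerSeries σ ℂ)
    (h : ∀ n, X s ^ n ∣ a (n + 1) - a n) :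
    ∃ l : MvPowerSeries σ ℂ, ∀ n, X s ^ n ∣ l - a n := by
  have hstep : ∀ (e : σ →₀ ℕ) n k, e s < n → coeff e (a (n + k)) = coeff e (a n) := by
    intro e n k hn
    induction k with
    | zero => rfl
    | succ k ih =>
      have h1 := X_pow_dvd_iff.mp (h (n + k)) e (by omega)
      rw [map_sub, sub_eq_zero] at h1
      rw [← add_assoc, h1, ih]
  let l : MvPowerSeries σ ℂ := fun e => coeff e (a (e s + 1))
  refine ⟨l, fun n => X_pow_dvd_iff.mpr fun e he => ?_⟩
  rw [map_sub, sub_eq_zero]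
  change coeff e (a (e s + 1)) = _
  obtain ⟨k, rfl⟩ := Nat.exists_eq_add_of_le (Nat.succ_le_of_lt he)
  exact (hstep e (e s + 1) k (Nat.lt_succ_self _)).symm

theorem eq_zero_of_forall_dvd {σ : Type*} (s : σ) {f : MvPowerSeries σ ℂ}
    (h : ∀ n, X s ^ n ∣ f) : f = 0 := by
  ext e
  exact X_pow_dvd_iff.mp (h (e s + 1)) e (Nat.lt_succ_self _)

end Limits

/-! ### Operators that differ from the identity by raising the order -/

section Inverse

/-- A linear endomorphism of a space of power series that differs from the identity by an
operator raising the order is bijective. -/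
theorem bijective_of_raises_order {σ : Type*} [Finite σ]
    (φ : MvPowerSeries σ ℂ →ₗ[ℂ] MvPowerSeries σ ℂ)
    (h : ∀ f, f.order + 1 ≤ (φ f - f).order) : Function.Bijective φ := by
  constructor
  · rw [injective_iff_map_eq_zero]
    intro f hf
    have h1 := h f
    rw [hf, zero_sub, order_neg] at h1
    by_contra hne
    have h2 : f.order ≠ ⊤ := by rwa [Ne, order_eq_top_iff]
    exact absurd h1 (not_le.mpr (ENat.lt_add_one_iff h2 |>.mpr le_rfl))
  · intro g
    -- Neumann series: `φ = id - T` and `T` raises the order, so the partial sums of `T^k g`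
    -- converge to a preimage of `g`.
    set T : MvPowerSeries σ ℂ →ₗ[ℂ] MvPowerSeries σ ℂ := LinearMap.id - φ with hT
    have hTo : ∀ f, f.order + 1 ≤ (T f).order := by
      intro f
      have : T f = -(φ f - f) := by simp [hT]
      rw [this, order_neg]
      exact h f
    have hpow : ∀ n : ℕ, (n : ℕ∞) ≤ ((T ^ n) g).order := by
      intro n
      induction n with
      | zero => simp
      | succ n ih =>
        rw [pow_succ']
        calc ((n + 1 : ℕ) : ℕ∞) ≤ ((T ^ n) g).order + 1 := by push_cast; gcongr
          _ ≤ _ := hTo _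
    set P : ℕ → MvPowerSeries σ ℂ := fun n => ∑ k ∈ Finset.range n, (T ^ k) g with hP
    have hφP : ∀ n, φ (P n) = g - (T ^ n) g := by
      intro n
      have : φ = LinearMap.id - T := by simp [hT]
      induction n with
      | zero => simp [hP]
      | succ n ih =>
        have e : P (n + 1) = P n + (T ^ n) g := by simp [hP, Finset.sum_range_succ]
        rw [e, map_add, ih, this, pow_succ']
        simp
    set l : MvPowerSeries σ ℂ := fun e => coeff e (P (e.degree + 1)) with hl
    have hstep : ∀ (e : σ →₀ ℕ) n k, e.degree < n → coeff e (P (n + k)) = coeff e (P n) := by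
      intro e n k hn
      induction k with
      | zero => rfl
      | succ k ih =>
        have e1 : P (n + (k + 1)) = P (n + k) + (T ^ (n + k)) g := by
          simp [hP, ← add_assoc, Finset.sum_range_succ]
        rw [e1, map_add, ih, coeff_of_lt_order (lt_of_lt_of_le _ (hpow (n + k))), add_zero]
        exact_mod_cast (by omega)
    have hlP : ∀ n : ℕ, (n : ℕ∞) ≤ (l - P n).order := by
      intro n
      refine nat_le_order fun e he => ?_
      rw [map_sub, sub_eq_zero]
      change coeff e (P (e.degree + 1)) = _
      obtain ⟨k, rfl⟩ := Nat.exists_eq_add_of_le (Nat.succ_le_of_lt he)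
      exact (hstep e (e.degree + 1) k (Nat.lt_succ_self _)).symm
    refine ⟨l, ?_⟩
    have hφo : ∀ f, f.order ≤ (φ f).order := by
      intro f
      have e1 : φ f = (φ f - f) + f := by ring
      rw [e1]
      refine le_trans (le_min ?_ le_rfl) min_order_le_add
      exact le_trans le_self_add (h f)
    ext e
    rw [← sub_eq_zero, ← map_sub]
    set n := e.degree + 1
    have e2 : φ l - g = φ (l - P n) + -((T ^ n) g) := by
      rw [map_sub, hφP]; ring
    rw [e2]
    refine coeff_of_lt_order (lt_of_lt_of_le (b := (n : ℕ∞)) ?_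
      (le_trans (le_min ?_ ?_) min_order_le_add))
    · exact_mod_cast Nat.lt_succ_self _
    · exact (hlP n).trans (hφo _)
    · rw [order_neg]; exact hpow n

end Inverse

/-! ### Exponent vectors in two, three and four variables -/

section Exponents

@[simp] theorem exp2_zero (a b : ℕ) : exp2 a b 0 = a := rfl
@[simp] theorem exp2_one (a b : ℕ) : exp2 a b 1 = b := rfl
@[simp] theorem exp3_zero (a b c : ℕ) : exp3 a b c 0 = a := rfl
@[simp] theorem exp3_one (a b c : ℕ) : exp3 a b c 1 = b := rfl
@[simp] theorem exp3_two (a b c : ℕ) : exp3 a b c 2 = c := rfl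

theorem eq_exp2 (e : Fin 2 →₀ ℕ) : e = exp2 (e 0) (e 1) := by
  ext i; fin_cases i <;> rfl

theorem eq_exp3 (e : Fin 3 →₀ ℕ) : e = exp3 (e 0) (e 1) (e 2) := by
  ext i; fin_cases i <;> rfl

theorem exp2_inj {a b a' b' : ℕ} : exp2 a b = exp2 a' b' ↔ a = a' ∧ b = b' :=
  ⟨fun h => ⟨congrArg (· 0) h, congrArg (· 1) h⟩, fun h => by rw [h.1, h.2]⟩

theorem exp3_inj {a b c a' b' c' : ℕ} : exp3 a b c = exp3 a' b' c' ↔ a = a' ∧ b = b' ∧ c = c' :=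
  ⟨fun h => ⟨congrArg (· 0) h, congrArg (· 1) h, congrArg (· 2) h⟩,
    fun h => by rw [h.1, h.2.1, h.2.2]⟩

theorem exp2_one_zero : exp2 1 0 = Finsupp.single 0 1 := by
  ext i; fin_cases i <;> simp [exp2]

theorem exp2_zero_one : exp2 0 1 = Finsupp.single 1 1 := by
  ext i; fin_cases i <;> simp [exp2]

theorem exp4_first : exp4 1 0 0 0 = Finsupp.single 0 1 := by
  ext i; fin_cases i <;> simp [exp4]

theorem exp4_second : exp4 0 1 0 0 = Finsupp.single 1 1 := by
  ext i; fin_cases i <;> simp [exp4]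

theorem ext_exp2 {f g : MvPowerSeries (Fin 2) ℂ}
    (h : ∀ a b, coeff (exp2 a b) f = coeff (exp2 a b) g) : f = g := by
  ext e; rw [eq_exp2 e]; exact h _ _

theorem ext_exp3 {f g : MvPowerSeries (Fin 3) ℂ}
    (h : ∀ a b c, coeff (exp3 a b c) f = coeff (exp3 a b c) g) : f = g := by
  ext e; rw [eq_exp3 e]; exact h _ _ _

theorem exp3_zero_eq : exp3 0 0 0 = 0 := by
  ext i; fin_cases i <;> rfl

theorem exp2_zero_eq : exp2 0 0 = 0 := by
  ext i; fin_cases i <;> rfl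

end Exponents

/-! ### The formal inverse function theorem -/

section Inverse

variable {σ : Type*} [Fintype σ]

/-- The error of a product is one error times a factor of full order. The induction must therefore
carry the order of the unperturbed monomial along with that of the error. -/
theorem le_order_aeval_monomial_sub {a : σ → MvPowerSeries σ ℂ}
    (ha : ∀ i, (2 : ℕ∞) ≤ (a i - X i).order) (d : σ →₀ ℕ) :
    (d.degree : ℕ∞) + 1 ≤ ((d.prod fun i k => a i ^ k) -
      (d.prod fun i k => (X i : MvPowerSeries σ ℂ) ^ k)).order := by
  classical
  have key : ∀ (x y x' y' : MvPowerSeries σ ℂ) (p q : ℕ), (p : ℕ∞) + 1 ≤ (x - x').order →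
      (q : ℕ∞) + 1 ≤ (y - y').order → (p : ℕ∞) ≤ x'.order → (q : ℕ∞) ≤ y'.order →
      ((p + q : ℕ) : ℕ∞) + 1 ≤ (x * y - x' * y').order ∧ ((p + q : ℕ) : ℕ∞) ≤ (x' * y').order := by
    intro x y x' y' p q hx hy hx' hy'
    have hyo : (q : ℕ∞) ≤ y.order := by
      have : y = (y - y') + y' := by ring
      rw [this]
      exact le_trans (le_min (le_trans le_self_add hy) hy') min_order_le_add
    constructor
    · have e : x * y - x' * y' = (x - x') * y + x' * (y - y') := by ring
      rw [e]
      refine le_trans (le_min ?_ ?_) min_order_le_add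
      · refine le_trans ?_ le_order_mul
        calc ((p + q : ℕ) : ℕ∞) + 1 = ((p : ℕ∞) + 1) + q := by push_cast; ring
          _ ≤ _ := add_le_add hx hyo
      · refine le_trans ?_ le_order_mul
        calc ((p + q : ℕ) : ℕ∞) + 1 = (p : ℕ∞) + (q + 1) := by push_cast; ring
          _ ≤ _ := add_le_add hx' hy
    · refine le_trans ?_ le_order_mul
      push_cast
      exact add_le_add hx' hy'
  suffices h : (d.degree : ℕ∞) + 1 ≤ ((d.prod fun i k => a i ^ k) -
      (d.prod fun i k => (X i : MvPowerSeries σ ℂ) ^ k)).order ∧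
      (d.degree : ℕ∞) ≤ (d.prod fun i k => (X i : MvPowerSeries σ ℂ) ^ k).order from h.1
  induction d using Finsupp.induction_linear with
  | zero => simp
  | add d e hd he =>
    rw [Finsupp.prod_add_index' (by simp) (by intros; rw [pow_add]),
      Finsupp.prod_add_index' (by simp) (by intros; rw [pow_add]), map_add]
    exact key _ _ _ _ _ _ hd.1 he.1 hd.2 he.2
  | single i k =>
    rw [Finsupp.prod_single_index (by simp), Finsupp.prod_single_index (by simp),
      Finsupp.degree_single]
    induction k with
    | zero => simp
    | succ k ih =>
      rw [pow_succ, pow_succ]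
      refine key _ _ _ _ k 1 ih.1 ?_ ih.2 ?_
      · refine le_trans (le_of_eq ?_) (ha i)
        norm_num
      · exact_mod_cast one_le_order_iff_constCoeff_eq_zero.mpr (by simp)

/-- With `n` the order of `f`, the truncation below degree `n + 1` consists of monomials of degree
at least `n`, each perturbed only in higher order; the rest already has order `n + 1`. -/
theorem order_add_one_le_subst_sub {a : σ → MvPowerSeries σ ℂ}
    (ha0 : ∀ i, constantCoeff (a i) = 0)
    (ha : ∀ i, (2 : ℕ∞) ≤ (a i - X i).order) (f : MvPowerSeries σ ℂ) :
    f.order + 1 ≤ (f.subst a - f).order := by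
  classical
  rcases eq_or_ne f 0 with rfl | hf
  · have : (0 : MvPowerSeries σ ℂ).subst a = 0 := by
      rw [← substAlgHom_apply (hasSubst_of_zero ha0), map_zero]
    simp [this]
  obtain ⟨n, hn⟩ : ∃ n : ℕ, f.order = n := ⟨_, (ne_zero_iff_order_finite.mp hf).symm⟩
  rw [hn]
  set p := truncTotal (n + 1) f with hp
  have e : f.subst a - f = (MvPolynomial.aeval a p - (p : MvPowerSeries σ ℂ)) +
      ((f - p).subst a + -(f - p)) := by
    rw [subst_sub (hasSubst_of_zero ha0), subst_coe]; ring
  have h2 := order_sub_truncTotal f (n + 1)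
  rw [e]
  refine le_trans (le_min ?_ (le_trans (le_min ?_ ?_) min_order_le_add)) min_order_le_add
  · have hX : (p : MvPowerSeries σ ℂ) = MvPolynomial.aeval X p := by
      rw [← subst_coe, subst_self]; rfl
    rw [hX, MvPolynomial.aeval_def, MvPolynomial.aeval_def, MvPolynomial.eval₂_eq',
      MvPolynomial.eval₂_eq', ← Finset.sum_sub_distrib]
    refine le_order fun d hd => ?_
    rw [map_sum]
    refine Finset.sum_eq_zero fun c hc => ?_
    rw [← mul_sub, MvPowerSeries.algebraMap_apply, coeff_C_mul]
    have hcn : n ≤ c.degree := by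
      by_contra! hlt
      rw [MvPolynomial.mem_support_iff, hp, coeff_truncTotal _ (by omega)] at hc
      exact hc (coeff_of_lt_order (by rw [hn]; exact_mod_cast hlt))
    have h3 := le_order_aeval_monomial_sub ha c
    rw [Finsupp.prod_fintype _ _ (by simp), Finsupp.prod_fintype _ _ (by simp)] at h3
    rw [coeff_of_lt_order (lt_of_lt_of_le hd (le_trans _ h3)), mul_zero]
    gcongr
  · exact_mod_cast h2.trans (order_le_order_subst ha0 _)
  · rw [order_neg]; exact_mod_cast h2

theorem bijective_subst_of_tangent_identity {a : σ → MvPowerSeries σ ℂ}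
    (ha0 : ∀ i, constantCoeff (a i) = 0) (ha : ∀ i, (2 : ℕ∞) ≤ (a i - X i).order) :
    Function.Bijective (subst a : MvPowerSeries σ ℂ → MvPowerSeries σ ℂ) := by
  have := bijective_of_raises_order (substAlgHom (R := ℂ) (hasSubst_of_zero ha0)).toLinearMap
    (fun f => by
      simpa [substAlgHom_apply] using order_add_one_le_subst_sub ha0 ha f)
  convert this using 1
  funext f
  exact (substAlgHom_apply (hasSubst_of_zero ha0) f).symm

theorem two_le_order {σ : Type*} {f : MvPowerSeries σ ℂ} (h0 : constantCoeff f = 0)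
    (h1 : ∀ i, coeff (Finsupp.single i 1) f = 0) : (2 : ℕ∞) ≤ f.order := by
  refine nat_le_order (n := 2) fun d hd => ?_
  rcases Nat.lt_or_ge d.degree 1 with h | h
  · rw [(Finsupp.degree_eq_zero_iff d).mp (by omega)]
    simpa using h0
  · obtain ⟨k, hk⟩ : ∃ k, d k ≠ 0 := by
      by_contra! h'
      have : d = 0 := Finsupp.ext h'
      simp [this] at h
    have hle : Finsupp.single k 1 ≤ d := by
      rw [Finsupp.single_le_iff]; omega
    obtain ⟨c, rfl⟩ := exists_add_of_le hle
    rw [map_add, Finsupp.degree_single] at hd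
    have : c = 0 := (Finsupp.degree_eq_zero_iff c).mp (by omega)
    rw [this, add_zero]
    exact h1 k

/-- The formal inverse function theorem in two variables. -/
theorem IsInvertibleMap.exists_inverse {H : FormalMap} (hH : IsInvertibleMap H) :
    ∃ B : FormalMap, (∀ i, constantCoeff (B i) = 0) ∧ (∀ i, (B i).subst H = X i) ∧
      ∀ i, (H i).subst B = X i := by
  obtain ⟨h0, hD⟩ := hH
  rw [exp2_one_zero, exp2_zero_one] at hD
  set a := coeff (Finsupp.single 0 1) (H 0) with ha
  set b := coeff (Finsupp.single 1 1) (H 0) with hb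
  set c := coeff (Finsupp.single 0 1) (H 1) with hc
  set d := coeff (Finsupp.single 1 1) (H 1) with hd
  set D := a * d - b * c with hDdef
  -- `L` is the inverse of the linear part of `H`, which makes `L ∘ H` tangent to the identity.
  set L : FormalMap := ![C (d / D) * X 0 - C (b / D) * X 1, C (a / D) * X 1 - C (c / D) * X 0]
    with hL
  have hL0 : ∀ i, constantCoeff (L i) = 0 := by
    intro i; fin_cases i <;> simp [hL]
  have hs := hasSubst_of_zero h0
  have hsL := hasSubst_of_zero hL0
  set H1 : FormalMap := fun i => (L i).subst H with hH1
  have e0 : H1 0 = C (d / D) * H 0 - C (b / D) * H 1 := by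
    simp [hH1, hL, subst_sub hs, subst_mul hs, subst_X hs, subst_C]
  have e1 : H1 1 = C (a / D) * H 1 - C (c / D) * H 0 := by
    simp [hH1, hL, subst_sub hs, subst_mul hs, subst_X hs, subst_C]
  have hH10 : ∀ i, constantCoeff (H1 i) = 0 := by
    intro i; fin_cases i
    · change constantCoeff (H1 0) = 0; rw [e0]; simp [h0]
    · change constantCoeff (H1 1) = 0; rw [e1]; simp [h0]
  have hbij : Function.Bijective (subst H1 : MvPowerSeries (Fin 2) ℂ → _) := by
    refine bijective_subst_of_tangent_identity hH10 fun i => two_le_order ?_ fun k => ?_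
    · simp [hH10]
    · fin_cases i
      · change coeff _ (H1 0 - X 0) = 0
        rw [e0]
        fin_cases k
        · simp only [Fin.zero_eta, map_sub, coeff_C_mul, ← ha, ← hc, coeff_X, if_true]
          field_simp
          rw [hDdef]; ring
        · simp only [Fin.mk_one, map_sub, coeff_C_mul, ← hb, ← hd, coeff_X,
            Finsupp.single_left_inj one_ne_zero]
          simp; ring
      · change coeff _ (H1 1 - X 1) = 0
        rw [e1]
        fin_cases k
        · simp only [Fin.zero_eta, map_sub, coeff_C_mul, ← ha, ← hc, coeff_X,
            Finsupp.single_left_inj one_ne_zero]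
          simp; ring
        · simp only [Fin.mk_one, map_sub, coeff_C_mul, ← hb, ← hd, coeff_X, if_true]
          field_simp
          rw [hDdef]; ring
  have hcomp : ∀ f : MvPowerSeries (Fin 2) ℂ, (f.subst L).subst H = f.subst H1 := fun f =>
    subst_comp_subst_apply hsL hs f
  choose G hG using fun i => hbij.2 (X i : MvPowerSeries (Fin 2) ℂ)
  have hBH : ∀ i, ((G i).subst L).subst H = X i := fun i => by rw [hcomp, hG]
  -- `N` is the linear part of `H`, the inverse of `L`; hence every series factors through `L`, and
  -- injectivity passes from `L ∘ H` to `H`.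
  have hLL : ∀ f : MvPowerSeries (Fin 2) ℂ, ∃ g : MvPowerSeries (Fin 2) ℂ, f = g.subst L := by
    intro f
    set N : FormalMap := ![C a * X 0 + C b * X 1, C c * X 0 + C d * X 1] with hN
    have hN0 : ∀ i, constantCoeff (N i) = 0 := by
      intro i; fin_cases i <;> simp [hN]
    refine ⟨f.subst N, ?_⟩
    rw [subst_comp_subst_apply (hasSubst_of_zero hN0) hsL]
    have : (fun i => (N i).subst L) = X := by
      funext i
      fin_cases i
      · change (C a * X 0 + C b * X 1 : MvPowerSeries (Fin 2) ℂ).subst L = X 0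
        simp only [subst_add hsL, subst_mul hsL, subst_C, subst_X hsL]
        change C a * (C (d / D) * X 0 - C (b / D) * X 1) +
          C b * (C (a / D) * X 1 - C (c / D) * X 0) = X 0
        have h1 : (C a * C (d / D) - C b * C (c / D) : MvPowerSeries (Fin 2) ℂ) = 1 := by
          rw [← map_mul, ← map_mul, ← map_sub, ← map_one C]
          congr 1; field_simp; rw [hDdef]
        have h2 : (C a * C (b / D) - C b * C (a / D) : MvPowerSeries (Fin 2) ℂ) = 0 := by
          rw [← map_mul, ← map_mul, ← map_sub, ← map_zero C]
          congr 1; ring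
        linear_combination X 0 * h1 - X 1 * h2
      · change (C c * X 0 + C d * X 1 : MvPowerSeries (Fin 2) ℂ).subst L = X 1
        simp only [subst_add hsL, subst_mul hsL, subst_C, subst_X hsL]
        change C c * (C (d / D) * X 0 - C (b / D) * X 1) +
          C d * (C (a / D) * X 1 - C (c / D) * X 0) = X 1
        have h1 : (C d * C (a / D) - C c * C (b / D) : MvPowerSeries (Fin 2) ℂ) = 1 := by
          rw [← map_mul, ← map_mul, ← map_sub, ← map_one C]
          congr 1; field_simp; rw [hDdef]; ring
        have h2 : (C c * C (d / D) - C d * C (c / D) : MvPowerSeries (Fin 2) ℂ) = 0 := by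
          rw [← map_mul, ← map_mul, ← map_sub, ← map_zero C]
          congr 1; ring
        linear_combination X 1 * h1 + X 0 * h2
    rw [this, subst_self]; rfl
  -- The left inverse is also a right inverse: `H ∘ B ∘ H = H`, and the outer substitution of `H`
  -- can be cancelled.
  have hinj : Function.Injective (subst H : MvPowerSeries (Fin 2) ℂ → MvPowerSeries (Fin 2) ℂ) := by
    intro f g hfg
    obtain ⟨f, rfl⟩ := hLL f
    obtain ⟨g, rfl⟩ := hLL g
    simp only [hcomp] at hfg
    rw [hbij.1 hfg]
  have hB0 : ∀ i, constantCoeff ((G i).subst L) = 0 := by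
    intro i
    rw [← constantCoeff_subst_zero h0, hBH]
    simp
  refine ⟨fun i => (G i).subst L, hB0, hBH, fun i => hinj ?_⟩
  rw [subst_comp_subst_apply (hasSubst_of_zero hB0) hs, subst_X hs]
  have : (fun i => ((G i).subst L).subst H) = X := funext hBH
  rw [this, subst_self]; rfl

end Inverse

/-! ### Parametrization of the complexified hypersurface and the basic equation -/

section Parametrization

/-- The parametrization `(z, χ, u) ↦ (z, u + i f, χ, u - i f)` of the complexified hypersurface
`v = f(z, z̄, u)`. -/
def parametrization (f : MvPowerSeries (Fin 3) ℂ) : Fin 4 → MvPowerSeries (Fin 3) ℂ :=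
  ![X 0, X 2 + C Complex.I * f, X 1, X 2 - C Complex.I * f]

/-- The restriction of a holomorphic series to the hypersurface `v = f(z, z̄, u)`. -/
def hol (f : MvPowerSeries (Fin 3) ℂ) (g : MvPowerSeries (Fin 2) ℂ) : MvPowerSeries (Fin 3) ℂ :=
  g.subst (![X 0, X 2 + C Complex.I * f] : Fin 2 → MvPowerSeries (Fin 3) ℂ)

/-- The restriction of the conjugate of a holomorphic series to the hypersurface
`v = f(z, z̄, u)`. -/
def antihol (f : MvPowerSeries (Fin 3) ℂ) (g : MvPowerSeries (Fin 2) ℂ) :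
    MvPowerSeries (Fin 3) ℂ :=
  (conjSeries g).subst (![X 1, X 2 - C Complex.I * f] : Fin 2 → MvPowerSeries (Fin 3) ℂ)

/-- The coordinates `(F, F̄, Re G)` of the image of a point of `v = f(z, z̄, u)` under
`K = (F, G)`. -/
def imagePoint (f : MvPowerSeries (Fin 3) ℂ) (K : FormalMap) : Fin 3 → MvPowerSeries (Fin 3) ℂ :=
  ![hol f (K 0), antihol f (K 0), C (1 / 2) * (hol f (K 1) + antihol f (K 1))]

/-- The basic equation expressing that `K` maps the hypersurface `v = f(z, z̄, u)` into the
hypersurface `v = g(z, z̄, u)`. -/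
def basicEquation (f : MvPowerSeries (Fin 3) ℂ) (K : FormalMap) (g : MvPowerSeries (Fin 3) ℂ) :
    MvPowerSeries (Fin 3) ℂ :=
  C (1 / (2 * Complex.I)) * (hol f (K 1) - antihol f (K 1)) - g.subst (imagePoint f K)

variable {f : MvPowerSeries (Fin 3) ℂ}

theorem C_mul_C_eq_one {σ : Type*} {a b : ℂ} (h : a * b = 1) :
    (C a * C b : MvPowerSeries σ ℂ) = 1 := by
  rw [← map_mul, h, map_one]

theorem constantCoeff_conjSeries {n : ℕ} (g : MvPowerSeries (Fin n) ℂ) :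
    constantCoeff (conjSeries g) = conj (constantCoeff g) := by
  rw [conjSeries, constantCoeff_map]

theorem constantCoeff_conjSeries_eq_zero {n : ℕ} {g : MvPowerSeries (Fin n) ℂ}
    (h : constantCoeff g = 0) : constantCoeff (conjSeries g) = 0 := by
  rw [constantCoeff_conjSeries, h, map_zero]

theorem hol_args_zero (hf : constantCoeff f = 0) (i : Fin 2) :
    constantCoeff ((![X 0, X 2 + C Complex.I * f] : Fin 2 → MvPowerSeries (Fin 3) ℂ) i) = 0 := by
  fin_cases i <;> simp [hf]

theorem antihol_args_zero (hf : constantCoeff f = 0) (i : Fin 2) :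
    constantCoeff ((![X 1, X 2 - C Complex.I * f] : Fin 2 → MvPowerSeries (Fin 3) ℂ) i) = 0 := by
  fin_cases i <;> simp [hf]

theorem parametrization_zero (hf : constantCoeff f = 0) (i : Fin 4) :
    constantCoeff (parametrization f i) = 0 := by
  fin_cases i <;> simp [parametrization, hf]

theorem constantCoeff_hol (hf : constantCoeff f = 0) (g : MvPowerSeries (Fin 2) ℂ) :
    constantCoeff (hol f g) = constantCoeff g :=
  constantCoeff_subst_zero (hol_args_zero hf) g

theorem constantCoeff_antihol (hf : constantCoeff f = 0) (g : MvPowerSeries (Fin 2) ℂ) :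
    constantCoeff (antihol f g) = conj (constantCoeff g) := by
  rw [antihol, constantCoeff_subst_zero (antihol_args_zero hf), constantCoeff_conjSeries]

theorem imagePoint_zero (hf : constantCoeff f = 0) {K : FormalMap}
    (hK : ∀ i, constantCoeff (K i) = 0) (i : Fin 3) : constantCoeff (imagePoint f K i) = 0 := by
  fin_cases i <;>
    simp [imagePoint, constantCoeff_hol hf, constantCoeff_antihol hf, hK]

theorem complexify_zero {K : FormalMap} (hK : ∀ i, constantCoeff (K i) = 0) (i : Fin 4) :
    constantCoeff (complexify K i) = 0 := by
  have h1 : ∀ i, constantCoeff ((![X 0, X 1] : Fin 2 → MvPowerSeries (Fin 4) ℂ) i) = 0 := by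
    intro i; fin_cases i <;> simp
  have h2 : ∀ i, constantCoeff ((![X 2, X 3] : Fin 2 → MvPowerSeries (Fin 4) ℂ) i) = 0 := by
    intro i; fin_cases i <;> simp
  fin_cases i <;>
    simp [complexify, constantCoeff_subst_zero h1, constantCoeff_subst_zero h2, hK,
      constantCoeff_conjSeries]

theorem graph_args_zero (i : Fin 3) :
    constantCoeff ((![X 0, X 2, C (1 / 2) * (X 1 + X 3)] :
      Fin 3 → MvPowerSeries (Fin 4) ℂ) i) = 0 := by
  fin_cases i <;> simp

theorem graphSeries_subst {τ : Type*} [Finite τ] (g : MvPowerSeries (Fin 3) ℂ)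
    {a : Fin 4 → MvPowerSeries τ ℂ} (ha : ∀ i, constantCoeff (a i) = 0) :
    (graphSeries g).subst a = C (1 / (2 * Complex.I)) * (a 1 - a 3) -
      g.subst (![a 0, a 2, C (1 / 2) * (a 1 + a 3)] : Fin 3 → MvPowerSeries τ ℂ) := by
  have hs := hasSubst_of_zero ha
  rw [graphSeries, subst_sub hs, subst_mul hs, subst_sub hs, subst_X hs, subst_X hs, subst_C,
    subst_comp_subst_apply (hasSubst_of_zero graph_args_zero) hs]
  congr 2
  funext i
  fin_cases i
  · simp [subst_X hs]
  · simp [subst_X hs]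
  · change (C (1 / 2) * (X 1 + X 3) : MvPowerSeries (Fin 4) ℂ).subst a = _
    rw [subst_mul hs, subst_add hs, subst_X hs, subst_X hs, subst_C]
    rfl

theorem C_half_mul_two {σ : Type*} : (C (1 / 2) * 2 : MvPowerSeries σ ℂ) = 1 := by
  rw [show (2 : MvPowerSeries σ ℂ) = C 2 from (map_ofNat C 2).symm]
  exact C_mul_C_eq_one (by norm_num)

theorem C_inv_two_I_mul {σ : Type*} :
    (C (1 / (2 * Complex.I)) * (2 * C Complex.I) : MvPowerSeries σ ℂ) = 1 := by
  rw [show (2 : MvPowerSeries σ ℂ) = C 2 from (map_ofNat C 2).symm, ← map_mul]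
  exact C_mul_C_eq_one (by field_simp)

theorem graphSeries_subst_parametrization (hf : constantCoeff f = 0) :
    (graphSeries f).subst (parametrization f) = 0 := by
  rw [graphSeries_subst f (parametrization_zero hf)]
  have : (![parametrization f 0, parametrization f 2,
      C (1 / 2) * (parametrization f 1 + parametrization f 3)] :
      Fin 3 → MvPowerSeries (Fin 3) ℂ) = X := by
    funext i
    fin_cases i
    · rfl
    · rfl
    · change C (1 / 2) * ((X 2 + C Complex.I * f) + (X 2 - C Complex.I * f)) = X 2
      linear_combination X 2 * C_half_mul_two
  rw [this, subst_self]
  change C (1 / (2 * Complex.I)) * ((X 2 + C Complex.I * f) - (X 2 - C Complex.I * f)) - f = 0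
  linear_combination f * C_inv_two_I_mul

/-- In the coordinates `(z, χ, u, v - f)` the defining series becomes a coordinate function, and a
series vanishing on a coordinate hyperplane is divisible by the coordinate. -/
theorem graphSeries_dvd_of_subst_eq_zero (hf : constantCoeff f = 0)
    {Q : MvPowerSeries (Fin 4) ℂ} (hQ : Q.subst (parametrization f) = 0) :
    graphSeries f ∣ Q := by
  set e : Fin 3 → MvPowerSeries (Fin 4) ℂ := ![X 0, X 1, X 2] with he
  have he0 : ∀ i, constantCoeff (e i) = 0 := by intro i; fin_cases i <;> simp [he]
  set F := f.subst e with hF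
  have hF0 : constantCoeff F = 0 := by rw [hF, constantCoeff_subst_zero he0, hf]
  -- `S` expresses the old variables through the straightened ones: it is the parametrization with
  -- `f` replaced by `f + X 3`. The map `T` below introduces the straightened variables, and
  -- composing returns the identity.
  set S : Fin 4 → MvPowerSeries (Fin 4) ℂ :=
    ![X 0, X 2 + C Complex.I * (X 3 + F), X 1, X 2 - C Complex.I * (X 3 + F)] with hS
  have hS0 : ∀ i, constantCoeff (S i) = 0 := by intro i; fin_cases i <;> simp [hS, hF0]
  have hg0 : constantCoeff (graphSeries f) = 0 := by
    have h := constantCoeff_subst_zero graph_args_zero f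
    simp [graphSeries] at h ⊢
    rw [h, hf]
  set T : Fin 4 → MvPowerSeries (Fin 4) ℂ :=
    ![X 0, X 2, C (1 / 2) * (X 1 + X 3), graphSeries f] with hT
  have hT0 : ∀ i, constantCoeff (T i) = 0 := by intro i; fin_cases i <;> simp [hT, hg0]
  have hTs := hasSubst_of_zero hT0
  have hSs := hasSubst_of_zero hS0
  set Z : Fin 4 → MvPowerSeries (Fin 4) ℂ := ![X 0, X 1, X 2, 0] with hZ
  have hZ0 : ∀ i, constantCoeff (Z i) = 0 := by intro i; fin_cases i <;> simp [hZ]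
  have hZs := hasSubst_of_zero hZ0
  have hFT : F.subst T = f.subst
      (![X 0, X 2, C (1 / 2) * (X 1 + X 3)] : Fin 3 → MvPowerSeries (Fin 4) ℂ) := by
    rw [hF, subst_comp_subst_apply (hasSubst_of_zero he0) hTs]
    congr 1
    funext i
    fin_cases i <;> exact subst_X hTs _
  have hgr : graphSeries f + F.subst T = C (1 / (2 * Complex.I)) * (X 1 - X 3) := by
    rw [hFT, graphSeries]; ring
  have hST : (fun i => (S i).subst T) = X := by
    funext i
    fin_cases i
    · exact subst_X hTs _
    · change (X 2 + C Complex.I * (X 3 + F) : MvPowerSeries (Fin 4) ℂ).subst T = X 1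
      rw [subst_add hTs, subst_mul hTs, subst_add hTs, subst_C, subst_X hTs, subst_X hTs]
      change C (1 / 2) * (X 1 + X 3) + C Complex.I * (graphSeries f + F.subst T) = X 1
      rw [hgr]
      have h2 : (C Complex.I * C (1 / (2 * Complex.I)) : MvPowerSeries (Fin 4) ℂ) = C (1 / 2) := by
        rw [← map_mul]; congr 1; field_simp
      linear_combination (X 1 - X 3) * h2 + X 1 * C_half_mul_two
    · exact subst_X hTs _
    · change (X 2 - C Complex.I * (X 3 + F) : MvPowerSeries (Fin 4) ℂ).subst T = X 3
      rw [subst_sub hTs, subst_mul hTs, subst_add hTs, subst_C, subst_X hTs, subst_X hTs]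
      change C (1 / 2) * (X 1 + X 3) - C Complex.I * (graphSeries f + F.subst T) = X 3
      rw [hgr]
      have h2 : (C Complex.I * C (1 / (2 * Complex.I)) : MvPowerSeries (Fin 4) ℂ) = C (1 / 2) := by
        rw [← map_mul]; congr 1; field_simp
      linear_combination -(X 1 - X 3) * h2 + X 3 * C_half_mul_two
  have hQST : (Q.subst S).subst T = Q := by
    rw [subst_comp_subst_apply hSs hTs, hST, subst_self]; rfl
  have hZQ : (Q.subst S).subst Z = 0 := by
    have h1 : (Q.subst (parametrization f)).subst e = 0 := by
      rw [hQ, ← substAlgHom_apply (hasSubst_of_zero he0), map_zero]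
    rw [subst_comp_subst_apply (hasSubst_of_zero (parametrization_zero hf))
      (hasSubst_of_zero he0)] at h1
    rw [subst_comp_subst_apply hSs hZs, ← h1]
    congr 1
    have hes := hasSubst_of_zero he0
    have hFZ : F.subst Z = F := by
      rw [hF, subst_comp_subst_apply hes hZs]
      congr 1
      funext i
      fin_cases i <;> exact subst_X hZs _
    funext i
    fin_cases i
    · exact (subst_X hZs _).trans (subst_X hes (0 : Fin 3)).symm
    · change (X 2 + C Complex.I * (X 3 + F) : MvPowerSeries (Fin 4) ℂ).subst Z =
        (X 2 + C Complex.I * f).subst e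
      rw [subst_add hZs, subst_mul hZs, subst_add hZs, subst_C, subst_X hZs, subst_X hZs,
        subst_add hes, subst_mul hes, subst_C, subst_X hes, hFZ]
      simp [hZ, he, hF]
    · exact (subst_X hZs _).trans (subst_X hes (1 : Fin 3)).symm
    · change (X 2 - C Complex.I * (X 3 + F) : MvPowerSeries (Fin 4) ℂ).subst Z =
        (X 2 - C Complex.I * f).subst e
      rw [subst_sub hZs, subst_mul hZs, subst_add hZs, subst_C, subst_X hZs, subst_X hZs,
        subst_sub hes, subst_mul hes, subst_C, subst_X hes, hFZ]
      simp [hZ, he, hF]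
  -- Replacing `X 3` by zero changes a series only by a multiple of `X 3`.
  have hdvd : (X 3 : MvPowerSeries (Fin 4) ℂ) ^ 1 ∣ (Q.subst S).subst X - (Q.subst S).subst Z := by
    refine subst_sub_subst_dvd (by simp) hZ0 (fun i => ?_) _
    fin_cases i <;> simp [hZ]
  rw [hZQ, sub_zero, subst_self, pow_one] at hdvd
  obtain ⟨R, hR⟩ := hdvd
  refine ⟨R.subst T, ?_⟩
  rw [← hQST]
  change Q.subst S = X 3 * R at hR
  rw [hR, subst_mul hTs, subst_X hTs]
  rfl

theorem graphSeries_subst_complexify (g : MvPowerSeries (Fin 3) ℂ) (hf : constantCoeff f = 0)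
    {K : FormalMap} (hK : ∀ i, constantCoeff (K i) = 0) :
    ((graphSeries g).subst (complexify K)).subst (parametrization f) = basicEquation f K g := by
  have hp := hasSubst_of_zero (parametrization_zero hf)
  have h1 : ∀ i, constantCoeff ((![X 0, X 1] : Fin 2 → MvPowerSeries (Fin 4) ℂ) i) = 0 := by
    intro i; fin_cases i <;> simp
  have h2 : ∀ i, constantCoeff ((![X 2, X 3] : Fin 2 → MvPowerSeries (Fin 4) ℂ) i) = 0 := by
    intro i; fin_cases i <;> simp
  have hh : ∀ k : MvPowerSeries (Fin 2) ℂ,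
      (k.subst (![X 0, X 1] : Fin 2 → MvPowerSeries (Fin 4) ℂ)).subst (parametrization f) =
        hol f k := by
    intro k
    rw [subst_comp_subst_apply (hasSubst_of_zero h1) hp, hol]
    congr 1
    funext i
    fin_cases i <;> exact subst_X hp _
  have ha : ∀ k : MvPowerSeries (Fin 2) ℂ,
      ((conjSeries k).subst (![X 2, X 3] : Fin 2 → MvPowerSeries (Fin 4) ℂ)).subst
        (parametrization f) = antihol f k := by
    intro k
    rw [subst_comp_subst_apply (hasSubst_of_zero h2) hp, antihol]
    congr 1
    funext i
    fin_cases i <;> exact subst_X hp _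
  have hc : (fun i => (complexify K i).subst (parametrization f)) =
      ![hol f (K 0), hol f (K 1), antihol f (K 0), antihol f (K 1)] := by
    funext i
    fin_cases i
    · exact hh _
    · exact hh _
    · exact ha _
    · exact ha _
  rw [subst_comp_subst_apply (hasSubst_of_zero (complexify_zero hK)) hp, hc, graphSeries_subst]
  · rfl
  · intro i
    fin_cases i <;> simp [constantCoeff_hol hf, constantCoeff_antihol hf, hK]

/-- `K` maps `v = f` into `v = g` if and only if the basic equation holds. -/
theorem mapsToGraph_graphSeries_iff {g : MvPowerSeries (Fin 3) ℂ} (hf : constantCoeff f = 0)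
    {K : FormalMap} (hK : ∀ i, constantCoeff (K i) = 0) :
    MapsToGraph K (graphSeries f) g ↔ basicEquation f K g = 0 := by
  rw [← graphSeries_subst_complexify g hf hK]
  constructor
  · rintro ⟨Q, hQ⟩
    rw [hQ, subst_mul (hasSubst_of_zero (parametrization_zero hf)),
      graphSeries_subst_parametrization hf, zero_mul]
  · exact graphSeries_dvd_of_subst_eq_zero hf

end Parametrization

/-! ### Composition of maps and linear parts of defining series -/

section Composition

/-- As `P` vanishes at the origin, the linear coefficients of `P * U` are those of `P` times the
value of `U`; a nonzero one forces `U` to be a unit. Thus smoothness upgrades inclusion of ideals to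
equality. -/
theorem dvd_of_dvd_of_linearCoeff_ne_zero {τ : Type*} [Finite τ] {P Q : MvPowerSeries τ ℂ}
    (hP : constantCoeff P = 0) (h : P ∣ Q) {i : τ} (hi : coeff (Finsupp.single i 1) Q ≠ 0) :
    Q ∣ P := by
  obtain ⟨U, rfl⟩ := h
  rw [linearCoeff_mul, hP, zero_mul, add_zero] at hi
  have hU : IsUnit U := by
    rw [isUnit_iff_constantCoeff, isUnit_iff_ne_zero]
    exact right_ne_zero_of_mul hi
  obtain ⟨V, rfl⟩ := hU
  exact Units.mul_right_dvd.mpr dvd_rfl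

theorem complexify_subst {K A : FormalMap} (hA : ∀ i, constantCoeff (A i) = 0) :
    (fun i => (complexify K i).subst (complexify A)) = complexify (fun i => (K i).subst A) := by
  have hc := hasSubst_of_zero (complexify_zero hA)
  have h1 : ∀ i, constantCoeff ((![X 0, X 1] : Fin 2 → MvPowerSeries (Fin 4) ℂ) i) = 0 := by
    intro i; fin_cases i <;> simp
  have h2 : ∀ i, constantCoeff ((![X 2, X 3] : Fin 2 → MvPowerSeries (Fin 4) ℂ) i) = 0 := by
    intro i; fin_cases i <;> simp
  have hA' : ∀ i, constantCoeff ((A i).map (starRingEnd ℂ)) = 0 := fun i =>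
    constantCoeff_conjSeries_eq_zero (hA i)
  have hh : ∀ k : MvPowerSeries (Fin 2) ℂ,
      (k.subst (![X 0, X 1] : Fin 2 → MvPowerSeries (Fin 4) ℂ)).subst (complexify A) =
        (k.subst A).subst (![X 0, X 1] : Fin 2 → MvPowerSeries (Fin 4) ℂ) := by
    intro k
    rw [subst_comp_subst_apply (hasSubst_of_zero h1) hc,
      subst_comp_subst_apply (hasSubst_of_zero hA) (hasSubst_of_zero h1)]
    congr 1
    funext i
    fin_cases i <;> exact subst_X hc _
  have ha : ∀ k : MvPowerSeries (Fin 2) ℂ,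
      ((conjSeries k).subst (![X 2, X 3] : Fin 2 → MvPowerSeries (Fin 4) ℂ)).subst
        (complexify A) =
        (conjSeries (k.subst A)).subst (![X 2, X 3] : Fin 2 → MvPowerSeries (Fin 4) ℂ) := by
    intro k
    rw [subst_comp_subst_apply (hasSubst_of_zero h2) hc, conjSeries, conjSeries,
      map_subst (hasSubst_of_zero hA),
      subst_comp_subst_apply (hasSubst_of_zero hA') (hasSubst_of_zero h2)]
    congr 1
    funext i
    fin_cases i <;> exact subst_X hc _
  funext i
  fin_cases i
  · exact hh _
  · exact hh _
  · exact ha _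
  · exact ha _

theorem MapsToGraph.comp {P : MvPowerSeries (Fin 4) ℂ} {f g : MvPowerSeries (Fin 3) ℂ}
    {K A : FormalMap} (hK : ∀ i, constantCoeff (K i) = 0) (hA : ∀ i, constantCoeff (A i) = 0)
    (h1 : MapsToGraph A P f) (h2 : MapsToGraph K (graphSeries f) g) :
    MapsToGraph (fun i => (K i).subst A) P g := by
  obtain ⟨Q, hQ⟩ := h2
  have hc := hasSubst_of_zero (complexify_zero hA)
  rw [MapsToGraph, ← complexify_subst hA,
    ← subst_comp_subst_apply (hasSubst_of_zero (complexify_zero hK)) hc, hQ, subst_mul hc]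
  exact Dvd.dvd.mul_right h1 _

theorem complexify_X : complexify X = X := by
  funext i
  have h1 : ∀ i, constantCoeff ((![X 0, X 1] : Fin 2 → MvPowerSeries (Fin 4) ℂ) i) = 0 := by
    intro i; fin_cases i <;> simp
  have h2 : ∀ i, constantCoeff ((![X 2, X 3] : Fin 2 → MvPowerSeries (Fin 4) ℂ) i) = 0 := by
    intro i; fin_cases i <;> simp
  fin_cases i <;>
    simp [complexify, subst_X (hasSubst_of_zero h1), subst_X (hasSubst_of_zero h2), conjSeries]

/-- Only `v` contributes in first order. The formulas provide the nonzero linear coefficient that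
makes the pulled-back series a generator, and they identify the complex tangent space with the
kernel of the differential of `A 1`. -/
theorem linearCoeff_graphSeries_subst_complexify {f : MvPowerSeries (Fin 3) ℂ}
    (hf : ∀ i, coeff (Finsupp.single i 1) f = 0) {A : FormalMap}
    (hA : ∀ i, constantCoeff (A i) = 0) :
    coeff (exp4 1 0 0 0) ((graphSeries f).subst (complexify A)) =
        1 / (2 * Complex.I) * coeff (exp2 1 0) (A 1) ∧
      coeff (exp4 0 1 0 0) ((graphSeries f).subst (complexify A)) =
        1 / (2 * Complex.I) * coeff (exp2 0 1) (A 1) := by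
  have h1 : ∀ i, constantCoeff ((![X 0, X 1] : Fin 2 → MvPowerSeries (Fin 4) ℂ) i) = 0 := by
    intro i; fin_cases i <;> simp
  have h2 : ∀ i, constantCoeff ((![X 2, X 3] : Fin 2 → MvPowerSeries (Fin 4) ℂ) i) = 0 := by
    intro i; fin_cases i <;> simp
  have hc := complexify_zero hA
  have hv : ∀ i, constantCoeff ((![complexify A 0, complexify A 2,
      C (1 / 2) * (complexify A 1 + complexify A 3)] : Fin 3 → MvPowerSeries (Fin 4) ℂ) i) = 0 := by
    intro i; fin_cases i <;> simp [hc]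
  rw [graphSeries_subst f hc, exp4_first, exp4_second, exp2_one_zero, exp2_zero_one]
  constructor <;>
  · rw [map_sub, coeff_C_mul, linearCoeff_subst hv, Finset.sum_eq_zero (by simp [hf]), sub_zero,
      map_sub]
    congr 1
    simp [complexify, linearCoeff_subst h1, linearCoeff_subst h2, coeff_X,
      Finsupp.single_left_inj]

theorem linearCoeff_admissibleSeries {m : ℕ} (hm : 2 ≤ m) (ε : ℤˣ) (h : MvPowerSeries (Fin 3) ℂ)
    (i : Fin 3) : coeff (Finsupp.single i 1) (admissibleSeries m ε h) = 0 := by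
  obtain ⟨n, rfl⟩ := Nat.exists_eq_add_of_le hm
  have : admissibleSeries (2 + n) ε h =
      X 2 * (X 2 * (C (1 / 2) * X 2 ^ n * (C (((ε : ℤ) : ℂ)) * X 0 * X 1 + h))) := by
    rw [admissibleSeries, pow_add]; ring
  rw [this, linearCoeff_mul]
  simp

end Composition

/-! ### Restriction to the hypersurface respects the ring operations -/

section RingHoms

variable {f : MvPowerSeries (Fin 3) ℂ}

theorem hol_add (hf : constantCoeff f = 0) (a b : MvPowerSeries (Fin 2) ℂ) :
    hol f (a + b) = hol f a + hol f b := subst_add (hasSubst_of_zero (hol_args_zero hf)) a b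
theorem hol_sub (hf : constantCoeff f = 0) (a b : MvPowerSeries (Fin 2) ℂ) :
    hol f (a - b) = hol f a - hol f b := subst_sub (hasSubst_of_zero (hol_args_zero hf)) a b
theorem hol_mul (hf : constantCoeff f = 0) (a b : MvPowerSeries (Fin 2) ℂ) :
    hol f (a * b) = hol f a * hol f b := subst_mul (hasSubst_of_zero (hol_args_zero hf)) a b
theorem hol_pow (hf : constantCoeff f = 0) (a : MvPowerSeries (Fin 2) ℂ) (n : ℕ) :
    hol f (a ^ n) = hol f a ^ n := subst_pow (hasSubst_of_zero (hol_args_zero hf)) a n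
theorem hol_X_zero (hf : constantCoeff f = 0) : hol f (X 0) = X 0 :=
  subst_X (hasSubst_of_zero (hol_args_zero hf)) 0
theorem hol_X_one (hf : constantCoeff f = 0) : hol f (X 1) = X 2 + C Complex.I * f :=
  subst_X (hasSubst_of_zero (hol_args_zero hf)) 1
theorem hol_C (c : ℂ) : hol f (C c) = C c := subst_C c

theorem antihol_add (hf : constantCoeff f = 0) (a b : MvPowerSeries (Fin 2) ℂ) :
    antihol f (a + b) = antihol f a + antihol f b := by
  rw [antihol, conjSeries, map_add, subst_add (hasSubst_of_zero (antihol_args_zero hf))]; rfl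
theorem antihol_sub (hf : constantCoeff f = 0) (a b : MvPowerSeries (Fin 2) ℂ) :
    antihol f (a - b) = antihol f a - antihol f b := by
  rw [antihol, conjSeries, map_sub, subst_sub (hasSubst_of_zero (antihol_args_zero hf))]; rfl
theorem antihol_mul (hf : constantCoeff f = 0) (a b : MvPowerSeries (Fin 2) ℂ) :
    antihol f (a * b) = antihol f a * antihol f b := by
  rw [antihol, conjSeries, map_mul, subst_mul (hasSubst_of_zero (antihol_args_zero hf))]; rfl
theorem antihol_pow (hf : constantCoeff f = 0) (a : MvPowerSeries (Fin 2) ℂ) (n : ℕ) :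
    antihol f (a ^ n) = antihol f a ^ n := by
  rw [antihol, conjSeries, map_pow, subst_pow (hasSubst_of_zero (antihol_args_zero hf))]; rfl
theorem antihol_X_zero (hf : constantCoeff f = 0) : antihol f (X 0) = X 1 := by
  rw [antihol, conjSeries, map_X, subst_X (hasSubst_of_zero (antihol_args_zero hf))]; rfl
theorem antihol_X_one (hf : constantCoeff f = 0) : antihol f (X 1) = X 2 - C Complex.I * f := by
  rw [antihol, conjSeries, map_X, subst_X (hasSubst_of_zero (antihol_args_zero hf))]; rfl
theorem antihol_C (c : ℂ) : antihol f (C c) = C (conj c) := by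
  rw [antihol, conjSeries, map_C, subst_C]

end RingHoms

/-! ### The real structure -/

section Involution

/-- The involution of the series in `(z, χ, u)` that swaps `z` and `χ` and conjugates the
coefficients. -/
def conjSwap : MvPowerSeries (Fin 3) ℂ →+* MvPowerSeries (Fin 3) ℂ :=
  (rename (R := ℂ) (Equiv.swap (0 : Fin 3) 1)).toRingHom.comp (MvPowerSeries.map (starRingEnd ℂ))

theorem coeff_conjSwap (f : MvPowerSeries (Fin 3) ℂ) (k l j : ℕ) :
    coeff (exp3 k l j) (conjSwap f) = conj (coeff (exp3 l k j) f) := by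
  have h := coeff_embDomain_rename (Equiv.swap (0 : Fin 3) 1).toEmbedding
    (MvPowerSeries.map (starRingEnd ℂ) f) (exp3 l k j)
  have e : Finsupp.embDomain (Equiv.swap (0 : Fin 3) 1).toEmbedding (exp3 l k j) = exp3 k l j := by
    ext i
    have : i = (Equiv.swap (0 : Fin 3) 1).toEmbedding (Equiv.swap (0 : Fin 3) 1 i) := by simp
    rw [this, Finsupp.embDomain_apply_self]
    fin_cases i <;> rfl
  rw [e, coeff_map] at h
  exact h

theorem isRealSeries_iff {f : MvPowerSeries (Fin 3) ℂ} : IsRealSeries f ↔ conjSwap f = f := by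
  constructor
  · intro h
    refine ext_exp3 fun k l j => ?_
    rw [coeff_conjSwap, h k l j, Complex.conj_conj]
  · intro h k l j
    conv_lhs => rw [← h]
    exact coeff_conjSwap f l k j

theorem conjSwap_X_zero : conjSwap (X 0) = X 1 := by simp [conjSwap]
theorem conjSwap_X_one : conjSwap (X 1) = X 0 := by simp [conjSwap]
theorem conjSwap_X_two : conjSwap (X 2) = X 2 := by
  simp [conjSwap, Equiv.swap_apply_of_ne_of_ne]
theorem conjSwap_C (c : ℂ) : conjSwap (C c) = C (conj c) := by simp [conjSwap]

theorem constantCoeff_conjSwap (f : MvPowerSeries (Fin 3) ℂ) :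
    constantCoeff (conjSwap f) = conj (constantCoeff f) := by simp [conjSwap]

theorem conjSwap_subst {n : ℕ} {a : Fin n → MvPowerSeries (Fin 3) ℂ}
    (ha : ∀ i, constantCoeff (a i) = 0) (g : MvPowerSeries (Fin n) ℂ) :
    conjSwap (g.subst a) = (conjSeries g).subst fun i => conjSwap (a i) := by
  have ha' : ∀ i, constantCoeff ((a i).map (starRingEnd ℂ)) = 0 := fun i =>
    constantCoeff_conjSeries_eq_zero (ha i)
  change rename _ (MvPowerSeries.map (starRingEnd ℂ) (g.subst a)) = _
  rw [map_subst (hasSubst_of_zero ha), rename_eq_subst,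
    subst_comp_subst_apply (hasSubst_of_zero ha') (HasSubst.X_comp _)]
  congr 1
  funext i
  rw [← rename_eq_subst]
  rfl

/-- Swapping `z` and `χ` is an involution, so reality can be read as saying that conjugated
coefficients amount to exchanged variables. -/
theorem conjSeries_eq_of_real {g : MvPowerSeries (Fin 3) ℂ} (hg : conjSwap g = g) :
    conjSeries g = g.subst (![X 1, X 0, X 2] : Fin 3 → MvPowerSeries (Fin 3) ℂ) := by
  have e : (![X 1, X 0, X 2] : Fin 3 → MvPowerSeries (Fin 3) ℂ) =
      X ∘ (Equiv.swap (0 : Fin 3) 1) := by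
    funext i; fin_cases i <;> simp [Equiv.swap_apply_of_ne_of_ne]
  rw [e, ← rename_eq_subst]
  conv_rhs => rw [← hg]
  change _ = rename _ (rename _ (conjSeries g))
  rw [rename_rename]
  have : (Equiv.swap (0 : Fin 3) 1 : Fin 3 → Fin 3) ∘ (Equiv.swap (0 : Fin 3) 1) = id := by
    funext i; simp
  simp [this]

variable {f : MvPowerSeries (Fin 3) ℂ}

theorem conjSwap_hol (hf : constantCoeff f = 0) (hr : conjSwap f = f)
    (g : MvPowerSeries (Fin 2) ℂ) : conjSwap (hol f g) = antihol f g := by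
  rw [hol, conjSwap_subst (hol_args_zero hf), antihol]
  congr 1
  funext i
  fin_cases i
  · exact conjSwap_X_zero
  · change conjSwap (X 2 + C Complex.I * f) = X 2 - C Complex.I * f
    rw [map_add, map_mul, conjSwap_X_two, conjSwap_C, hr, Complex.conj_I, map_neg]
    ring

theorem conjSwap_conjSwap (g : MvPowerSeries (Fin 3) ℂ) : conjSwap (conjSwap g) = g := by
  refine ext_exp3 fun k l j => ?_
  rw [coeff_conjSwap, coeff_conjSwap, Complex.conj_conj]

theorem conjSwap_antihol (hf : constantCoeff f = 0) (hr : conjSwap f = f)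
    (g : MvPowerSeries (Fin 2) ℂ) : conjSwap (antihol f g) = hol f g := by
  rw [← conjSwap_hol hf hr, conjSwap_conjSwap]

/-- The involution exchanges `K` restricted to the hypersurface with its conjugate, and `1 / 2i`
changes sign together with the difference. Hence the error terms met in the iteration are real,
which is what makes solutions with real `b` available. -/
theorem conjSwap_basicEquation (hf : constantCoeff f = 0) (hr : conjSwap f = f)
    {K : FormalMap} (hK : ∀ i, constantCoeff (K i) = 0)
    {g : MvPowerSeries (Fin 3) ℂ} (hg : conjSwap g = g) :
    conjSwap (basicEquation f K g) = basicEquation f K g := by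
  have hI := imagePoint_zero hf hK
  have h1 : ∀ i, constantCoeff ((![X 1, X 0, X 2] : Fin 3 → MvPowerSeries (Fin 3) ℂ) i) = 0 := by
    intro i; fin_cases i <;> simp
  have h2 : ∀ i, constantCoeff (conjSwap (imagePoint f K i)) = 0 := fun i => by
    rw [constantCoeff_conjSwap, hI, map_zero]
  rw [basicEquation, map_sub, map_mul, map_sub, conjSwap_hol hf hr, conjSwap_antihol hf hr,
    conjSwap_C, conjSwap_subst hI, conjSeries_eq_of_real hg,
    subst_comp_subst_apply (hasSubst_of_zero h1) (hasSubst_of_zero h2)]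
  congr 1
  · have : conj (1 / (2 * Complex.I)) = -(1 / (2 * Complex.I)) := by
      rw [map_div₀, map_mul, Complex.conj_I]
      simp [div_neg, map_ofNat]
    rw [this, map_neg]
    ring
  · congr 1
    funext i
    fin_cases i
    · refine (subst_X (hasSubst_of_zero h2) 1).trans ?_
      exact conjSwap_antihol hf hr _
    · refine (subst_X (hasSubst_of_zero h2) 0).trans ?_
      exact conjSwap_hol hf hr _
    · refine (subst_X (hasSubst_of_zero h2) 2).trans ?_
      change conjSwap (C (1 / 2) * (hol f (K 1) + antihol f (K 1))) = _
      rw [map_mul, map_add, conjSwap_hol hf hr, conjSwap_antihol hf hr, conjSwap_C, add_comm]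
      simp [imagePoint, map_ofNat]

end Involution

/-! ### Congruences modulo powers of `u` -/

section Congruence

/-- Congruence of series in `(z, χ, u)` modulo `u ^ k`. -/
def CongrMod (k : ℕ) (x y : MvPowerSeries (Fin 3) ℂ) : Prop := X 2 ^ k ∣ x - y

variable {k : ℕ} {x y z x' y' : MvPowerSeries (Fin 3) ℂ}

theorem CongrMod.refl (k : ℕ) (x : MvPowerSeries (Fin 3) ℂ) : CongrMod k x x := by
  simp [CongrMod]

theorem CongrMod.of_eq (h : x = y) : CongrMod k x y := h ▸ CongrMod.refl k x

theorem CongrMod.symm (h : CongrMod k x y) : CongrMod k y x := by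
  rw [CongrMod, dvd_sub_comm]; exact h

theorem CongrMod.trans (h : CongrMod k x y) (h' : CongrMod k y z) : CongrMod k x z := by
  have := dvd_add h h'
  rwa [sub_add_sub_cancel] at this

theorem CongrMod.add (h : CongrMod k x x') (h' : CongrMod k y y') :
    CongrMod k (x + y) (x' + y') := by
  have := dvd_add h h'
  rwa [show x - x' + (y - y') = x + y - (x' + y') by ring] at this

theorem CongrMod.sub (h : CongrMod k x x') (h' : CongrMod k y y') :
    CongrMod k (x - y) (x' - y') := by
  have := dvd_sub h h'
  rwa [show x - x' - (y - y') = x - y - (x' - y') by ring] at this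

theorem CongrMod.mul (h : CongrMod k x x') (h' : CongrMod k y y') :
    CongrMod k (x * y) (x' * y') := by
  have := dvd_add (h.mul_right y) (h'.mul_left x')
  rwa [show (x - x') * y + x' * (y - y') = x * y - x' * y' by ring] at this

theorem CongrMod.mul_left (c : MvPowerSeries (Fin 3) ℂ) (h : CongrMod k x y) :
    CongrMod k (c * x) (c * y) := (CongrMod.refl k c).mul h

theorem CongrMod.mul_right (c : MvPowerSeries (Fin 3) ℂ) (h : CongrMod k x y) :
    CongrMod k (x * c) (y * c) := h.mul (CongrMod.refl k c)

theorem CongrMod.pow (h : CongrMod k x y) (n : ℕ) : CongrMod k (x ^ n) (y ^ n) :=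
  Dvd.dvd.trans h (sub_dvd_pow_sub_pow x y n)

theorem CongrMod.pow_mul (i : ℕ) (h : CongrMod k x y) :
    CongrMod (i + k) (X 2 ^ i * x) (X 2 ^ i * y) := by
  rw [CongrMod, ← mul_sub, pow_add]
  exact mul_dvd_mul_left _ h

theorem CongrMod.mono {i : ℕ} (hi : i ≤ k) (h : CongrMod k x y) : CongrMod i x y :=
  (pow_dvd_pow _ hi).trans h

theorem congrMod_zero_iff : CongrMod k x 0 ↔ X 2 ^ k ∣ x := by rw [CongrMod, sub_zero]

theorem X_two_ne_zero : (X 2 : MvPowerSeries (Fin 3) ℂ) ≠ 0 := by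
  intro h
  simpa using congrArg (coeff (Finsupp.single 2 1)) h

theorem CongrMod.of_pow_mul {i : ℕ} (h : CongrMod (i + k) (X 2 ^ i * x) (X 2 ^ i * y)) :
    CongrMod k x y := by
  rw [CongrMod, ← mul_sub, pow_add] at h
  exact (mul_dvd_mul_iff_left (pow_ne_zero _ X_two_ne_zero)).mp h

theorem CongrMod.subst {n : ℕ} {a b : Fin n → MvPowerSeries (Fin 3) ℂ}
    (ha : ∀ i, constantCoeff (a i) = 0) (hb : ∀ i, constantCoeff (b i) = 0)
    (h : ∀ i, CongrMod k (a i) (b i)) (g : MvPowerSeries (Fin n) ℂ) :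
    CongrMod k (g.subst a) (g.subst b) :=
  subst_sub_subst_dvd ha hb h g

theorem CongrMod.coeff_eq (h : CongrMod k x y) {a b c : ℕ} (hc : c < k) :
    coeff (exp3 a b c) x = coeff (exp3 a b c) y := by
  have := X_pow_dvd_iff.mp h (exp3 a b c) hc
  rwa [map_sub, sub_eq_zero] at this

theorem congrMod_iff : CongrMod k x y ↔
    ∀ a b c, c < k → coeff (exp3 a b c) x = coeff (exp3 a b c) y := by
  refine ⟨fun h a b c hc => h.coeff_eq hc, fun h => X_pow_dvd_iff.mpr fun e he => ?_⟩
  rw [eq_exp3 e, map_sub, sub_eq_zero]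
  exact h _ _ _ he

end Congruence

/-! ### Perturbation near the identity and the linearized equation -/

section Perturbation

theorem one_add_pow_congr {A : Type*} [CommRing A] (x : A) (n : ℕ) :
    x ^ 2 ∣ (1 + x) ^ n - (1 + n * x) := by
  induction n with
  | zero => simp
  | succ n ih =>
    obtain ⟨c, hc⟩ := ih
    refine ⟨c * (1 + x) + n, ?_⟩
    rw [pow_succ]
    push_cast
    linear_combination (1 + x) * hc

/-- The derivative of the `n`-th power at `V` is `n V^(n-1)`, and `V` may be replaced by `1`. Terms
quadratic in `D` have order `2j ≥ j + 1`. -/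
theorem add_pow_congr {j : ℕ} (hj : 1 ≤ j) {V D : MvPowerSeries (Fin 3) ℂ}
    (hV : CongrMod 1 V 1) (hD : CongrMod j D 0) (n : ℕ) :
    CongrMod (j + 1) ((V + D) ^ n - V ^ n) (n * D) := by
  induction n with
  | zero => simpa using CongrMod.refl _ _
  | succ n ih =>
    obtain ⟨d, hd⟩ : X 2 ^ j ∣ D := congrMod_zero_iff.mp hD
    have h1 : CongrMod (j + 1) (((V + D) ^ n - V ^ n) * (V + D)) (n * D * 1) := by
      refine (ih.mul_right _).trans ?_
      have h2 : CongrMod 1 (X 2 ^ j * d) 0 := by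
        rw [congrMod_zero_iff]
        exact (pow_dvd_pow _ hj).mul_right _
      have h3 := CongrMod.pow_mul j (CongrMod.mul_left (n * d) (hV.add h2))
      rw [hd]
      refine (CongrMod.of_eq ?_).trans (h3.trans (CongrMod.of_eq ?_)) <;> ring
    have h2 : CongrMod (j + 1) (V ^ n * D) (1 * D) := by
      rw [hd, show V ^ n * (X 2 ^ j * d) = X 2 ^ j * (V ^ n * d) by ring,
        show 1 * (X 2 ^ j * d) = X 2 ^ j * (1 ^ n * d) by ring]
      exact CongrMod.pow_mul j ((hV.pow n).mul_right d)
    have h3 := h1.add h2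
    convert h3 using 1
    · ring
    · push_cast; ring

variable {m j : ℕ} {ψ : MvPowerSeries (Fin 3) ℂ}

/-- The right-hand side `½ u ^ m ψ`. -/
def scaledSeries (m : ℕ) (ψ : MvPowerSeries (Fin 3) ℂ) : MvPowerSeries (Fin 3) ℂ :=
  C (1 / 2) * X 2 ^ m * ψ

theorem constantCoeff_scaledSeries (hm : 2 ≤ m) (ψ : MvPowerSeries (Fin 3) ℂ) :
    constantCoeff (scaledSeries m ψ) = 0 := by
  have : m ≠ 0 := by omega
  simp [scaledSeries, this]

/-- The point of this form is `w = u (1 + O(u^(m-1)))` on the hypersurface, so powers of `w` are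
powers of `u` up to higher order. -/
theorem scaledSeries_eq_X_mul (hm : 2 ≤ m) (ψ : MvPowerSeries (Fin 3) ℂ) :
    scaledSeries m ψ = X 2 * (X 2 ^ (m - 1) * (C (1 / 2) * ψ)) := by
  obtain ⟨n, rfl⟩ := Nat.exists_eq_add_of_le hm
  rw [scaledSeries, show 2 + n - 1 = n + 1 by omega]
  ring

theorem hol_X_one_eq (hm : 2 ≤ m) (ψ : MvPowerSeries (Fin 3) ℂ) :
    hol (scaledSeries m ψ) (X 1) =
      X 2 * (1 + C Complex.I * (X 2 ^ (m - 1) * (C (1 / 2) * ψ))) := by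
  rw [hol_X_one (constantCoeff_scaledSeries hm ψ), scaledSeries_eq_X_mul hm]
  ring

theorem antihol_X_one_eq (hm : 2 ≤ m) (ψ : MvPowerSeries (Fin 3) ℂ) :
    antihol (scaledSeries m ψ) (X 1) =
      X 2 * (1 + -(C Complex.I * (X 2 ^ (m - 1) * (C (1 / 2) * ψ)))) := by
  rw [antihol_X_one (constantCoeff_scaledSeries hm ψ), scaledSeries_eq_X_mul hm]
  ring

theorem congrMod_X_pow_mul {i k : ℕ} (hi : i ≤ k) (x : MvPowerSeries (Fin 3) ℂ) :
    CongrMod i (X 2 ^ k * x) 0 :=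
  congrMod_zero_iff.mpr ((pow_dvd_pow _ hi).mul_right _)

theorem hol_X_one_pow_congr (hm : 2 ≤ m) (ψ : MvPowerSeries (Fin 3) ℂ) (n : ℕ) :
    CongrMod (n + 1) (hol (scaledSeries m ψ) (X 1) ^ n) (X 2 ^ n) := by
  rw [hol_X_one_eq hm, mul_pow]
  have h : CongrMod 1 (1 + C Complex.I * (X 2 ^ (m - 1) * (C (1 / 2) * ψ))) 1 := by
    have := (congrMod_X_pow_mul (i := 1) (k := m - 1) (by omega) (C (1 / 2) * ψ)).mul_left
      (C Complex.I)
    simpa using (CongrMod.refl 1 1).add this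
  simpa using CongrMod.pow_mul n (h.pow n)

theorem antihol_X_one_pow_congr (hm : 2 ≤ m) (ψ : MvPowerSeries (Fin 3) ℂ) (n : ℕ) :
    CongrMod (n + 1) (antihol (scaledSeries m ψ) (X 1) ^ n) (X 2 ^ n) := by
  rw [antihol_X_one_eq hm, mul_pow]
  have h : CongrMod 1 (1 + -(C Complex.I * (X 2 ^ (m - 1) * (C (1 / 2) * ψ)))) 1 := by
    have := (congrMod_X_pow_mul (i := 1) (k := m - 1) (by omega) (C (1 / 2) * ψ)).mul_left
      (-C Complex.I)
    simpa using (CongrMod.refl 1 1).add this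
  simpa using CongrMod.pow_mul n (h.pow n)

theorem hol_dvd_of_dvd (hm : 2 ≤ m) (ψ : MvPowerSeries (Fin 3) ℂ) {n : ℕ}
    {g : MvPowerSeries (Fin 2) ℂ} (h : X 1 ^ n ∣ g) :
    X 2 ^ n ∣ hol (scaledSeries m ψ) g := by
  obtain ⟨c, rfl⟩ := h
  have hf := constantCoeff_scaledSeries hm ψ
  rw [hol_mul hf, hol_pow hf, hol_X_one_eq hm, mul_pow]
  exact ⟨_, mul_assoc _ _ _⟩

theorem antihol_dvd_of_dvd (hm : 2 ≤ m) (ψ : MvPowerSeries (Fin 3) ℂ) {n : ℕ}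
    {g : MvPowerSeries (Fin 2) ℂ} (h : X 1 ^ n ∣ g) :
    X 2 ^ n ∣ antihol (scaledSeries m ψ) g := by
  obtain ⟨c, rfl⟩ := h
  have hf := constantCoeff_scaledSeries hm ψ
  rw [antihol_mul hf, antihol_pow hf, antihol_X_one_eq hm, mul_pow]
  exact ⟨_, mul_assoc _ _ _⟩

/-- A real series in `w` alone takes values which are real modulo the defining series. -/
theorem hol_congr_antihol (hm : 2 ≤ m) (ψ : MvPowerSeries (Fin 3) ℂ)
    {p : MvPowerSeries (Fin 2) ℂ}
    (hp : p.subst (![0, X 1] : Fin 2 → MvPowerSeries (Fin 2) ℂ) = p) (hr : conjSeries p = p) :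
    CongrMod m (hol (scaledSeries m ψ) p) (antihol (scaledSeries m ψ) p) := by
  have hf := constantCoeff_scaledSeries hm ψ
  have h0 : ∀ i, constantCoeff ((![0, X 1] : Fin 2 → MvPowerSeries (Fin 2) ℂ) i) = 0 := by
    intro i; fin_cases i <;> simp
  have ha : ∀ i, constantCoeff ((![0, hol (scaledSeries m ψ) (X 1)] :
      Fin 2 → MvPowerSeries (Fin 3) ℂ) i) = 0 := by
    intro i; fin_cases i <;> simp [constantCoeff_hol hf]
  have hb : ∀ i, constantCoeff ((![0, antihol (scaledSeries m ψ) (X 1)] :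
      Fin 2 → MvPowerSeries (Fin 3) ℂ) i) = 0 := by
    intro i; fin_cases i <;> simp [constantCoeff_antihol hf]
  have e1 : hol (scaledSeries m ψ) p = p.subst (![0, hol (scaledSeries m ψ) (X 1)] :
      Fin 2 → MvPowerSeries (Fin 3) ℂ) := by
    conv_lhs => rw [hol, ← hp]
    have hs := hasSubst_of_zero (hol_args_zero hf)
    rw [subst_comp_subst_apply (hasSubst_of_zero h0) hs]
    congr 1
    funext i
    fin_cases i
    · change (0 : MvPowerSeries (Fin 2) ℂ).subst _ = 0
      rw [← substAlgHom_apply hs, map_zero]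
    · rfl
  have e2 : antihol (scaledSeries m ψ) p = p.subst (![0, antihol (scaledSeries m ψ) (X 1)] :
      Fin 2 → MvPowerSeries (Fin 3) ℂ) := by
    have hs := hasSubst_of_zero (antihol_args_zero hf)
    conv_lhs => rw [antihol, hr, ← hp]
    rw [subst_comp_subst_apply (hasSubst_of_zero h0) hs]
    congr 1
    funext i
    fin_cases i
    · change (0 : MvPowerSeries (Fin 2) ℂ).subst _ = 0
      rw [← substAlgHom_apply hs, map_zero]
    · change (X 1 : MvPowerSeries (Fin 2) ℂ).subst _ = antihol (scaledSeries m ψ) (X 1)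
      rw [antihol, conjSeries, map_X]
  rw [e1, e2]
  refine CongrMod.subst ha hb (fun i => ?_) p
  fin_cases i
  · exact CongrMod.refl _ _
  · change CongrMod m (hol _ _) (antihol _ _)
    rw [hol_X_one hf, antihol_X_one hf, CongrMod, scaledSeries]
    exact ⟨C Complex.I * C (1 / 2) * ψ * 2, by ring⟩

theorem basicEquation_scaledSeries (f φ : MvPowerSeries (Fin 3) ℂ) (hf : constantCoeff f = 0)
    {K : FormalMap} (hK : ∀ i, constantCoeff (K i) = 0) (m : ℕ) :
    basicEquation f K (scaledSeries m φ) =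
      C (1 / (2 * Complex.I)) * (hol f (K 1) - antihol f (K 1)) -
        C (1 / 2) * (imagePoint f K 2 ^ m * φ.subst (imagePoint f K)) := by
  have hs := hasSubst_of_zero (imagePoint_zero hf hK)
  rw [basicEquation, scaledSeries, subst_mul hs, subst_mul hs, subst_pow hs, subst_X hs, subst_C]
  ring

/-- The linearization, at the identity map, of the basic equation in the order `m + j`. -/
def linearizedEquation (m j : ℕ) (ψ : MvPowerSeries (Fin 3) ℂ) (F q : MvPowerSeries (Fin 2) ℂ)
    (b : ℂ) (η : MvPowerSeries (Fin 3) ℂ) : MvPowerSeries (Fin 3) ℂ :=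
  C (((j : ℂ) + 1 - m) * b) * ψ -
    C Complex.I * (hol (scaledSeries m ψ) q - antihol (scaledSeries m ψ) q) -
    hol (scaledSeries m ψ) F * pderiv ℂ 0 ψ - antihol (scaledSeries m ψ) F * pderiv ℂ 1 ψ - η

theorem hol_congr (hm : 2 ≤ m) (ψ : MvPowerSeries (Fin 3) ℂ) {n : ℕ}
    {g g' : MvPowerSeries (Fin 2) ℂ} (h : X 1 ^ n ∣ g - g') :
    CongrMod n (hol (scaledSeries m ψ) g) (hol (scaledSeries m ψ) g') := by
  rw [CongrMod, ← hol_sub (constantCoeff_scaledSeries hm ψ)]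
  exact hol_dvd_of_dvd hm ψ h

theorem antihol_congr (hm : 2 ≤ m) (ψ : MvPowerSeries (Fin 3) ℂ) {n : ℕ}
    {g g' : MvPowerSeries (Fin 2) ℂ} (h : X 1 ^ n ∣ g - g') :
    CongrMod n (antihol (scaledSeries m ψ) g) (antihol (scaledSeries m ψ) g') := by
  rw [CongrMod, ← antihol_sub (constantCoeff_scaledSeries hm ψ)]
  exact antihol_dvd_of_dvd hm ψ h

/-- A formal map which is tangent to the identity to the first order along `w = 0`. -/
structure IsTangentToIdentity (K : FormalMap) : Prop where
  zero : X 1 ∣ K 0 - X 0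
  one : X 1 ^ 2 ∣ K 1 - X 1

theorem constantCoeff_eq_zero_of_dvd {σ : Type*} {s : σ} {f : MvPowerSeries σ ℂ} (h : X s ∣ f) :
    constantCoeff f = 0 := by
  obtain ⟨c, rfl⟩ := h
  simp

theorem IsTangentToIdentity.constantCoeff {K : FormalMap} (hK : IsTangentToIdentity K)
    (i : Fin 2) : constantCoeff (K i) = 0 := by
  fin_cases i
  · simpa using constantCoeff_eq_zero_of_dvd hK.zero
  · simpa using constantCoeff_eq_zero_of_dvd ((dvd_pow_self _ two_ne_zero).trans hK.one)

theorem IsTangentToIdentity.imagePoint_congr (hm : 2 ≤ m) (ψ : MvPowerSeries (Fin 3) ℂ)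
    {K : FormalMap} (hK : IsTangentToIdentity K) (i : Fin 3) :
    CongrMod 1 (imagePoint (scaledSeries m ψ) K i) (X i) := by
  have hf := constantCoeff_scaledSeries hm ψ
  fin_cases i
  · change CongrMod 1 (hol _ (K 0)) (X 0)
    have := hol_congr hm ψ (n := 1) (g := K 0) (g' := X 0) (by simpa using hK.zero)
    rwa [hol_X_zero hf] at this
  · change CongrMod 1 (antihol _ (K 0)) (X 1)
    have := antihol_congr hm ψ (n := 1) (g := K 0) (g' := X 0) (by simpa using hK.zero)
    rwa [antihol_X_zero hf] at this
  · change CongrMod 1 (C (1 / 2) * (hol _ (K 1) + antihol _ (K 1))) (X 2)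
    have h1 : X 1 ^ 1 ∣ K 1 - 0 := by
      have := dvd_add ((pow_dvd_pow _ one_le_two).trans hK.one) (dvd_refl (X 1 ^ 1))
      simpa using this
    have e1 := hol_congr hm ψ h1
    have e2 := antihol_congr hm ψ h1
    have z1 : hol (scaledSeries m ψ) 0 = 0 := by
      have := hol_C (f := scaledSeries m ψ) 0; simpa using this
    have z2 : antihol (scaledSeries m ψ) 0 = 0 := by
      have := antihol_C (f := scaledSeries m ψ) 0; simpa using this
    rw [z1] at e1
    rw [z2] at e2
    refine ((e1.add e2).mul_left _).trans ?_
    rw [CongrMod]; simp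

theorem IsTangentToIdentity.imagePoint_two_congr (hm : 2 ≤ m) (ψ : MvPowerSeries (Fin 3) ℂ)
    {K : FormalMap} (hK : IsTangentToIdentity K) :
    CongrMod 2 (imagePoint (scaledSeries m ψ) K 2) (X 2) := by
  have e1 := (hol_congr hm ψ hK.one).trans ((by simpa using hol_X_one_pow_congr hm ψ 1))
  have e2 := (antihol_congr hm ψ hK.one).trans ((by simpa using antihol_X_one_pow_congr hm ψ 1))
  refine ((e1.add e2).mul_left (C (1 / 2))).trans (CongrMod.of_eq ?_)
  linear_combination X 2 * C_half_mul_two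

end Perturbation

/-! ### First-order expansion of the basic equation -/

section Linearization

variable {m j : ℕ} {ψ : MvPowerSeries (Fin 3) ℂ}

theorem C_two_mul_half (x : MvPowerSeries (Fin 3) ℂ) : 2 * (C (1 / 2) * x) = x := by
  linear_combination x * C_half_mul_two (σ := Fin 3)

/-- On the hypersurface `w = u (1 + r)` and `w̄ = u (1 - r)` with `r = ½ i u^(m-1) ψ`. The leading
term of the difference of the powers is `2 (k + 1) r u^(k+1)`. -/
theorem hol_pow_sub_antihol_pow_congr (hm : 2 ≤ m) (ψ : MvPowerSeries (Fin 3) ℂ) (k : ℕ) :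
    CongrMod (m + k + 1) (hol (scaledSeries m ψ) (X 1) ^ (k + 1) -
        antihol (scaledSeries m ψ) (X 1) ^ (k + 1))
      (X 2 ^ (m + k) * (C Complex.I * C ((k : ℂ) + 1) * ψ)) := by
  set r := C Complex.I * (X 2 ^ (m - 1) * (C (1 / 2) * ψ)) with hr
  rw [hol_X_one_eq hm, antihol_X_one_eq hm, ← hr, mul_pow, mul_pow, ← mul_sub]
  -- Here `m ≥ 2` enters, in the form `2 (m - 1) ≥ m`.
  have hr2 : X 2 ^ m ∣ r ^ 2 := by
    refine (pow_dvd_pow (X 2) (show m ≤ (m - 1) * 2 by omega)).trans ?_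
    rw [pow_mul]
    exact pow_dvd_pow_of_dvd ⟨C Complex.I * (C (1 / 2) * ψ), by rw [hr]; ring⟩ 2
  have h1 := hr2.trans (one_add_pow_congr r (k + 1))
  have h2 : X 2 ^ m ∣ (1 + -r) ^ (k + 1) - (1 + ((k + 1 : ℕ) : MvPowerSeries (Fin 3) ℂ) * -r) := by
    refine Dvd.dvd.trans ?_ (one_add_pow_congr (-r) (k + 1))
    simpa using hr2
  have h3 : CongrMod m ((1 + r) ^ (k + 1) - (1 + -r) ^ (k + 1))
      (X 2 ^ (m - 1) * (C Complex.I * C ((k : ℂ) + 1) * ψ)) := by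
    refine (CongrMod.sub (show CongrMod _ _ _ from h1) (show CongrMod _ _ _ from h2)).trans
      (CongrMod.of_eq ?_)
    have hk : (C ((k : ℂ) + 1) : MvPowerSeries (Fin 3) ℂ) = k + 1 := by simp
    rw [hk, hr]
    push_cast
    linear_combination (k + 1 : MvPowerSeries (Fin 3) ℂ) * C Complex.I * X 2 ^ (m - 1) *
      C_two_mul_half ψ
  have h4 := CongrMod.pow_mul (k + 1) h3
  refine (h4.mono (by omega)).trans (CongrMod.of_eq ?_)
  rw [← mul_assoc, ← pow_add]
  congr 2
  omega

variable {φ φ' : MvPowerSeries (Fin 3) ℂ} {K K' : FormalMap} {F p q : MvPowerSeries (Fin 2) ℂ}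
  {b : ℂ} {η : MvPowerSeries (Fin 3) ℂ}

/-- First-order expansion of the imaginary part of the transverse component. -/
theorem im_part_congr (hm : 2 ≤ m)
    (hp : p.subst (![0, X 1] : Fin 2 → MvPowerSeries (Fin 2) ℂ) = p) (hpr : conjSeries p = p)
    (hpb : X 1 ∣ p - C b) :
    CongrMod (m + j + 1)
      (hol (scaledSeries m ψ) (X 1 ^ (j + 1) * p + X 1 ^ (m + j) * q) -
        antihol (scaledSeries m ψ) (X 1 ^ (j + 1) * p + X 1 ^ (m + j) * q))
      (X 2 ^ (m + j) * (C Complex.I * C (((j : ℂ) + 1) * b) * ψ +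
        (hol (scaledSeries m ψ) q - antihol (scaledSeries m ψ) q))) := by
  have hf := constantCoeff_scaledSeries hm ψ
  simp only [hol_add hf, hol_mul hf, hol_pow hf, antihol_add hf, antihol_mul hf, antihol_pow hf]
  set W := hol (scaledSeries m ψ) (X 1)
  set T := antihol (scaledSeries m ψ) (X 1) with hT
  set hp' := hol (scaledSeries m ψ) p
  set ap' := antihol (scaledSeries m ψ) p
  set hq := hol (scaledSeries m ψ) q
  set aq := antihol (scaledSeries m ψ) q
  have e1 : CongrMod (m + j + 1) ((W ^ (j + 1) - T ^ (j + 1)) * hp')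
      (X 2 ^ (m + j) * (C Complex.I * C (((j : ℂ) + 1) * b) * ψ)) := by
    refine ((hol_pow_sub_antihol_pow_congr hm ψ j).mul_right hp').trans ?_
    have h1 : CongrMod 1 hp' (C b) := by
      have := hol_congr hm ψ (n := 1) (g := p) (g' := C b) (by simpa using hpb)
      rwa [hol_C] at this
    have h2 := CongrMod.pow_mul (m + j) (h1.mul_left (C Complex.I * C ((j : ℂ) + 1) * ψ))
    refine (CongrMod.of_eq (by ring)).trans (h2.trans (CongrMod.of_eq ?_))
    rw [map_mul]; ring
  -- The difference `w^(j+1) p - w̄^(j+1) p̄` is split as `(w^(j+1) - w̄^(j+1)) p + w̄^(j+1) (p -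
  -- p̄)`. The second summand is negligible, since the reality of `p` makes `p - p̄` divisible by
  -- `u^m`.
  have e2 : CongrMod (m + j + 1) (T ^ (j + 1) * (hp' - ap')) 0 := by
    rw [congrMod_zero_iff, show m + j + 1 = j + 1 + m by ring, pow_add]
    refine mul_dvd_mul ?_ (hol_congr_antihol hm ψ hp hpr)
    rw [hT, antihol_X_one_eq hm, mul_pow]
    exact dvd_mul_right _ _
  have e3 := (hol_X_one_pow_congr hm ψ (m + j)).mul_right hq
  have e4 := (antihol_X_one_pow_congr hm ψ (m + j)).mul_right aq
  have := (e1.add e2).add (e3.sub e4)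
  convert this using 1 <;> ring

/-- Only `b w^(j+1)` reaches the real part in order `j + 1`: the rest of `p` carries an additional
`w`, and `m + j ≥ j + 2`. -/
theorem im_part_dvd (hm : 2 ≤ m) {D : MvPowerSeries (Fin 2) ℂ}
    (hD : D = X 1 ^ (j + 1) * p + X 1 ^ (m + j) * q) (hpb : X 1 ∣ p - C b) (hb : conj b = b) :
    CongrMod (j + 2) (C (1 / 2) * (hol (scaledSeries m ψ) D + antihol (scaledSeries m ψ) D))
      (X 2 ^ (j + 1) * C b) := by
  have hf := constantCoeff_scaledSeries hm ψ
  have hDb : X 1 ^ (j + 2) ∣ D - X 1 ^ (j + 1) * C b := by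
    rw [hD, show X 1 ^ (j + 1) * p + X 1 ^ (m + j) * q - X 1 ^ (j + 1) * C b =
      X 1 ^ (j + 1) * (p - C b) + X 1 ^ (m + j) * q by ring]
    refine dvd_add ?_ ((pow_dvd_pow _ (by omega)).mul_right _)
    rw [pow_succ (X 1) (j + 1)]
    exact mul_dvd_mul_left _ hpb
  have e1 := hol_congr hm ψ hDb
  have e2 := antihol_congr hm ψ hDb
  rw [hol_mul hf, hol_pow hf, hol_C] at e1
  rw [antihol_mul hf, antihol_pow hf, antihol_C, hb] at e2
  have e3 := e1.trans ((hol_X_one_pow_congr hm ψ (j + 1)).mul_right (C b))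
  have e4 := e2.trans ((antihol_X_one_pow_congr hm ψ (j + 1)).mul_right (C b))
  refine ((e3.add e4).mul_left (C (1 / 2))).trans (CongrMod.of_eq ?_)
  linear_combination (X 2 ^ (j + 1) * C b) * C_half_mul_two (σ := Fin 3)

/-- First-order expansion of the values of the target series. -/
theorem target_value_congr (hm : 2 ≤ m) (hj : 1 ≤ j) (hK : IsTangentToIdentity K)
    (hK' : IsTangentToIdentity K') (hφ : CongrMod 1 φ ψ)
    (h0 : K' 0 = K 0 + X 1 ^ j * F) (h1 : X 1 ^ (j + 1) ∣ K' 1 - K 1)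
    (hη : φ' = φ + X 2 ^ j * η) :
    CongrMod (j + 1)
      (φ'.subst (imagePoint (scaledSeries m ψ) K') - φ.subst (imagePoint (scaledSeries m ψ) K))
      (X 2 ^ j * (η + hol (scaledSeries m ψ) F * pderiv ℂ 0 ψ +
        antihol (scaledSeries m ψ) F * pderiv ℂ 1 ψ)) := by
  have hf := constantCoeff_scaledSeries hm ψ
  have hI := imagePoint_zero hf hK.constantCoeff
  have hI' := imagePoint_zero hf hK'.constantCoeff
  have hX : ∀ i : Fin 3, constantCoeff (X i : MvPowerSeries (Fin 3) ℂ) = 0 := by simp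
  have hs' := hasSubst_of_zero hI'
  have d0 : imagePoint (scaledSeries m ψ) K' 0 - imagePoint (scaledSeries m ψ) K 0 =
      hol (scaledSeries m ψ) (X 1) ^ j * hol (scaledSeries m ψ) F := by
    change hol _ (K' 0) - hol _ (K 0) = _
    rw [h0, hol_add hf, hol_mul hf, hol_pow hf]; ring
  have d1 : imagePoint (scaledSeries m ψ) K' 1 - imagePoint (scaledSeries m ψ) K 1 =
      antihol (scaledSeries m ψ) (X 1) ^ j * antihol (scaledSeries m ψ) F := by
    change antihol _ (K' 0) - antihol _ (K 0) = _
    rw [h0, antihol_add hf, antihol_mul hf, antihol_pow hf]; ring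
  have d2 : CongrMod (j + 1) (imagePoint (scaledSeries m ψ) K' 2)
      (imagePoint (scaledSeries m ψ) K 2) :=
    ((hol_congr hm ψ h1).add (antihol_congr hm ψ h1)).mul_left _
  have c0 : CongrMod (j + 1)
      (imagePoint (scaledSeries m ψ) K' 0 - imagePoint (scaledSeries m ψ) K 0)
      (X 2 ^ j * hol (scaledSeries m ψ) F) := by
    rw [d0]; exact (hol_X_one_pow_congr hm ψ j).mul_right _
  have c1 : CongrMod (j + 1)
      (imagePoint (scaledSeries m ψ) K' 1 - imagePoint (scaledSeries m ψ) K 1)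
      (X 2 ^ j * antihol (scaledSeries m ψ) F) := by
    rw [d1]; exact (antihol_X_one_pow_congr hm ψ j).mul_right _
  have hall : ∀ i, X 2 ^ j ∣ imagePoint (scaledSeries m ψ) K' i -
      imagePoint (scaledSeries m ψ) K i := by
    intro i
    fin_cases i
    · exact congrMod_zero_iff.mp ((c0.mono (Nat.le_succ j)).trans
        (congrMod_zero_iff.mpr (dvd_mul_right _ _)))
    · exact congrMod_zero_iff.mp ((c1.mono (Nat.le_succ j)).trans
        (congrMod_zero_iff.mpr (dvd_mul_right _ _)))
    · exact d2.mono (Nat.le_succ j)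
  -- The quadratic remainder has order `2j ≥ j + 1`.
  have htaylor : CongrMod (j + 1)
      (φ.subst (imagePoint (scaledSeries m ψ) K') - φ.subst (imagePoint (scaledSeries m ψ) K))
      (∑ i, (imagePoint (scaledSeries m ψ) K' i - imagePoint (scaledSeries m ψ) K i) *
        (pderiv ℂ i φ).subst (imagePoint (scaledSeries m ψ) K)) :=
    CongrMod.mono (k := 2 * j) (by omega) (subst_taylor_dvd hI' hI hall φ)
  -- Congruence modulo `u` survives differentiation in `z` and `χ`, but not in `u`. The
  -- `u`-derivative is not needed, because the third coordinate changes only in order `j + 1`.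
  have hder : ∀ i : Fin 3, i ≠ 2 →
      CongrMod 1 ((pderiv ℂ i φ).subst (imagePoint (scaledSeries m ψ) K)) (pderiv ℂ i ψ) := by
    intro i hi
    have e1 := CongrMod.subst hI hX (hK.imagePoint_congr hm ψ) (pderiv ℂ i φ)
    rw [subst_self, id_eq] at e1
    refine e1.trans ?_
    refine X_pow_dvd_iff.mpr fun e he => ?_
    rw [← map_sub, coeff_pderiv, X_pow_dvd_iff.mp hφ, zero_mul]
    simpa [Finsupp.single_apply, hi] using he
  have hprod : ∀ (i : Fin 3) (x : MvPowerSeries (Fin 3) ℂ), i ≠ 2 →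
      CongrMod (j + 1)
        (imagePoint (scaledSeries m ψ) K' i - imagePoint (scaledSeries m ψ) K i) (X 2 ^ j * x) →
      CongrMod (j + 1)
        ((imagePoint (scaledSeries m ψ) K' i - imagePoint (scaledSeries m ψ) K i) *
          (pderiv ℂ i φ).subst (imagePoint (scaledSeries m ψ) K))
        (X 2 ^ j * (x * pderiv ℂ i ψ)) := by
    intro i x hi hx
    refine (hx.mul_right _).trans ?_
    rw [mul_assoc]
    exact CongrMod.pow_mul j ((hder i hi).mul_left x)
  have hη' : CongrMod (j + 1) ((X 2 ^ j * η).subst (imagePoint (scaledSeries m ψ) K'))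
      (X 2 ^ j * η) := by
    rw [subst_mul hs', subst_pow hs', subst_X hs']
    have e1 := CongrMod.subst hI' hX (hK'.imagePoint_congr hm ψ) η
    rw [subst_self, id_eq] at e1
    have e2 : CongrMod (j + 1) (imagePoint (scaledSeries m ψ) K' 2 ^ j) (X 2 ^ j) := by
      obtain ⟨c, hc⟩ := hK'.imagePoint_two_congr hm ψ
      have : imagePoint (scaledSeries m ψ) K' 2 = X 2 * (1 + X 2 * c) := by
        linear_combination hc
      rw [this, mul_pow]
      have h3 : CongrMod 1 (1 + X 2 * c) 1 := by
        rw [CongrMod]; simp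
      simpa using CongrMod.pow_mul j (h3.pow j)
    exact (e2.mul_right _).trans (CongrMod.pow_mul j e1)
  have hsum := (hη'.add htaylor).trans ((CongrMod.refl _ _).add
    (by
      rw [Fin.sum_univ_three]
      exact ((hprod 0 _ (by decide) c0).add (hprod 1 _ (by decide) c1)).add
        ((show CongrMod (j + 1) _ 0 from congrMod_zero_iff.mpr d2).mul_right _)))
  rw [hη, subst_add hs']
  convert hsum using 1 <;> ring

/-- Two solutions of the basic equation which agree to order `j` are related, in the order
`m + j`, by the linearized equation. -/
theorem basicEquation_sub_congr (hm : 2 ≤ m) (hj : 1 ≤ j) (hK : IsTangentToIdentity K)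
    (hK' : IsTangentToIdentity K') (hφ : CongrMod 1 φ ψ)
    (h0 : K' 0 = K 0 + X 1 ^ j * F)
    (h1 : K' 1 = K 1 + (X 1 ^ (j + 1) * p + X 1 ^ (m + j) * q))
    (hη : φ' = φ + X 2 ^ j * η)
    (hp : p.subst (![0, X 1] : Fin 2 → MvPowerSeries (Fin 2) ℂ) = p) (hpr : conjSeries p = p)
    (hpb : X 1 ∣ p - C b) (hb : conj b = b) :
    CongrMod (m + j + 1)
      (basicEquation (scaledSeries m ψ) K' (scaledSeries m φ') -
        basicEquation (scaledSeries m ψ) K (scaledSeries m φ))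
      (X 2 ^ (m + j) * (C (1 / 2) * linearizedEquation m j ψ F q b η)) := by
  have hf := constantCoeff_scaledSeries hm ψ
  have hI := imagePoint_zero hf hK.constantCoeff
  have hX : ∀ i : Fin 3, constantCoeff (X i : MvPowerSeries (Fin 3) ℂ) = 0 := by simp
  rw [basicEquation_scaledSeries _ _ hf hK.constantCoeff,
    basicEquation_scaledSeries _ _ hf hK'.constantCoeff]
  set D := X 1 ^ (j + 1) * p + X 1 ^ (m + j) * q with hD
  have hD1 : X 1 ^ (j + 1) ∣ K' 1 - K 1 := by
    rw [h1, add_sub_cancel_left, hD]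
    exact dvd_add (dvd_mul_right _ _) ((pow_dvd_pow _ (by omega)).mul_right _)
  have hval := target_value_congr hm hj hK hK' hφ h0 hD1 hη
  obtain ⟨c, hc⟩ := hK.imagePoint_two_congr hm ψ
  -- Writing `Re G` as `u V` before and `u (V + Y)` after the change pulls `u^m` out of the target,
  -- so that only expansions modulo `u^(j+1)` remain.
  set V := 1 + X 2 * c with hV
  have hU : imagePoint (scaledSeries m ψ) K 2 = X 2 * V := by rw [hV]; linear_combination hc
  have hV1 : CongrMod 1 V 1 := by rw [CongrMod, hV]; simp
  obtain ⟨d, hd⟩ := im_part_dvd (ψ := ψ) hm hD hpb hb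
  set Y := X 2 ^ j * (C b + X 2 * d) with hY
  have hU' : imagePoint (scaledSeries m ψ) K' 2 = X 2 * (V + Y) := by
    have e : imagePoint (scaledSeries m ψ) K' 2 = imagePoint (scaledSeries m ψ) K 2 +
        C (1 / 2) * (hol (scaledSeries m ψ) D + antihol (scaledSeries m ψ) D) := by
      change C (1 / 2) * (hol _ (K' 1) + antihol _ (K' 1)) =
        C (1 / 2) * (hol _ (K 1) + antihol _ (K 1)) + _
      rw [h1, hol_add hf, antihol_add hf]; ring
    rw [e, hU, hY]; linear_combination hd
  have hYj : CongrMod j Y 0 := congrMod_zero_iff.mpr (dvd_mul_right _ _)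
  have hYb : CongrMod (j + 1) Y (X 2 ^ j * C b) :=
    CongrMod.pow_mul j (by rw [CongrMod]; simp)
  set Q := φ.subst (imagePoint (scaledSeries m ψ) K) with hQ
  set Q' := φ'.subst (imagePoint (scaledSeries m ψ) K') with hQ'
  have hQψ : CongrMod 1 Q ψ := by
    have e1 := CongrMod.subst hI hX (hK.imagePoint_congr hm ψ) φ
    rw [subst_self, id_eq] at e1
    exact e1.trans hφ
  have hQ'ψ : CongrMod 1 Q' ψ := by
    have e1 : CongrMod 1 (Q' - Q) 0 := (hval.mono (by omega)).trans
      (congrMod_X_pow_mul hj _)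
    have e2 := e1.add hQψ
    simpa using e2
  have hpow : CongrMod (j + 1) (((V + Y) ^ m - V ^ m) * Q') (X 2 ^ j * ((m : MvPowerSeries (Fin 3) ℂ) * C b * ψ)) := by
    have e1 := (add_pow_congr hj hV1 hYj m).trans (hYb.mul_left (m : MvPowerSeries (Fin 3) ℂ))
    refine (e1.mul_right Q').trans ?_
    have e2 := CongrMod.pow_mul j (hQ'ψ.mul_left ((m : MvPowerSeries (Fin 3) ℂ) * C b))
    exact (CongrMod.of_eq (by ring)).trans e2
  have hval2 : CongrMod (j + 1) (V ^ m * (Q' - Q))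
      (X 2 ^ j * (η + hol (scaledSeries m ψ) F * pderiv ℂ 0 ψ +
        antihol (scaledSeries m ψ) F * pderiv ℂ 1 ψ)) := by
    refine (hval.mul_left (V ^ m)).trans ?_
    have e2 := CongrMod.pow_mul j ((hV1.pow m).mul_right
      (η + hol (scaledSeries m ψ) F * pderiv ℂ 0 ψ + antihol (scaledSeries m ψ) F * pderiv ℂ 1 ψ))
    rw [one_pow, one_mul] at e2
    exact (CongrMod.of_eq (by ring)).trans e2
  have hterm2 := (CongrMod.pow_mul m (hpow.add hval2)).mul_left (C (1 / 2))
  have hterm1 := (im_part_congr (ψ := ψ) (j := j) (q := q) hm hp hpr hpb).mul_left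
    (C (1 / (2 * Complex.I)))
  rw [← hD] at hterm1
  have hfin := hterm1.sub hterm2
  refine (CongrMod.of_eq ?_).trans (hfin.trans (CongrMod.of_eq ?_))
  · rw [hU, hU', h1, hol_add hf, antihol_add hf, mul_pow, mul_pow]; ring
  · have hI1 : (C (1 / (2 * Complex.I)) * C Complex.I : MvPowerSeries (Fin 3) ℂ) = C (1 / 2) := by
      rw [← map_mul]; congr 1; field_simp
    have hI2 : (C (1 / (2 * Complex.I)) : MvPowerSeries (Fin 3) ℂ) =
        -(C (1 / 2) * C Complex.I) := by
      rw [← map_mul, ← map_neg]; congr 1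
      rw [one_div, mul_inv, Complex.inv_I]; ring
    have hCm : (C (((j : ℂ) + 1 - m) * b) : MvPowerSeries (Fin 3) ℂ) =
        C (((j : ℂ) + 1) * b) - (m : MvPowerSeries (Fin 3) ℂ) * C b := by
      rw [sub_mul, map_sub, map_mul C (m : ℂ), map_natCast]
    rw [linearizedEquation, hCm, pow_add]
    linear_combination (X 2 ^ m * X 2 ^ j * C (((j : ℂ) + 1) * b) * ψ) * hI1 +
      (X 2 ^ m * X 2 ^ j * (hol (scaledSeries m ψ) q - antihol (scaledSeries m ψ) q)) * hI2

end Linearization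

/-! ### Taylor coefficients at `u = 0` -/

section Coefficients

theorem coeff_subst_X_zero_X_two (g : MvPowerSeries (Fin 2) ℂ) (k l : ℕ) :
    coeff (exp3 k l 0) (g.subst (![X 0, X 2] : Fin 2 → MvPowerSeries (Fin 3) ℂ)) =
      if l = 0 then coeff (exp2 k 0) g else 0 := by
  set e : Fin 2 ↪ Fin 3 := ⟨![0, 2], by decide⟩ with he
  have h1 : (![X 0, X 2] : Fin 2 → MvPowerSeries (Fin 3) ℂ) = X ∘ e := by
    funext i; fin_cases i <;> rfl
  rw [h1, ← rename_eq_subst]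
  split_ifs with hl
  · subst hl
    have h2 : Finsupp.embDomain e (exp2 k 0) = exp3 k 0 0 := by
      ext i
      fin_cases i
      · exact Finsupp.embDomain_apply_self e _ 0
      · exact Finsupp.embDomain_of_notMem_range e _ _ (by decide)
      · exact Finsupp.embDomain_apply_self e _ 1
    rw [← h2, coeff_embDomain_rename]
  · refine coeff_rename_eq_zero _ _ ?_
    rintro ⟨x, hx⟩
    have h3 : (Finsupp.mapDomain e x) 1 = 0 := Finsupp.mapDomain_of_notMem_range x _ (by decide)
    rw [hx] at h3
    exact hl h3

variable {m : ℕ} {ψ : MvPowerSeries (Fin 3) ℂ}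

/-- At `u = 0` the hypersurface collapses to `w = 0`, so only `g(z, 0)` remains visible. -/
theorem coeff_hol_scaledSeries (hm : 2 ≤ m) (ψ : MvPowerSeries (Fin 3) ℂ)
    (g : MvPowerSeries (Fin 2) ℂ) (k l : ℕ) :
    coeff (exp3 k l 0) (hol (scaledSeries m ψ) g) = if l = 0 then coeff (exp2 k 0) g else 0 := by
  rw [← coeff_subst_X_zero_X_two]
  have hf := constantCoeff_scaledSeries hm ψ
  refine CongrMod.coeff_eq (k := 1) (CongrMod.subst (hol_args_zero hf) ?_ ?_ g) zero_lt_one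
  · intro i; fin_cases i <;> simp
  · intro i
    fin_cases i
    · exact CongrMod.refl _ _
    · change CongrMod 1 (X 2 + C Complex.I * scaledSeries m ψ) (X 2)
      rw [CongrMod, scaledSeries_eq_X_mul hm, pow_one]
      exact ⟨C Complex.I * (X 2 ^ (m - 1) * (C (1 / 2) * ψ)), by ring⟩

theorem conjSwap_scaledSeries (hψ : conjSwap ψ = ψ) :
    conjSwap (scaledSeries m ψ) = scaledSeries m ψ := by
  rw [scaledSeries, map_mul, map_mul, map_pow, conjSwap_C, conjSwap_X_two, hψ]
  simp [map_ofNat]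

theorem coeff_antihol_scaledSeries (hm : 2 ≤ m) (hψ : conjSwap ψ = ψ)
    (g : MvPowerSeries (Fin 2) ℂ) (k l : ℕ) :
    coeff (exp3 k l 0) (antihol (scaledSeries m ψ) g) =
      if k = 0 then conj (coeff (exp2 l 0) g) else 0 := by
  rw [← conjSwap_hol (constantCoeff_scaledSeries hm ψ) (conjSwap_scaledSeries hψ),
    coeff_conjSwap, coeff_hol_scaledSeries hm]
  split_ifs <;> simp

theorem coeff_mul_of_z_series {g : MvPowerSeries (Fin 3) ℂ}
    (hg : ∀ k l, l ≠ 0 → coeff (exp3 k l 0) g = 0) (T : MvPowerSeries (Fin 3) ℂ) (k l : ℕ) :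
    coeff (exp3 k l 0) (g * T) =
      ∑ i ∈ Finset.range (k + 1), coeff (exp3 i 0 0) g * coeff (exp3 (k - i) l 0) T := by
  classical
  rw [coeff_mul]
  symm
  refine Finset.sum_of_injOn (fun i => (exp3 i 0 0, exp3 (k - i) l 0)) ?_ ?_ ?_ ?_
  · intro i _ i' _ h
    exact congrArg (fun p : (Fin 3 →₀ ℕ) × (Fin 3 →₀ ℕ) => p.1 0) h
  · intro i hi
    rw [Finset.coe_range, Set.mem_Iio] at hi
    rw [Finset.mem_coe, Finset.HasAntidiagonal.mem_antidiagonal]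
    ext s
    fin_cases s
    · change i + (k - i) = k; omega
    · change 0 + l = l; omega
    · rfl
  · rintro ⟨p, q⟩ hpq hn
    rw [Finset.HasAntidiagonal.mem_antidiagonal] at hpq
    have e0 : p 0 + q 0 = k := congrArg (· 0) hpq
    have e1 : p 1 + q 1 = l := congrArg (· 1) hpq
    have e2 : p 2 + q 2 = 0 := congrArg (· 2) hpq
    have hp2 : p 2 = 0 := by omega
    have hq2 : q 2 = 0 := by omega
    by_cases h1 : p 1 = 0
    · exfalso
      refine hn ⟨p 0, by rw [Finset.coe_range, Set.mem_Iio]; omega, ?_⟩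
      refine Prod.ext ?_ ?_
      · change exp3 (p 0) 0 0 = p
        rw [eq_exp3 p, h1, hp2]; rfl
      · change exp3 (k - p 0) l 0 = q
        rw [eq_exp3 q, exp3_inj]
        omega
    · change coeff p g * _ = 0
      rw [eq_exp3 p, hp2, hg _ _ h1, zero_mul]
  · intro i _; rfl

theorem coeff_pderiv_zero (T : MvPowerSeries (Fin 3) ℂ) (k l j : ℕ) :
    coeff (exp3 k l j) (pderiv ℂ 0 T) = (k + 1) * coeff (exp3 (k + 1) l j) T := by
  rw [coeff_pderiv, mul_comm]
  congr 2
  congr 1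
  ext i; fin_cases i <;> simp [exp3]

theorem coeff_pderiv_one (T : MvPowerSeries (Fin 3) ℂ) (k l j : ℕ) :
    coeff (exp3 k l j) (pderiv ℂ 1 T) = (l + 1) * coeff (exp3 k (l + 1) j) T := by
  rw [coeff_pderiv, mul_comm]
  congr 2
  congr 1
  ext i; fin_cases i <;> simp [exp3]

theorem conjSwap_pderiv_zero (hψ : conjSwap ψ = ψ) : conjSwap (pderiv ℂ 0 ψ) = pderiv ℂ 1 ψ := by
  refine ext_exp3 fun k l j => ?_
  rw [coeff_conjSwap, coeff_pderiv_zero, coeff_pderiv_one]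
  conv_rhs => rw [← hψ, coeff_conjSwap]
  simp

/-- The coefficients of the product of `f(z)` and `∂S/∂z`, where `S = ∑ S k l z ^ k χ ^ l`. -/
def fieldCoeff (f : ℕ → ℂ) (S : ℕ → ℕ → ℂ) (k l : ℕ) : ℂ :=
  ∑ i ∈ Finset.range (k + 1), f i * (((k - i : ℕ) + 1) * S (k - i + 1) l)

/-- The coefficients of the linearized equation, without the unknown increment of the target. -/
def linearizedCoeff (S : ℕ → ℕ → ℂ) (κ : ℂ) (f q : ℕ → ℂ) (k l : ℕ) : ℂ :=
  κ * S k l - Complex.I * ((if l = 0 then q k else 0) - if k = 0 then conj (q l) else 0) -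
    fieldCoeff f S k l - conj (fieldCoeff f S l k)

theorem coeff_linearizedEquation (hm : 2 ≤ m) (hψ : conjSwap ψ = ψ) (j : ℕ)
    (F q : MvPowerSeries (Fin 2) ℂ) (b : ℂ) (η : MvPowerSeries (Fin 3) ℂ) (k l : ℕ) :
    coeff (exp3 k l 0) (linearizedEquation m j ψ F q b η) =
      linearizedCoeff (fun k l => coeff (exp3 k l 0) ψ) (((j : ℂ) + 1 - m) * b)
        (fun k => coeff (exp2 k 0) F) (fun k => coeff (exp2 k 0) q) k l -
      coeff (exp3 k l 0) η := by
  have hf := constantCoeff_scaledSeries hm ψ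
  have hfr : conjSwap (scaledSeries m ψ) = scaledSeries m ψ := conjSwap_scaledSeries hψ
  have h1 : ∀ k l, coeff (exp3 k l 0) (hol (scaledSeries m ψ) F * pderiv ℂ 0 ψ) =
      fieldCoeff (fun k => coeff (exp2 k 0) F) (fun k l => coeff (exp3 k l 0) ψ) k l := by
    intro k l
    rw [coeff_mul_of_z_series fun k l hl => by rw [coeff_hol_scaledSeries hm, if_neg hl]]
    refine Finset.sum_congr rfl fun i _ => ?_
    rw [coeff_hol_scaledSeries hm, if_pos rfl, coeff_pderiv_zero]
  -- The antiholomorphic term is the image of the holomorphic one under the involution, so its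
  -- coefficients need no separate computation.
  have h2 : antihol (scaledSeries m ψ) F * pderiv ℂ 1 ψ =
      conjSwap (hol (scaledSeries m ψ) F * pderiv ℂ 0 ψ) := by
    rw [map_mul, conjSwap_hol hf hfr, conjSwap_pderiv_zero hψ]
  rw [linearizedEquation, h2]
  simp only [map_sub, coeff_C_mul, coeff_conjSwap, h1, coeff_hol_scaledSeries hm,
    coeff_antihol_scaledSeries hm hψ]
  rw [linearizedCoeff]

end Coefficients

/-! ### The homological equation -/

section HomologicalEquation

/-- The coefficients `S k l` of a real series `ε z χ + ∑_{k, l ≥ 2} S k l z ^ k χ ^ l`. -/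
structure IsAdmissibleJet (ε : ℂ) (S : ℕ → ℕ → ℂ) : Prop where
  sq : ε ^ 2 = 1
  conj_eq : conj ε = ε
  real : ∀ k l, S l k = conj (S k l)
  zero : ∀ k, S k 0 = 0
  one_one : S 1 1 = ε
  one : ∀ k, k ≠ 1 → S k 1 = 0

/-- The `(2, 2)` coefficient of the homological equation. -/
def system22 (S : ℕ → ℕ → ℂ) (κ a a' : ℂ) : ℂ := κ * S 2 2 + 3 * S 3 2 * a + 3 * S 2 3 * a'

/-- The `(2, 3)` coefficient of the homological equation. -/
def system23 (ε : ℂ) (S : ℕ → ℕ → ℂ) (κ a a' θ : ℂ) : ℂ :=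
  3 / 2 * κ * S 2 3 + (3 * S 3 3 - 4 * ε * S 2 2 ^ 2) * a + 4 * S 2 4 * a' -
    Complex.I * θ * S 2 3

/-- The `(3, 2)` coefficient of the homological equation. -/
def system32 (ε : ℂ) (S : ℕ → ℕ → ℂ) (κ a a' θ : ℂ) : ℂ :=
  3 / 2 * κ * S 3 2 + 4 * S 4 2 * a + (3 * S 3 3 - 4 * ε * S 2 2 ^ 2) * a' +
    Complex.I * θ * S 3 2

/-- The `(3, 3)` coefficient of the homological equation. -/
def system33 (ε : ℂ) (S : ℕ → ℕ → ℂ) (κ a a' : ℂ) : ℂ :=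
  2 * κ * S 3 3 + 4 * (S 4 3 - ε * S 2 2 * S 3 2) * a + 4 * (S 3 4 - ε * S 2 2 * S 2 3) * a'

/-- Unique solvability of the homological equation. -/
structure IsNonresonantJet (ε : ℂ) (S : ℕ → ℕ → ℂ) : Prop where
  injective : ∀ κ a a' θ : ℂ, system22 S κ a a' = 0 → system23 ε S κ a a' θ = 0 →
    system32 ε S κ a a' θ = 0 → system33 ε S κ a a' = 0 → κ = 0 ∧ a = 0 ∧ a' = 0 ∧ θ = 0
  surjective : ∀ y22 y23 y32 y33 : ℂ, ∃ κ a a' θ : ℂ, system22 S κ a a' = y22 ∧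
    system23 ε S κ a a' θ = y23 ∧ system32 ε S κ a a' θ = y32 ∧ system33 ε S κ a a' = y33
  injective_reduced : ∀ a a' θ : ℂ, system22 S 0 a a' = 0 → system23 ε S 0 a a' θ = 0 →
    system32 ε S 0 a a' θ = 0 → a = 0 ∧ a' = 0 ∧ θ = 0
  surjective_reduced : ∀ y22 y23 y32 : ℂ, ∃ a a' θ : ℂ, system22 S 0 a a' = y22 ∧
    system23 ε S 0 a a' θ = y23 ∧ system32 ε S 0 a a' θ = y32

/-- The indices `(k, l)` of the coefficients of `z ^ k z̄ ^ l u ^ j`, `j ≥ 1`, which vanish in the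
normal form. -/
def MustVanish (m j k l : ℕ) : Prop :=
  k < 2 ∨ l < 2 ∨ (k = 2 ∧ l = 2) ∨ (k = 2 ∧ l = 3) ∨ (k = 3 ∧ l = 2) ∨
    (k = 3 ∧ l = 3 ∧ j + 1 ≠ m)

theorem MustVanish.symm {m j k l : ℕ} (h : MustVanish m j k l) : MustVanish m j l k := by
  unfold MustVanish at *; omega

variable {ε : ℂ} {S : ℕ → ℕ → ℂ} {κ : ℂ} {f q : ℕ → ℂ}

/-- This halves the work: of each conjugate pair of equations only one has to be solved. -/
theorem linearizedCoeff_symm (hS : IsAdmissibleJet ε S) (hκ : conj κ = κ) (k l : ℕ) :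
    linearizedCoeff S κ f q l k = conj (linearizedCoeff S κ f q k l) := by
  simp only [linearizedCoeff, map_sub, map_mul, hκ, ← hS.real, Complex.conj_I, Complex.conj_conj]
  split_ifs <;> simp <;> ring

theorem IsAdmissibleJet.zero_left (hS : IsAdmissibleJet ε S) (l : ℕ) : S 0 l = 0 := by
  rw [hS.real, hS.zero, map_zero]

theorem IsAdmissibleJet.one_left (hS : IsAdmissibleJet ε S) {l : ℕ} (hl : l ≠ 1) : S 1 l = 0 := by
  rw [hS.real, hS.one l hl, map_zero]

theorem fieldCoeff_one_right (hS : IsAdmissibleJet ε S) (k : ℕ) :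
    fieldCoeff f S k 1 = f k * ε := by
  rw [fieldCoeff, Finset.sum_range_succ, Finset.sum_eq_zero]
  · simp [hS.one_one]
  · intro i hi
    rw [Finset.mem_range] at hi
    rw [hS.one _ (by omega)]
    simp

theorem fieldCoeff_zero_right (hS : IsAdmissibleJet ε S) (k : ℕ) : fieldCoeff f S k 0 = 0 := by
  simp [fieldCoeff, hS.zero]

/-- The jet has no pure terms, hence `q k` appears with coefficient `-i`, accompanied only by `f 0`.
These equations serve to eliminate `q`. -/
theorem linearizedCoeff_zero (hS : IsAdmissibleJet ε S) {k : ℕ} (hk : k ≠ 0) :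
    linearizedCoeff S κ f q k 0 = -(Complex.I * q k) - conj (f 0 * S 1 k) := by
  rw [linearizedCoeff, fieldCoeff_zero_right hS]
  simp [hS.zero, hk, fieldCoeff]

theorem linearizedCoeff_zero_zero (hS : IsAdmissibleJet ε S) :
    linearizedCoeff S κ f q 0 0 = -(Complex.I * (q 0 - conj (q 0))) := by
  rw [linearizedCoeff, fieldCoeff_zero_right hS]
  simp [hS.zero]

/-- The only monomial of the jet linear in `χ` is `ε z χ`, hence `f k` appears with the invertible
coefficient `-ε`. These equations express `f k` through `f 0`. -/
theorem linearizedCoeff_one (hS : IsAdmissibleJet ε S) {k : ℕ} (hk : 2 ≤ k) :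
    linearizedCoeff S κ f q k 1 = -(f k * ε) - 2 * conj (f 0) * S k 2 := by
  have h0 : k ≠ 0 := by omega
  have h1 : k ≠ 1 := by omega
  rw [linearizedCoeff, fieldCoeff_one_right hS]
  simp [fieldCoeff, Finset.sum_range_succ, hS.one_left h1, hS.one k h1, h0, ← hS.real]
  ring

theorem linearizedCoeff_one_one (hS : IsAdmissibleJet ε S) :
    linearizedCoeff S κ f q 1 1 = κ * ε - f 1 * ε - conj (f 1) * ε := by
  rw [linearizedCoeff, fieldCoeff_one_right hS]
  simp [hS.one_one, hS.conj_eq]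

theorem linearizedCoeff_two_two (hS : IsAdmissibleJet ε S) :
    linearizedCoeff S κ f q 2 2 = κ * S 2 2 - (3 * S 3 2 * f 0 + 2 * S 2 2 * f 1) -
      (3 * S 2 3 * conj (f 0) + 2 * S 2 2 * conj (f 1)) := by
  have h1 : S 1 2 = 0 := hS.one_left (by norm_num)
  rw [linearizedCoeff]
  simp [fieldCoeff, Finset.sum_range_succ, h1, ← hS.real, map_ofNat]
  ring

theorem linearizedCoeff_two_three (hS : IsAdmissibleJet ε S) :
    linearizedCoeff S κ f q 2 3 = κ * S 2 3 - (3 * S 3 3 * f 0 + 2 * S 2 3 * f 1) -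
      (4 * S 2 4 * conj (f 0) + 3 * S 2 3 * conj (f 1) + 2 * S 2 2 * conj (f 2)) := by
  have h1 : S 1 2 = 0 := hS.one_left (by norm_num)
  have h2 : S 1 3 = 0 := hS.one_left (by norm_num)
  rw [linearizedCoeff]
  simp [fieldCoeff, Finset.sum_range_succ, h1, h2, ← hS.real, map_ofNat]
  ring

theorem linearizedCoeff_three_three (hS : IsAdmissibleJet ε S) :
    linearizedCoeff S κ f q 3 3 =
      κ * S 3 3 - (4 * S 4 3 * f 0 + 3 * S 3 3 * f 1 + 2 * S 2 3 * f 2) -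
      (4 * S 3 4 * conj (f 0) + 3 * S 3 3 * conj (f 1) + 2 * S 3 2 * conj (f 2)) := by
  have h1 : S 1 3 = 0 := hS.one_left (by norm_num)
  rw [linearizedCoeff]
  simp [fieldCoeff, Finset.sum_range_succ, h1, ← hS.real, map_ofNat]
  ring

/-- The homological equation has only the trivial solution. -/
theorem homological_injective (hS : IsAdmissibleJet ε S) (hN : IsNonresonantJet ε S)
    {m j : ℕ} (hκ : conj κ = κ) (hκm : j + 1 = m → κ = 0)
    (h : ∀ k l, MustVanish m j k l → linearizedCoeff S κ f q k l = 0) :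
    κ = 0 ∧ ∀ k, f k = 0 := by
  have hε : ε * ε = 1 := by rw [← sq, hS.sq]
  have e11 := h 1 1 (by unfold MustVanish; omega)
  rw [linearizedCoeff_one_one hS] at e11
  have e11' : f 1 + conj (f 1) = κ := by linear_combination (-ε) * e11 + (κ - f 1 - conj (f 1)) * hε
  have ek : ∀ k, 2 ≤ k → f k = -2 * ε * conj (f 0) * S k 2 := by
    intro k hk
    have := h k 1 (by unfold MustVanish; omega)
    rw [linearizedCoeff_one hS hk] at this
    linear_combination (-ε) * this - f k * hε
  have e2 := ek 2 le_rfl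
  have e2' : conj (f 2) = -2 * ε * f 0 * S 2 2 := by
    rw [e2]
    simp only [map_mul, map_neg, hS.conj_eq, Complex.conj_conj, ← hS.real, map_ofNat]
  set θ : ℂ := (f 1 - conj (f 1)) / (2 * Complex.I) with hθ
  have hI : Complex.I * θ = (f 1 - conj (f 1)) / 2 := by
    rw [hθ]; field_simp
  have e22 := h 2 2 (by unfold MustVanish; omega)
  rw [linearizedCoeff_two_two hS] at e22
  have e23 := h 2 3 (by unfold MustVanish; omega)
  rw [linearizedCoeff_two_three hS, e2'] at e23
  have e32 : conj (linearizedCoeff S κ f q 2 3) = 0 := by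
    rw [h 2 3 (by unfold MustVanish; omega), map_zero]
  rw [linearizedCoeff_two_three hS] at e32
  simp only [map_sub, map_add, map_mul, hκ, ← hS.real, Complex.conj_conj, map_ofNat, e2] at e32
  have s22 : system22 S κ (f 0) (conj (f 0)) = 0 := by
    rw [system22]; linear_combination -e22 - 2 * S 2 2 * e11'
  have s23 : system23 ε S κ (f 0) (conj (f 0)) θ = 0 := by
    rw [system23]; linear_combination -e23 - S 2 3 * hI - (5 / 2) * S 2 3 * e11'
  have s32 : system32 ε S κ (f 0) (conj (f 0)) θ = 0 := by
    rw [system32]; linear_combination -e32 + S 3 2 * hI - (5 / 2) * S 3 2 * e11'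
  have hfin : κ = 0 ∧ f 0 = 0 ∧ θ = 0 := by
    -- At the resonant order `j + 1 = m` the (3,3) equation is not available, but `κ` is zero anyway
    -- and the reduced system decides.
    by_cases hjm : j + 1 = m
    · have hκ0 := hκm hjm
      rw [hκ0] at s22 s23 s32
      obtain ⟨h1, _, h3⟩ := hN.injective_reduced _ _ _ s22 s23 s32
      exact ⟨hκ0, h1, h3⟩
    · have e33 := h 3 3 (by unfold MustVanish; omega)
      rw [linearizedCoeff_three_three hS, e2', e2] at e33
      have s33 : system33 ε S κ (f 0) (conj (f 0)) = 0 := by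
        rw [system33]; linear_combination -e33 - 3 * S 3 3 * e11'
      obtain ⟨h1, h2, _, h4⟩ := hN.injective _ _ _ _ s22 s23 s32 s33
      exact ⟨h1, h2, h4⟩
  obtain ⟨h1, h2, h3⟩ := hfin
  refine ⟨h1, fun k => ?_⟩
  rcases Nat.lt_or_ge k 2 with hk | hk
  · interval_cases k
    · exact h2
    · rw [h3, mul_zero] at hI
      rw [h1] at e11'
      linear_combination (1 / 2) * e11' - hI
  · rw [ek k hk, h2]; simp

/-- Real solutions of the linear system with real data. -/
theorem exists_real_solution (hS : IsAdmissibleJet ε S) (hN : IsNonresonantJet ε S)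
    (m j : ℕ) {y22 y23 y33 : ℂ} (h22 : conj y22 = y22) (h33 : conj y33 = y33) :
    ∃ κ a θ : ℂ, conj κ = κ ∧ conj θ = θ ∧ (j + 1 = m → κ = 0) ∧
      system22 S κ a (conj a) = y22 ∧ system23 ε S κ a (conj a) θ = y23 ∧
      (j + 1 ≠ m → system33 ε S κ a (conj a) = y33) := by
  -- Conjugation exchanges `a` with `a'` and the (2,3) equation with the (3,2) equation.
  have hconj : ∀ κ a a' θ,
      conj (system22 S κ a a') = system22 S (conj κ) (conj a') (conj a) ∧
      conj (system23 ε S κ a a' θ) = system32 ε S (conj κ) (conj a') (conj a) (conj θ) ∧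
      conj (system32 ε S κ a a' θ) = system23 ε S (conj κ) (conj a') (conj a) (conj θ) ∧
      conj (system33 ε S κ a a') = system33 ε S (conj κ) (conj a') (conj a) := by
    intro κ a a' θ
    simp only [system22, system23, system32, system33, map_add, map_sub, map_mul, map_pow,
      map_div₀, map_ofNat, ← hS.real, hS.conj_eq, Complex.conj_I]
    refine ⟨by ring, by ring, by ring, by ring⟩
  have hhalf : conj (1 / 2 : ℂ) = 1 / 2 := by simp [map_ofNat]
  have hmain : ∃ κ a a' θ : ℂ, (j + 1 = m → κ = 0) ∧ system22 S κ a a' = y22 ∧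
      system23 ε S κ a a' θ = y23 ∧ system32 ε S κ a a' θ = conj y23 ∧
      (j + 1 ≠ m → system33 ε S κ a a' = y33) := by
    by_cases hjm : j + 1 = m
    · obtain ⟨a, a', θ, h1, h2, h3⟩ := hN.surjective_reduced y22 y23 (conj y23)
      exact ⟨0, a, a', θ, fun _ => rfl, h1, h2, h3, fun h => absurd hjm h⟩
    · obtain ⟨κ, a, a', θ, h1, h2, h3, h4⟩ := hN.surjective y22 y23 (conj y23) y33
      exact ⟨κ, a, a', θ, fun h => absurd h hjm, h1, h2, h3, fun _ => h4⟩
  obtain ⟨κ, a, a', θ, hκ, h1, h2, h3, h4⟩ := hmain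
  obtain ⟨c22, c23, c32, c33⟩ := hconj κ a a' θ
  -- The mean of a solution and its conjugate solves the same linear system with real data, has real
  -- `κ` and `θ`, and satisfies `a' = conj a`.
  refine ⟨1 / 2 * (κ + conj κ), 1 / 2 * (a + conj a'), 1 / 2 * (θ + conj θ), ?_, ?_, ?_, ?_, ?_, ?_⟩
  · rw [map_mul, map_add, Complex.conj_conj, hhalf]; ring
  · rw [map_mul, map_add, Complex.conj_conj, hhalf]; ring
  · intro h; rw [hκ h]; simp
  · rw [h1, h22] at c22
    rw [map_mul, map_add, Complex.conj_conj, hhalf]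
    rw [system22] at *
    linear_combination (1 / 2) * h1 - (1 / 2) * c22
  · rw [h3, Complex.conj_conj] at c32
    rw [map_mul, map_add, Complex.conj_conj, hhalf]
    rw [system23] at *
    linear_combination (1 / 2) * h2 - (1 / 2) * c32
  · intro h
    rw [h4 h, h33] at c33
    have h4' := h4 h
    rw [map_mul, map_add, Complex.conj_conj, hhalf]
    rw [system33] at *
    linear_combination (1 / 2) * h4' - (1 / 2) * c33

/-- The homological equation is solvable for every real right-hand side. -/
theorem homological_surjective (hS : IsAdmissibleJet ε S) (hN : IsNonresonantJet ε S)
    (m j : ℕ) {r : ℕ → ℕ → ℂ} (hr : ∀ k l, r l k = conj (r k l)) :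
    ∃ (κ : ℂ) (f q : ℕ → ℂ), conj κ = κ ∧ (j + 1 = m → κ = 0) ∧
      ∀ k l, MustVanish m j k l → linearizedCoeff S κ f q k l = r k l := by
  have hε : ε * ε = 1 := by rw [← sq, hS.sq]
  have hhalf : conj (1 / 2 : ℂ) = 1 / 2 := by simp [map_ofNat]
  -- The data are what the (2,2), (2,3) and (3,3) equations retain after `Re (f 1)` and `f 2` are
  -- eliminated by means of the equations (1,1) and (2,1).
  obtain ⟨κ, a, θ, hκ, hθ, hκm, s22, s23, s33⟩ := exists_real_solution hS hN m j
    (y22 := 2 * ε * S 2 2 * r 1 1 - r 2 2)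
    (y23 := 5 / 2 * ε * r 1 1 * S 2 3 + 2 * ε * S 2 2 * r 1 2 - r 2 3)
    (y33 := 3 * ε * S 3 3 * r 1 1 + 2 * ε * S 2 3 * r 2 1 + 2 * ε * S 3 2 * r 1 2 - r 3 3)
    (by simp only [map_sub, map_mul, ← hS.real, ← hr, hS.conj_eq, map_ofNat])
    (by simp only [map_add, map_sub, map_mul, ← hS.real, ← hr, hS.conj_eq, map_ofNat]; ring)
  set f : ℕ → ℂ := fun k => if k = 0 then a else if k = 1 then
    1 / 2 * (κ - ε * r 1 1) + Complex.I * θ else -ε * (r k 1 + 2 * conj a * S k 2) with hf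
  -- The factor one half at `k = 0` is due to the constant equation involving `q 0 - conj (q 0)`,
  -- where the same unknown occurs twice.
  set q : ℕ → ℂ := fun k => Complex.I * (r k 0 + conj (f 0 * S 1 k)) *
    (if k = 0 then 1 / 2 else 1) with hq
  have f0 : f 0 = a := by simp [hf]
  have f1 : f 1 = 1 / 2 * (κ - ε * r 1 1) + Complex.I * θ := by simp [hf]
  have f1c : conj (f 1) = 1 / 2 * (κ - ε * r 1 1) - Complex.I * θ := by
    rw [f1]
    simp only [map_add, map_sub, map_mul, hκ, hhalf, hθ, ← hr, hS.conj_eq, Complex.conj_I]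
    ring
  have fk : ∀ k, 2 ≤ k → f k = -ε * (r k 1 + 2 * conj a * S k 2) := by
    intro k hk
    simp [hf, show k ≠ 0 by omega, show k ≠ 1 by omega]
  have f2c : conj (f 2) = -ε * (r 1 2 + 2 * a * S 2 2) := by
    rw [fk 2 le_rfl]
    simp only [map_add, map_mul, map_neg, ← hr, ← hS.real, hS.conj_eq, Complex.conj_conj,
      map_ofNat]
  have key : ∀ k l, MustVanish m j k l → l ≤ k ∨ (k = 2 ∧ l = 3) → ¬ (k = 3 ∧ l = 2) →
      linearizedCoeff S κ f q k l = r k l := by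
    intro k l h hkl h32
    have hcases : l = 0 ∨ (l = 1 ∧ 1 ≤ k) ∨ (k = 2 ∧ l = 2) ∨ (k = 2 ∧ l = 3) ∨
        (k = 3 ∧ l = 3 ∧ j + 1 ≠ m) := by
      unfold MustVanish at h; omega
    rcases hcases with rfl | ⟨rfl, hk⟩ | ⟨rfl, rfl⟩ | ⟨rfl, rfl⟩ | ⟨rfl, rfl, hjm⟩
    · rcases Nat.eq_zero_or_pos k with rfl | hk
      · have hq0 : q 0 = Complex.I * r 0 0 * (1 / 2) := by
          simp [hq, hS.zero]
        rw [linearizedCoeff_zero_zero hS, hq0]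
        simp only [map_mul, hhalf, ← hr, Complex.conj_I]
        linear_combination (-r 0 0) * Complex.I_sq
      · rw [linearizedCoeff_zero hS (by omega)]
        have hqk : q k = Complex.I * (r k 0 + conj (f 0 * S 1 k)) := by
          simp [hq, show k ≠ 0 by omega]
        rw [hqk]
        linear_combination (-(r k 0 + conj (f 0 * S 1 k))) * Complex.I_sq
    · rcases hk.eq_or_lt with rfl | hk
      · rw [linearizedCoeff_one_one hS, f1c, f1]
        linear_combination (r 1 1) * hε
      · rw [linearizedCoeff_one hS hk, fk k hk, f0]
        linear_combination (r k 1 + 2 * conj a * S k 2) * hε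
    · rw [linearizedCoeff_two_two hS, f1c, f1, f0]
      rw [system22] at s22
      linear_combination -s22
    · rw [linearizedCoeff_two_three hS, f1c, f1, f0, f2c]
      rw [system23] at s23
      linear_combination -s23
    · rw [linearizedCoeff_three_three hS, f1c, f1, f0, f2c, fk 2 le_rfl]
      have s33' := s33 hjm
      rw [system33] at s33'
      linear_combination -s33'
  refine ⟨κ, f, q, hκ, hκm, fun k l h => ?_⟩
  by_cases hkl : (l ≤ k ∨ (k = 2 ∧ l = 3)) ∧ ¬ (k = 3 ∧ l = 2)
  · exact key k l h hkl.1 hkl.2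
  · rw [linearizedCoeff_symm hS hκ l k, key l k h.symm (by omega) (by omega), ← hr]

end HomologicalEquation

/-! ### Columns: series in `z` as coefficients of powers of another variable -/

section ZSeries

/-- The embedding of the power series in `z`. -/
def zSeries : MvPowerSeries Unit ℂ →ₐ[ℂ] MvPowerSeries (Fin 3) ℂ :=
  rename (R := ℂ) (fun _ : Unit => (0 : Fin 3))

theorem coeff_zSeries (p : PowerSeries ℂ) (e : Fin 3 →₀ ℕ) :
    coeff e (zSeries p) = if e 1 = 0 ∧ e 2 = 0 then PowerSeries.coeff (e 0) p else 0 := by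
  set i : Unit ↪ Fin 3 := ⟨fun _ => 0, fun _ _ _ => rfl⟩
  split_ifs with h
  · have h2 : Finsupp.embDomain i (Finsupp.single () (e 0)) = e := by
      rw [Finsupp.embDomain_single]
      change Finsupp.single (0 : Fin 3) (e 0) = e
      ext s
      fin_cases s <;> simp [h.1, h.2]
    conv_lhs => rw [← h2]
    exact coeff_embDomain_rename i p (Finsupp.single () (e 0))
  · refine coeff_rename_eq_zero _ _ ?_
    rintro ⟨x, hx⟩
    refine h ⟨?_, ?_⟩
    · rw [← hx]; exact Finsupp.mapDomain_of_notMem_range x _ (by simp)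
    · rw [← hx]; exact Finsupp.mapDomain_of_notMem_range x _ (by simp)

theorem coeff_X_pow_mul_zSeries {s t : Fin 3} (hs : s ≠ 0) (ht : t ≠ 0) (hst : s ≠ t) (i : ℕ)
    (p : PowerSeries ℂ) (e : Fin 3 →₀ ℕ) :
    coeff e (X s ^ i * zSeries p) =
      if e s = i ∧ e t = 0 then PowerSeries.coeff (e 0) p else 0 := by
  classical
  rw [X_pow_eq, coeff_monomial_mul, coeff_zSeries, one_mul, ← ite_and]
  have hcond : (Finsupp.single s i ≤ e ∧ (e - Finsupp.single s i) 1 = 0 ∧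
      (e - Finsupp.single s i) 2 = 0) ↔ (e s = i ∧ e t = 0) := by
    rw [Finsupp.single_le_iff]
    fin_cases s <;> fin_cases t <;> simp at hs ht hst ⊢ <;> omega
  have h0 : (e - Finsupp.single s i) 0 = e 0 := by
    simp [hs]
  simp only [hcond, h0]

/-- The coefficient of `X s ^ k`, as a series in `z`. -/
def column (s : Fin 3) (k : ℕ) (T : MvPowerSeries (Fin 3) ℂ) : PowerSeries ℂ :=
  PowerSeries.mk fun a => coeff (Finsupp.single 0 a + Finsupp.single s k) T

/-- Modulo the ideal generated by `X s ^ n` and `X t`, a series is a polynomial in `X s` with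
coefficients in `z`. It is needed both for the hypersurface (powers of `χ`, `u = 0`) and for `Φ`
(powers of `ζ`, `w = 0`). -/
theorem exists_column_decomposition {s t : Fin 3} (hs : s ≠ 0) (ht : t ≠ 0) (hst : s ≠ t) (n : ℕ)
    (T : MvPowerSeries (Fin 3) ℂ) :
    ∃ A B, T = ∑ k ∈ Finset.range n, X s ^ k * zSeries (column s k T) + X s ^ n * A + X t * B := by
  classical
  set D := T - ∑ k ∈ Finset.range n, X s ^ k * zSeries (column s k T) with hD
  have hD0 : ∀ e : Fin 3 →₀ ℕ, e s < n → e t = 0 → coeff e D = 0 := by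
    intro e hes het
    have he : Finsupp.single 0 (e 0) + Finsupp.single s (e s) = e := by
      ext i
      fin_cases s <;> fin_cases t <;> fin_cases i <;> simp at hs ht hst het ⊢ <;> omega
    rw [hD, map_sub, map_sum, Finset.sum_eq_single (e s)]
    · rw [coeff_X_pow_mul_zSeries hs ht hst, if_pos ⟨rfl, het⟩, column, PowerSeries.coeff_mk, he,
        sub_self]
    · intro i _ hi
      rw [coeff_X_pow_mul_zSeries hs ht hst, if_neg fun h => hi h.1.symm]
    · intro h; exact absurd (Finset.mem_range.mpr hes) h
  -- `A'` keeps the monomials free of `X t`; those with small exponent of `X s` have already been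
  -- removed from `D`.
  let A' : MvPowerSeries (Fin 3) ℂ := fun e => if e t = 0 then coeff e D else 0
  have hA' : ∀ e, coeff e A' = if e t = 0 then coeff e D else 0 := fun e => rfl
  obtain ⟨A, hA⟩ : X s ^ n ∣ A' := X_pow_dvd_iff.mpr fun e he => by
    rw [hA']
    split_ifs with h
    · exact hD0 e he h
    · rfl
  obtain ⟨B, hB⟩ : X t ∣ D - A' := X_dvd_iff.mpr fun e he => by
    rw [map_sub, hA', if_pos he, sub_self]
  refine ⟨A, B, ?_⟩
  rw [← hA, ← hB, hD]
  ring

/-- Coefficients at exponents without `X t` and with fewer than `n` factors `X s` are invisible to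
the ideal, so comparison of columns modulo the ideal is legitimate. -/
theorem column_eq_zero_of_sum {s t : Fin 3} (hs : s ≠ 0) (ht : t ≠ 0) (hst : s ≠ t) {n : ℕ}
    {g : ℕ → PowerSeries ℂ} {A B : MvPowerSeries (Fin 3) ℂ}
    (h : ∑ k ∈ Finset.range n, X s ^ k * zSeries (g k) = X s ^ n * A + X t * B) {k : ℕ}
    (hk : k < n) : g k = 0 := by
  classical
  ext a
  set e : Fin 3 →₀ ℕ := Finsupp.single 0 a + Finsupp.single s k with he
  have e0 : e 0 = a := by simp [he, hs]
  have es : e s = k := by simp [he, hs.symm]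
  have et : e t = 0 := by simp [he, ht.symm, hst]
  have h1 := congrArg (coeff e) h
  rw [map_sum, Finset.sum_eq_single k, coeff_X_pow_mul_zSeries hs ht hst, if_pos ⟨es, et⟩, e0,
    map_add, X_pow_dvd_iff.mp (dvd_mul_right (X s ^ n) A) e (by omega),
    X_dvd_iff.mp (dvd_mul_right (X t) B) e et] at h1
  · simpa using h1
  · intro i _ hi
    rw [coeff_X_pow_mul_zSeries hs ht hst, if_neg fun h => hi (h.1.symm.trans es)]
  · intro h; exact absurd (Finset.mem_range.mpr hk) h

theorem zSeries_subst {a : Fin 3 → MvPowerSeries (Fin 3) ℂ} (ha : ∀ i, constantCoeff (a i) = 0)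
    (h0 : a 0 = X 0) (p : PowerSeries ℂ) : (zSeries p).subst a = zSeries p := by
  rw [zSeries, rename_eq_subst, subst_comp_subst_apply (HasSubst.X_comp _) (hasSubst_of_zero ha)]
  congr 1
  funext i
  exact (subst_X (hasSubst_of_zero ha) _).trans h0

end ZSeries

/-! ### The associated equation to leading order -/

section AssociatedODE

variable {m : ℕ} {ψ Θ Φ : MvPowerSeries (Fin 3) ℂ}

theorem CongrMod.pderiv_zero {k : ℕ} {x y : MvPowerSeries (Fin 3) ℂ} (h : CongrMod k x y) :
    CongrMod k (pderiv ℂ 0 x) (pderiv ℂ 0 y) := by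
  rw [congrMod_iff]
  intro a b c hc
  rw [coeff_pderiv_zero, coeff_pderiv_zero, h.coeff_eq hc]

/-- The leading terms of the complex defining series. -/
theorem complexDefiningSeries_congr (hm : 2 ≤ m)
    (h : IsComplexDefiningSeries (scaledSeries m ψ) Θ) :
    CongrMod (m + 1) Θ (X 2 + X 2 ^ m * (C Complex.I * ψ)) ∧
      ∃ θ, Θ = X 2 * θ ∧ CongrMod 1 θ 1 := by
  obtain ⟨hΘ0, heq⟩ := h
  set Y := C (1 / 2) * (Θ + X 2) with hY
  set a : Fin 3 → MvPowerSeries (Fin 3) ℂ := ![X 0, X 1, Y] with ha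
  have ha0 : ∀ i, constantCoeff (a i) = 0 := by intro i; fin_cases i <;> simp [ha, hY, hΘ0]
  have hs := hasSubst_of_zero ha0
  set Ψ := ψ.subst a with hΨ
  have heq' : C (1 / (2 * Complex.I)) * (Θ - X 2) = C (1 / 2) * Y ^ m * Ψ := by
    rw [heq, scaledSeries, subst_mul hs, subst_mul hs, subst_pow hs, subst_X hs, subst_C]
    rfl
  have hI1 : (C Complex.I * 2 * C (1 / (2 * Complex.I)) : MvPowerSeries (Fin 3) ℂ) = 1 := by
    rw [mul_comm, mul_comm (C Complex.I)]; exact C_inv_two_I_mul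
  have heq2 : Θ - X 2 = C Complex.I * (Y ^ m * Ψ) := by
    linear_combination (C Complex.I * 2) * heq' - (Θ - X 2) * hI1 +
      C Complex.I * (Y ^ m * Ψ) * C_half_mul_two (σ := Fin 3)
  obtain ⟨n, rfl⟩ := Nat.exists_eq_add_of_le hm
  -- One factor `Y = (Θ + τ) / 2` of `Y^m` is expanded, and the terms with `Θ` are collected on the
  -- left; their total coefficient `v` is a unit.
  have hdvd : X 2 ∣ Θ := by
    set v := 1 - C Complex.I * C (1 / 2) * (Y ^ (1 + n) * Ψ) with hv
    have hvu : IsUnit v := by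
      rw [isUnit_iff_constantCoeff, isUnit_iff_ne_zero, hv]
      simp [hY, hΘ0, pow_add]
    have h1 : Θ * v = X 2 * (1 + C Complex.I * C (1 / 2) * (Y ^ (1 + n) * Ψ)) := by
      rw [hv]
      have e : Y ^ (2 + n) = Y ^ (1 + n) * (C (1 / 2) * (Θ + X 2)) := by
        rw [← hY, ← pow_succ]; congr 1; ring
      rw [e] at heq2
      linear_combination heq2
    exact (hvu.dvd_mul_right (b := Θ)).mp ⟨_, h1⟩
  obtain ⟨θ, hθ⟩ := hdvd
  have hYθ : Y = X 2 * (C (1 / 2) * (θ + 1)) := by rw [hY, hθ]; ring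
  have hθ1 : CongrMod 1 θ 1 := by
    have h1 : X 2 * (θ - 1) = X 2 * (X 2 ^ 1 * (X 2 ^ n * (C Complex.I *
        ((C (1 / 2) * (θ + 1)) ^ (2 + n) * Ψ)))) := by
      have : Θ - X 2 = X 2 * (θ - 1) := by rw [hθ]; ring
      rw [← this, heq2, hYθ, mul_pow]; ring
    exact ⟨_, mul_left_cancel₀ X_two_ne_zero h1⟩
  refine ⟨?_, θ, hθ, hθ1⟩
  have hy1 : CongrMod 1 ((C (1 / 2) * (θ + 1)) ^ (2 + n)) 1 := by
    have h1 := ((hθ1.add (CongrMod.refl 1 1)).mul_left (C (1 / 2))).pow (2 + n)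
    refine h1.trans (CongrMod.of_eq ?_)
    rw [show (1 + 1 : MvPowerSeries (Fin 3) ℂ) = 2 by norm_num, C_half_mul_two, one_pow]
  have hΨ1 : CongrMod 1 Ψ ψ := by
    have h1 := CongrMod.subst (k := 1) (b := X) ha0 (by simp) (fun i => ?_) ψ
    · rw [subst_self, id_eq] at h1; exact h1
    · fin_cases i
      · exact CongrMod.refl _ _
      · exact CongrMod.refl _ _
      · change CongrMod 1 Y (X 2)
        rw [CongrMod, hYθ, pow_one]
        exact ⟨C (1 / 2) * (θ + 1) - 1, by ring⟩
  have h2 := CongrMod.pow_mul (2 + n) ((hy1.mul hΨ1).mul_left (C Complex.I))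
  have h3 := (CongrMod.refl _ (X 2)).add h2
  refine (CongrMod.of_eq ?_).trans (h3.trans (CongrMod.of_eq ?_))
  · have : Θ = X 2 + C Complex.I * (Y ^ (2 + n) * Ψ) := by linear_combination heq2
    rw [this, hYθ, mul_pow]; ring
  · ring

/-- The associated equation, restricted to `w = 0`. -/
theorem associatedODE_congr (hm : 2 ≤ m) (hψ : coeff (exp3 1 0 0) ψ = 0)
    (h : IsComplexDefiningSeries (scaledSeries m ψ) Θ) (hΦ : IsAssociatedODE m Θ Φ) :
    CongrMod 1 (Φ.subst (![X 0, 0, C Complex.I * pderiv ℂ 0 ψ] :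
        Fin 3 → MvPowerSeries (Fin 3) ℂ))
      (C Complex.I * pderiv ℂ 0 (pderiv ℂ 0 ψ)) := by
  obtain ⟨h1, θ, hθ, hθ1⟩ := complexDefiningSeries_congr hm h
  obtain ⟨Z, hZ0, hz, hzz⟩ := hΦ
  have hpow : ∀ x, pderiv ℂ 0 (X 2 ^ m * x : MvPowerSeries (Fin 3) ℂ) = X 2 ^ m * pderiv ℂ 0 x := by
    intro x
    rw [Derivation.leibniz, pderiv_pow, pderiv_X_of_ne (by decide)]
    simp
  have hd1 : CongrMod (m + 1) (pderiv ℂ 0 Θ) (X 2 ^ m * (C Complex.I * pderiv ℂ 0 ψ)) := by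
    refine h1.pderiv_zero.trans (CongrMod.of_eq ?_)
    rw [map_add, pderiv_X_of_ne (by decide), hpow, zero_add, Derivation.leibniz, pderiv_C]
    simp
  have hd2 : CongrMod (m + 1) (pderiv ℂ 0 (pderiv ℂ 0 Θ))
      (X 2 ^ m * (C Complex.I * pderiv ℂ 0 (pderiv ℂ 0 ψ))) := by
    refine hd1.pderiv_zero.trans (CongrMod.of_eq ?_)
    rw [hpow, Derivation.leibniz, pderiv_C]
    simp
  -- Since `Θ = τ θ` with `θ ≡ 1`, dividing by `Θ^m` and by `τ^m` agree to leading order.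
  have hcancel : ∀ x y, CongrMod (m + 1) (Θ ^ m * x) (X 2 ^ m * y) → CongrMod 1 x y := by
    intro x y hxy
    rw [hθ, mul_pow, mul_assoc] at hxy
    have h2 := CongrMod.of_pow_mul hxy
    have h3 := ((hθ1.pow m).mul_right x)
    rw [one_pow, one_mul] at h3
    exact h3.symm.trans h2
  rw [hz] at hd1
  rw [hzz] at hd2
  have hZ := hcancel _ _ hd1
  refine CongrMod.trans ?_ (hcancel _ _ hd2)
  have hψ0 : constantCoeff (pderiv ℂ 0 ψ) = 0 := by
    have := coeff_pderiv_zero ψ 0 0 0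
    rw [exp3_zero_eq, coeff_zero_eq_constantCoeff_apply] at this
    rw [this]
    simp [hψ]
  have hΘ0 : constantCoeff Θ = 0 := h.1
  refine CongrMod.subst ?_ ?_ (fun i => ?_) Φ
  · intro i; fin_cases i <;> simp [hψ0]
  · intro i; fin_cases i <;> simp [hΘ0, hZ0]
  · fin_cases i
    · exact CongrMod.refl _ _
    · change CongrMod 1 0 Θ
      exact (congrMod_zero_iff.mpr ⟨θ, by rw [hθ, pow_one]⟩).symm
    · exact hZ.symm

end AssociatedODE

/-! ### Non-resonance matrices and the homological equation -/

section Nonresonance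

variable {m : ℕ} {ψ Θ Φ : MvPowerSeries (Fin 3) ℂ}

/-- Substitution of one quartic polynomial without constant term into another, in a ring where `x ^
5 = 0`. The multipliers of `hx` collect everything of degree five and more. -/
theorem quartic_subst {R : Type*} [CommRing R] {x p1 p2 p3 p4 f0 f1 f2 f3 f4 : R}
    (hx : x ^ 5 = 0) :
    let Y := x * p1 + x ^ 2 * p2 + x ^ 3 * p3 + x ^ 4 * p4
    f0 + Y * f1 + Y ^ 2 * f2 + Y ^ 3 * f3 + Y ^ 4 * f4 =
      f0 + x * (p1 * f1) + x ^ 2 * (p2 * f1 + p1 ^ 2 * f2) +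
      x ^ 3 * (p3 * f1 + 2 * p1 * p2 * f2 + p1 ^ 3 * f3) +
      x ^ 4 * (p4 * f1 + (p2 ^ 2 + 2 * p1 * p3) * f2 + 3 * p1 ^ 2 * p2 * f3 + p1 ^ 4 * f4) ∧
    Y ^ 5 = 0 := by
  intro Y
  have h2 : Y ^ 2 = x ^ 2 * p1 ^ 2 + 2 * x ^ 3 * p1 * p2 + x ^ 4 * (p2 ^ 2 + 2 * p1 * p3) := by
    simp only [Y]
    linear_combination ((2 * p1 * p4 + 2 * p2 * p3) + x * (p3 ^ 2 + 2 * p2 * p4) +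
      2 * x ^ 2 * p3 * p4 + x ^ 3 * p4 ^ 2) * hx
  have h3 : Y ^ 3 = x ^ 3 * p1 ^ 3 + 3 * x ^ 4 * p1 ^ 2 * p2 := by
    rw [pow_succ, h2]
    simp only [Y]
    linear_combination ((p1 ^ 2 * p3 + 2 * p1 * p2 ^ 2 + (p2 ^ 2 + 2 * p1 * p3) * p1) +
      x * (p1 ^ 2 * p4 + 2 * p1 * p2 * p3 + (p2 ^ 2 + 2 * p1 * p3) * p2) +
      x ^ 2 * (2 * p1 * p2 * p4 + (p2 ^ 2 + 2 * p1 * p3) * p3) +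
      x ^ 3 * (p2 ^ 2 + 2 * p1 * p3) * p4) * hx
  have h4 : Y ^ 4 = x ^ 4 * p1 ^ 4 := by
    rw [pow_succ, h3]
    simp only [Y]
    linear_combination (4 * p1 ^ 3 * p2 + x * (p1 ^ 3 * p3 + 3 * p1 ^ 2 * p2 ^ 2) +
      x ^ 2 * (p1 ^ 3 * p4 + 3 * p1 ^ 2 * p2 * p3) + x ^ 3 * 3 * p1 ^ 2 * p2 * p4) * hx
  refine ⟨?_, ?_⟩
  · rw [h2, h3, h4]
    simp only [Y]
    ring
  · rw [pow_succ, h4]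
    simp only [Y]
    linear_combination (p1 ^ 4 * (p1 + x * p2 + x ^ 2 * p3 + x ^ 3 * p4)) * hx

/-- The coefficients of `χ ^ k` in the restriction of the associated equation to `w = 0`. -/
theorem associatedODE_columns
    (hp0 : column 1 0 (C Complex.I * pderiv ℂ 0 ψ) = 0)
    (hr0 : column 1 0 (C Complex.I * pderiv ℂ 0 (pderiv ℂ 0 ψ)) = 0)
    (hr1 : column 1 1 (C Complex.I * pderiv ℂ 0 (pderiv ℂ 0 ψ)) = 0)
    (h : CongrMod 1 (Φ.subst (![X 0, 0, C Complex.I * pderiv ℂ 0 ψ] :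
        Fin 3 → MvPowerSeries (Fin 3) ℂ))
      (C Complex.I * pderiv ℂ 0 (pderiv ℂ 0 ψ)))
    (hc : constantCoeff (C Complex.I * pderiv ℂ 0 ψ) = 0) :
    let p := fun k => column 1 k (C Complex.I * pderiv ℂ 0 ψ)
    let r := fun k => column 1 k (C Complex.I * pderiv ℂ 0 (pderiv ℂ 0 ψ))
    let φ := fun k => column 2 k Φ
    p 1 * φ 1 = 0 ∧ p 2 * φ 1 + p 1 ^ 2 * φ 2 = r 2 ∧
    p 3 * φ 1 + 2 * p 1 * p 2 * φ 2 + p 1 ^ 3 * φ 3 = r 3 ∧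
    p 4 * φ 1 + (p 2 ^ 2 + 2 * p 1 * p 3) * φ 2 + 3 * p 1 ^ 2 * p 2 * φ 3 + p 1 ^ 4 * φ 4 =
      r 4 := by
  intro p r φ
  have h10 : (1 : Fin 3) ≠ 0 := by decide
  have h20 : (2 : Fin 3) ≠ 0 := by decide
  have h12 : (1 : Fin 3) ≠ 2 := by decide
  obtain ⟨A1, B1, hY⟩ := exists_column_decomposition h10 h20 h12 5 (C Complex.I * pderiv ℂ 0 ψ)
  obtain ⟨A2, B2, hR⟩ := exists_column_decomposition h10 h20 h12 5
    (C Complex.I * pderiv ℂ 0 (pderiv ℂ 0 ψ))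
  obtain ⟨A3, B3, hF⟩ := exists_column_decomposition h20 h10 h12.symm 5 Φ
  set Y := C Complex.I * pderiv ℂ 0 ψ with hYdef
  set R := C Complex.I * pderiv ℂ 0 (pderiv ℂ 0 ψ) with hRdef
  set b : Fin 3 → MvPowerSeries (Fin 3) ℂ := ![X 0, 0, Y] with hb
  have hb0 : ∀ i, constantCoeff (b i) = 0 := by intro i; fin_cases i <;> simp [hb, hc]
  have hs := hasSubst_of_zero hb0
  have hsub : Φ.subst b = zSeries (φ 0) + Y * zSeries (φ 1) + Y ^ 2 * zSeries (φ 2) +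
      Y ^ 3 * zSeries (φ 3) + Y ^ 4 * zSeries (φ 4) + Y ^ 5 * A3.subst b := by
    have e1 : b 1 = 0 := rfl
    have e2 : b 2 = Y := rfl
    have s0 : (0 : MvPowerSeries (Fin 3) ℂ).subst b = 0 := by
      rw [← coe_substAlgHom hs]; exact map_zero _
    conv_lhs => rw [hF]
    simp only [s0, Finset.sum_range_succ, Finset.sum_range_zero, subst_add hs, subst_mul hs,
      subst_pow hs, subst_X hs, zSeries_subst hb0 rfl, e1, e2]
    simp only [φ]
    ring
  obtain ⟨T, hT⟩ := h
  rw [hsub] at hT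
  -- Modulo `χ^5` and `u` both sides are polynomials of degree at most four in `χ` over the series
  -- in `z`, and the substitution becomes a finite computation.
  set I : Ideal (MvPowerSeries (Fin 3) ℂ) := Ideal.span {X 1 ^ 5, X 2} with hI
  set π := Ideal.Quotient.mk I with hπ
  have hx5 : (π (X 1)) ^ 5 = 0 := by
    rw [← map_pow, Ideal.Quotient.eq_zero_iff_mem]
    exact Ideal.subset_span (by simp)
  have hu : π (X 2) = 0 := by
    rw [Ideal.Quotient.eq_zero_iff_mem]
    exact Ideal.subset_span (by simp)
  have hYπ : π Y = π (X 1) * π (zSeries (p 1)) + π (X 1) ^ 2 * π (zSeries (p 2)) +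
      π (X 1) ^ 3 * π (zSeries (p 3)) + π (X 1) ^ 4 * π (zSeries (p 4)) := by
    rw [hY]
    simp only [Finset.sum_range_succ, Finset.sum_range_zero, hp0, map_add, map_mul, map_pow, hx5,
      hu, map_zero, p]
    ring
  have hRπ : π R = π (X 1) ^ 2 * π (zSeries (r 2)) +
      π (X 1) ^ 3 * π (zSeries (r 3)) + π (X 1) ^ 4 * π (zSeries (r 4)) := by
    rw [hR]
    simp only [Finset.sum_range_succ, Finset.sum_range_zero, hr0, hr1, map_add, map_mul, map_pow,
      hx5, hu, map_zero, r]
    ring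
  have hTπ := congrArg π hT
  simp only [map_sub, map_add, map_mul, map_pow, hu] at hTπ
  obtain ⟨q1, q2⟩ := quartic_subst (p1 := π (zSeries (p 1))) (p2 := π (zSeries (p 2)))
    (p3 := π (zSeries (p 3))) (p4 := π (zSeries (p 4))) (f0 := π (zSeries (φ 0)))
    (f1 := π (zSeries (φ 1))) (f2 := π (zSeries (φ 2))) (f3 := π (zSeries (φ 3)))
    (f4 := π (zSeries (φ 4))) hx5
  rw [← hYπ] at q1 q2
  rw [q1, q2, hRπ] at hTπ
  set g : ℕ → PowerSeries ℂ := fun k => match k with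
    | 0 => φ 0
    | 1 => p 1 * φ 1
    | 2 => p 2 * φ 1 + p 1 ^ 2 * φ 2 - r 2
    | 3 => p 3 * φ 1 + 2 * p 1 * p 2 * φ 2 + p 1 ^ 3 * φ 3 - r 3
    | _ => p 4 * φ 1 + (p 2 ^ 2 + 2 * p 1 * p 3) * φ 2 + 3 * p 1 ^ 2 * p 2 * φ 3 +
      p 1 ^ 4 * φ 4 - r 4 with hg
  have hmem : ∑ k ∈ Finset.range 5, X 1 ^ k * zSeries (g k) ∈ I := by
    rw [← Ideal.Quotient.eq_zero_iff_mem, ← hπ]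
    simp only [Finset.sum_range_succ, Finset.sum_range_zero, hg, map_add, map_sub, map_mul, map_pow,
      map_ofNat, map_zero]
    linear_combination hTπ
  obtain ⟨a, b', hab⟩ := Ideal.mem_span_pair.mp hmem
  have hz : ∀ k, k < 5 → g k = 0 := fun k hk =>
    column_eq_zero_of_sum (A := a) (B := b') h10 h20 h12
      (by rw [← hab]; ring) hk
  exact ⟨hz 1 (by norm_num), sub_eq_zero.mp (hz 2 (by norm_num)),
    sub_eq_zero.mp (hz 3 (by norm_num)), sub_eq_zero.mp (hz 4 (by norm_num))⟩

theorem coeff_column_two (k a : ℕ) (T : MvPowerSeries (Fin 3) ℂ) :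
    PowerSeries.coeff a (column 2 k T) = coeff (exp3 a 0 k) T := by
  rw [column, PowerSeries.coeff_mk]
  congr 2
  ext i; fin_cases i <;> simp

theorem coeff_column_one (k a : ℕ) (T : MvPowerSeries (Fin 3) ℂ) :
    PowerSeries.coeff a (column 1 k T) = coeff (exp3 a k 0) T := by
  rw [column, PowerSeries.coeff_mk]
  congr 2
  ext i; fin_cases i <;> simp

/-- The jet of the associated equation in terms of the jet of the hypersurface. -/
theorem associatedODE_jet {ε : ℂ} (hm : 2 ≤ m)
    (hS : IsAdmissibleJet ε fun k l => coeff (exp3 k l 0) ψ)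
    (h : IsComplexDefiningSeries (scaledSeries m ψ) Θ) (hΦ : IsAssociatedODE m Θ Φ) :
    let S := fun k l => coeff (exp3 k l 0) ψ
    let α : ℕ → ℂ := fun j => coeff (exp3 j 0 2) Φ
    let β : ℕ → ℂ := fun j => coeff (exp3 j 0 3) Φ
    let γ : ℕ → ℂ := fun j => coeff (exp3 j 0 4) Φ
    α 0 = -2 * Complex.I * S 2 2 ∧ α 1 = -6 * Complex.I * S 3 2 ∧
    α 2 = -12 * Complex.I * S 4 2 ∧ β 0 = -2 * ε * S 2 3 ∧
    β 1 = -6 * ε * S 3 3 + 8 * S 2 2 ^ 2 ∧ β 2 = -12 * ε * S 4 3 + 36 * S 2 2 * S 3 2 ∧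
    γ 0 = 2 * Complex.I * S 2 4 ∧
    γ 1 = 6 * Complex.I * S 3 4 - 20 * Complex.I * ε * S 2 2 * S 2 3 := by
  intro S α β γ
  have hcg := associatedODE_congr hm (hS.zero 1) h hΦ
  have hε := hS.sq
  have hI := Complex.I_sq
  have cp : ∀ k a, PowerSeries.coeff a (column 1 k (C Complex.I * pderiv ℂ 0 ψ)) =
      Complex.I * ((a + 1) * S (a + 1) k) := by
    intro k a; rw [coeff_column_one, coeff_C_mul, coeff_pderiv_zero]
  have cr : ∀ k a, PowerSeries.coeff a (column 1 k (C Complex.I * pderiv ℂ 0 (pderiv ℂ 0 ψ))) =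
      Complex.I * ((a + 1) * ((a + 2) * S (a + 2) k)) := by
    intro k a; rw [coeff_column_one, coeff_C_mul, coeff_pderiv_zero, coeff_pderiv_zero]
    push_cast; ring
  have hp1 : column 1 1 (C Complex.I * pderiv ℂ 0 ψ) = PowerSeries.C (Complex.I * ε) := by
    ext a
    rw [cp, PowerSeries.coeff_C]
    split_ifs with ha
    · subst ha; simp [S, hS.one_one]
    · rw [show S (a + 1) 1 = 0 from hS.one _ (by omega)]; simp
  have hc : constantCoeff (C Complex.I * pderiv ℂ 0 ψ) = 0 := by
    have h0 := cp 0 0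
    rw [coeff_column_one, exp3_zero_eq, coeff_zero_eq_constantCoeff_apply] at h0
    rw [h0]
    simp [S, hS.zero]
  obtain ⟨e1, e2, e3, e4⟩ := associatedODE_columns
    (by ext a; rw [cp]; simp [S, hS.zero])
    (by ext a; rw [cr]; simp [S, hS.zero])
    (by ext a; rw [cr, show S (a + 2) 1 = 0 from hS.one _ (by omega)]; simp) hcg hc
  dsimp only at e1 e2 e3 e4
  -- The `χ`-column of `i ψ_z` is the nonzero constant `i ε`. The first equation thus forbids a term
  -- linear in `ζ` in `Φ(z, 0, ζ)`, and the remaining equations yield the columns 2, 3, 4 of `Φ` in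
  -- turn.
  have hφ1 : column 2 1 Φ = 0 := by
    have hne : Complex.I * ε ≠ 0 := by
      refine mul_ne_zero Complex.I_ne_zero fun h => ?_
      rw [h] at hε; norm_num at hε
    rw [hp1] at e1
    refine (mul_eq_zero.mp e1).resolve_left ?_
    intro h0
    refine hne ?_
    have := congrArg (PowerSeries.coeff 0) h0
    simpa using this
  simp only [hφ1, hp1, mul_zero, zero_add, ← map_pow] at e2 e3 e4
  have S12 : S 1 2 = 0 := hS.one_left (by norm_num)
  have S13 : S 1 3 = 0 := hS.one_left (by norm_num)
  have E2 : ∀ a, α a = -Complex.I * ((a + 1) * ((a + 2) * S (a + 2) 2)) := by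
    intro a
    have := congrArg (PowerSeries.coeff a) e2
    rw [PowerSeries.coeff_C_mul, cr, coeff_column_two, mul_pow, hI, hε] at this
    linear_combination -this
  have cφ2 : ∀ a, PowerSeries.coeff a (column 2 2 Φ) = α a := fun a => coeff_column_two _ _ _
  have cφ3 : ∀ a, PowerSeries.coeff a (column 2 3 Φ) = β a := fun a => coeff_column_two _ _ _
  have cφ4 : ∀ a, PowerSeries.coeff a (column 2 4 Φ) = γ a := fun a => coeff_column_two _ _ _
  have hC2 : ∀ c : ℂ, PowerSeries.C (2 * c) = 2 * PowerSeries.C c := by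
    intro c; rw [map_mul, map_ofNat]
  have hC3 : ∀ c : ℂ, PowerSeries.C (3 * c) = 3 * PowerSeries.C c := by
    intro c; rw [map_mul, map_ofNat]
  set P2 := column 1 2 (C Complex.I * pderiv ℂ 0 ψ) with hP2
  set P3 := column 1 3 (C Complex.I * pderiv ℂ 0 ψ) with hP3
  set φ2 := column 2 2 Φ with hφ2
  set φ3 := column 2 3 Φ with hφ3
  have A0 : α 0 = -2 * Complex.I * S 2 2 := by rw [E2]; push_cast; ring
  have A1 : α 1 = -6 * Complex.I * S 3 2 := by rw [E2]; push_cast; ring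
  have A2 : α 2 = -12 * Complex.I * S 4 2 := by rw [E2]; push_cast; ring
  have cP2φ : ∀ a, PowerSeries.coeff a (P2 * φ2) = ∑ x ∈ Finset.HasAntidiagonal.antidiagonal a,
      (Complex.I * (((x.1 : ℂ) + 1) * S (x.1 + 1) 2)) * α x.2 := by
    intro a; rw [PowerSeries.coeff_mul]; simp only [hP2, cp, cφ2]
  have E3 : ∀ a, β a = 2 * PowerSeries.coeff a (P2 * φ2) -
      ε * ((a + 1) * ((a + 2) * S (a + 2) 3)) := by
    intro a
    have h1 : (2 : PowerSeries ℂ) * PowerSeries.C (Complex.I * ε) * P2 * φ2 =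
        PowerSeries.C (2 * (Complex.I * ε)) * (P2 * φ2) := by
      rw [hC2]; ring
    rw [h1] at e3
    have h2 := congrArg (PowerSeries.coeff a) e3
    rw [map_add, PowerSeries.coeff_C_mul, PowerSeries.coeff_C_mul, cr, cφ3] at h2
    set c := PowerSeries.coeff a (P2 * φ2)
    have h3 : (Complex.I * ε) ^ 3 = -(Complex.I * ε) := by
      rw [pow_succ, mul_pow, hI, hε]; ring
    rw [h3] at h2
    linear_combination (Complex.I * ε) * h2 + (-2 * ε ^ 2 * c + ε ^ 2 * β a +
      ε * ((a + 1) * ((a + 2) * S (a + 2) 3))) * hI + (2 * c - β a) * hε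
  have B0 : β 0 = -2 * ε * S 2 3 := by
    rw [E3, cP2φ]; simp [S12]; ring
  have B1 : β 1 = -6 * ε * S 3 3 + 8 * S 2 2 ^ 2 := by
    rw [E3, cP2φ]; simp [Finset.Nat.antidiagonal_succ, S12, A0]
    linear_combination (-8 * S 2 2 ^ 2) * hI
  have B2 : β 2 = -12 * ε * S 4 3 + 36 * S 2 2 * S 3 2 := by
    rw [E3, cP2φ]; simp [Finset.Nat.antidiagonal_succ, S12, A0, A1]
    linear_combination (-36 * S 2 2 * S 3 2) * hI
  have E4 : ∀ a, γ a = Complex.I * ((a + 1) * ((a + 2) * S (a + 2) 4)) -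
      PowerSeries.coeff a (P2 * (P2 * φ2)) - 2 * (Complex.I * ε) * PowerSeries.coeff a (P3 * φ2) +
      3 * PowerSeries.coeff a (P2 * φ3) := by
    intro a
    have h1 : (P2 ^ 2 + 2 * PowerSeries.C (Complex.I * ε) * P3) * φ2 +
        3 * PowerSeries.C ((Complex.I * ε) ^ 2) * P2 * φ3 =
        P2 * (P2 * φ2) + PowerSeries.C (2 * (Complex.I * ε)) * (P3 * φ2) +
        PowerSeries.C (3 * (Complex.I * ε) ^ 2) * (P2 * φ3) := by
      rw [hC2, hC3]; ring
    rw [h1] at e4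
    have h2 := congrArg (PowerSeries.coeff a) e4
    simp only [map_add, PowerSeries.coeff_C_mul, cr, cφ4] at h2
    have h3 : (Complex.I * ε) ^ 2 = -1 := by rw [mul_pow, hI, hε]; ring
    have h4 : (Complex.I * ε) ^ 4 = 1 := by
      rw [show (Complex.I * ε) ^ 4 = ((Complex.I * ε) ^ 2) ^ 2 by ring, h3]; norm_num
    rw [h3, h4] at h2
    linear_combination h2
  have cP3φ : ∀ a, PowerSeries.coeff a (P3 * φ2) = ∑ x ∈ Finset.HasAntidiagonal.antidiagonal a,
      (Complex.I * (((x.1 : ℂ) + 1) * S (x.1 + 1) 3)) * α x.2 := by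
    intro a; rw [PowerSeries.coeff_mul]; simp only [hP3, cp, cφ2]
  have cP2φ3 : ∀ a, PowerSeries.coeff a (P2 * φ3) = ∑ x ∈ Finset.HasAntidiagonal.antidiagonal a,
      (Complex.I * (((x.1 : ℂ) + 1) * S (x.1 + 1) 2)) * β x.2 := by
    intro a; rw [PowerSeries.coeff_mul]; simp only [hP2, cp, cφ3]
  have cP22 : ∀ a, PowerSeries.coeff a (P2 * (P2 * φ2)) =
      ∑ x ∈ Finset.HasAntidiagonal.antidiagonal a,
      (Complex.I * (((x.1 : ℂ) + 1) * S (x.1 + 1) 2)) * PowerSeries.coeff x.2 (P2 * φ2) := by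
    intro a; rw [PowerSeries.coeff_mul]; simp only [hP2, cp]
  refine ⟨A0, A1, A2, B0, B1, B2, ?_, ?_⟩
  · rw [E4, cP22, cP3φ, cP2φ3]; simp [S12, S13]; ring
  · rw [E4, cP22, cP3φ, cP2φ3]
    simp [Finset.Nat.antidiagonal_succ, S12, S13, A0, B0, cP2φ]
    linear_combination (8 * Complex.I * ε * S 2 2 * S 2 3) * hI

/-- Non-resonance of the associated equation means unique solvability of the homological
equation. -/
theorem IsNonresonantODE.isNonresonantJet {ε : ℂ} (hm : 2 ≤ m)
    (hS : IsAdmissibleJet ε fun k l => coeff (exp3 k l 0) ψ)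
    (h : IsComplexDefiningSeries (scaledSeries m ψ) Θ) (hΦ : IsAssociatedODE m Θ Φ)
    (hN : IsNonresonantODE Φ) : IsNonresonantJet ε fun k l => coeff (exp3 k l 0) ψ := by
  obtain ⟨A0, A1, A2, B0, B1, B2, G0, G1⟩ := associatedODE_jet hm hS h hΦ
  obtain ⟨h4, h3⟩ := hN
  rw [A0, A1, A2, B0, B1, B2, G0, G1] at h4
  rw [A1, A2, B0, B1, G0] at h3
  have hε := hS.sq
  have hε0 : ε ≠ 0 := fun h => by rw [h] at hε; norm_num at hε
  have hI := Complex.I_sq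
  set S : ℕ → ℕ → ℂ := fun k l => coeff (exp3 k l 0) ψ with hSdef
  set M4 := !![-2 * Complex.I * S 2 2, 3 * (-2 * ε * S 2 3), -6 * Complex.I * S 3 2, 0;
    -6 * Complex.I * S 3 2, 3 * (-6 * ε * S 3 3 + 8 * S 2 2 ^ 2), 2 * (-12 * Complex.I * S 4 2),
      -6 * Complex.I * S 3 2;
    2 * (-2 * ε * S 2 3), 4 * (2 * Complex.I * S 2 4), -6 * ε * S 3 3 + 8 * S 2 2 ^ 2,
      -(-2 * ε * S 2 3);
    2 * (-6 * ε * S 3 3 + 8 * S 2 2 ^ 2), 2 * (-2 * ε * S 2 3) * (-2 * Complex.I * S 2 2) +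
      4 * (6 * Complex.I * S 3 4 - 20 * Complex.I * ε * S 2 2 * S 2 3),
      2 * (-12 * ε * S 4 3 + 36 * S 2 2 * S 3 2), 0] with hM4
  set M3 := !![3 * (-2 * ε * S 2 3), -6 * Complex.I * S 3 2, 0;
    3 * (-6 * ε * S 3 3 + 8 * S 2 2 ^ 2), 2 * (-12 * Complex.I * S 4 2), -6 * Complex.I * S 3 2;
    4 * (2 * Complex.I * S 2 4), -6 * ε * S 3 3 + 8 * S 2 2 ^ 2, -(-2 * ε * S 2 3)] with hM3
  -- In the unknowns `(κ, i ε a', a, i θ + κ / 2)` the non-resonance matrix yields the four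
  -- equations, up to nonzero factors (where used, `ε ≠ 0`) and a multiple of the (2,2) equation
  -- added to the (3,3) equation.
  have act4 : ∀ κ a a' θ : ℂ, M4.mulVec ![κ, Complex.I * ε * a', a, Complex.I * θ + κ / 2] =
      ![-2 * Complex.I * system22 S κ a a', -6 * Complex.I * system32 ε S κ a a' θ,
        -2 * ε * system23 ε S κ a a' θ,
        -6 * ε * system33 ε S κ a a' + 16 * S 2 2 * system22 S κ a a'] := by
    intro κ a a' θ
    ext i
    fin_cases i <;>
      simp [hM4, Matrix.mulVec, dotProduct, Fin.sum_univ_four, system22, system23, system32,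
        system33]
    · linear_combination (-6 * Complex.I * S 2 3 * a') * hε
    · linear_combination (-18 * Complex.I * S 3 3 * a') * hε
    · linear_combination (8 * ε * S 2 4 * a') * hI - (8 * S 2 2 ^ 2 * a) * hε
    · linear_combination (24 * ε * S 3 4 * a' - 72 * ε ^ 2 * S 2 2 * S 2 3 * a') * hI +
        (48 * S 2 2 * S 2 3 * a' - 24 * S 2 2 * S 3 2 * a) * hε
  have act3 : ∀ a a' θ : ℂ, M3.mulVec ![Complex.I * ε * a', a, Complex.I * θ] =
      ![-2 * Complex.I * system22 S 0 a a', -6 * Complex.I * system32 ε S 0 a a' θ,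
        -2 * ε * system23 ε S 0 a a' θ] := by
    intro a a' θ
    ext i
    fin_cases i <;>
      simp [hM3, Matrix.mulVec, dotProduct, Fin.sum_univ_three, system22, system23, system32]
    · linear_combination (-6 * Complex.I * S 2 3 * a') * hε
    · linear_combination (-18 * Complex.I * S 3 3 * a') * hε
    · linear_combination (8 * ε * S 2 4 * a') * hI - (8 * S 2 2 ^ 2 * a) * hε
  have hII : Complex.I ≠ 0 := Complex.I_ne_zero
  have i4 := Matrix.mulVec_injective_iff_isUnit.mpr h4
  have s4 := Matrix.mulVec_surjective_iff_isUnit.mpr h4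
  have i3 := Matrix.mulVec_injective_iff_isUnit.mpr h3
  have s3 := Matrix.mulVec_surjective_iff_isUnit.mpr h3
  refine ⟨?_, ?_, ?_, ?_⟩
  · intro κ a a' θ e22 e23 e32 e33
    have h0 := act4 κ a a' θ
    rw [e22, e23, e32, e33] at h0
    have h1 := i4 (h0.trans (by ext i; fin_cases i <;> simp) : _ = M4.mulVec 0)
    have v0 := congrFun h1 0
    have v1 := congrFun h1 1
    have v2 := congrFun h1 2
    have v3 := congrFun h1 3
    simp at v0 v1 v2 v3
    subst v0
    simp [hε0] at v1 v3
    exact ⟨rfl, v2, v1, v3⟩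
  · intro y22 y23 y32 y33
    obtain ⟨v, hv⟩ := s4 ![-2 * Complex.I * y22, -6 * Complex.I * y32, -2 * ε * y23,
      -6 * ε * y33 + 16 * S 2 2 * y22]
    -- The change of unknowns is undone: `a'`, `a`, `θ` are read off from an arbitrary vector `v`.
    have hv' : v = ![v 0, Complex.I * ε * (-Complex.I * ε * v 1), v 2,
        Complex.I * (-Complex.I * (v 3 - v 0 / 2)) + v 0 / 2] := by
      ext i
      fin_cases i <;> simp
      · linear_combination (ε ^ 2 * v 1) * hI - v 1 * hε
      · linear_combination (v 3 - v 0 / 2) * hI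
    rw [hv', act4] at hv
    have v0 := congrFun hv 0
    have v1 := congrFun hv 1
    have v2 := congrFun hv 2
    have v3 := congrFun hv 3
    simp only [Matrix.cons_val] at v0 v1 v2 v3
    have w0 := mul_left_cancel₀ (by simp) v0
    rw [w0] at v3
    exact ⟨_, _, _, _, w0, mul_left_cancel₀ (by simp [hε0]) v2, mul_left_cancel₀ (by simp) v1,
      mul_left_cancel₀ (by simp [hε0]) (add_right_cancel v3)⟩
  · intro a a' θ e22 e23 e32
    have h0 := act3 a a' θ
    rw [e22, e23, e32] at h0
    have h1 := i3 (h0.trans (by ext i; fin_cases i <;> simp) : _ = M3.mulVec 0)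
    have v0 := congrFun h1 0
    have v1 := congrFun h1 1
    have v2 := congrFun h1 2
    simp [hε0] at v0 v1 v2
    exact ⟨v1, v0, v2⟩
  · intro y22 y23 y32
    obtain ⟨v, hv⟩ := s3 ![-2 * Complex.I * y22, -6 * Complex.I * y32, -2 * ε * y23]
    have hv' : v = ![Complex.I * ε * (-Complex.I * ε * v 0), v 1,
        Complex.I * (-Complex.I * v 2)] := by
      ext i
      fin_cases i <;> simp
      · linear_combination (ε ^ 2 * v 0) * hI - v 0 * hε
      · linear_combination v 2 * hI
    rw [hv', act3] at hv
    have v0 := congrFun hv 0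
    have v1 := congrFun hv 1
    have v2 := congrFun hv 2
    simp only [Matrix.cons_val] at v0 v1 v2
    exact ⟨_, _, _, mul_left_cancel₀ (by simp) v0, mul_left_cancel₀ (by simp [hε0]) v2,
      mul_left_cancel₀ (by simp) v1⟩

end Nonresonance

/-! ### Existence of a normalization tangent to the identity -/

section Existence

variable {m : ℕ} {ψ : MvPowerSeries (Fin 3) ℂ}

theorem exists_seq_of_step {α : Type*} {p : ℕ → α → Prop} {r : ℕ → α → α → Prop} {a : α}
    (ha : p 0 a) (step : ∀ n x, p n x → ∃ y, p (n + 1) y ∧ r n x y) :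
    ∃ s : ℕ → α, ∀ n, p n (s n) ∧ r n (s n) (s (n + 1)) := by
  choose! g hg using step
  let s : ℕ → α := fun n => Nat.rec a (fun n x => g n x) n
  have hs : ∀ n, p n (s n) := by
    intro n
    induction n with
    | zero => exact ha
    | succ n ih => exact (hg n _ ih).1
  exact ⟨s, fun n => ⟨hs n, (hg n _ (hs n)).2⟩⟩

/-- The point and the series vary at once. That `u` divides the third coordinate is what keeps a
factor `u ^ n` of `φ - φ'` after substitution. -/
theorem CongrMod.subst_of_congr {n : ℕ} {a b : Fin 3 → MvPowerSeries (Fin 3) ℂ}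
    (ha : ∀ i, constantCoeff (a i) = 0) (hb : ∀ i, constantCoeff (b i) = 0)
    (h : ∀ i, CongrMod n (a i) (b i)) (ha2 : X 2 ∣ a 2) {φ φ' : MvPowerSeries (Fin 3) ℂ}
    (hφ : CongrMod n φ φ') : CongrMod n (φ.subst a) (φ'.subst b) := by
  refine CongrMod.trans ?_ (CongrMod.subst ha hb h φ')
  obtain ⟨T, hT⟩ := hφ
  have hs := hasSubst_of_zero ha
  rw [CongrMod, ← subst_sub hs, hT, subst_mul hs, subst_pow hs, subst_X hs]
  exact (pow_dvd_pow_of_dvd ha2 n).mul_right _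

theorem IsTangentToIdentity.dvd_imagePoint_two (hm : 2 ≤ m) (ψ : MvPowerSeries (Fin 3) ℂ)
    {K : FormalMap} (hK : IsTangentToIdentity K) : X 2 ∣ imagePoint (scaledSeries m ψ) K 2 := by
  have h := hK.imagePoint_congr hm ψ 2
  rw [CongrMod, pow_one] at h
  exact (dvd_sub_self_right).mp h

/-- Continuity of the basic equation in the adic topology, by which the limit of approximate
normalizations is an exact one. -/
theorem basicEquation_congr (hm : 2 ≤ m) {K K' : FormalMap} (hK : IsTangentToIdentity K)
    (hK' : IsTangentToIdentity K') {n : ℕ} (h : ∀ i, X 1 ^ n ∣ K i - K' i)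
    {φ φ' : MvPowerSeries (Fin 3) ℂ} (hφ : CongrMod n φ φ') :
    CongrMod n (basicEquation (scaledSeries m ψ) K (scaledSeries m φ))
      (basicEquation (scaledSeries m ψ) K' (scaledSeries m φ')) := by
  have hf := constantCoeff_scaledSeries hm ψ
  have h1 := fun i => hol_congr hm ψ (h i)
  have h2 := fun i => antihol_congr hm ψ (h i)
  refine CongrMod.sub (((h1 1).sub (h2 1)).mul_left _)
    (CongrMod.subst_of_congr (imagePoint_zero hf hK.constantCoeff)
      (imagePoint_zero hf hK'.constantCoeff) (fun i => ?_) (hK.dvd_imagePoint_two hm ψ)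
      (hφ.mul_left _))
  fin_cases i
  · exact h1 0
  · exact h2 0
  · exact ((h1 1).add (h2 1)).mul_left _

/-- An approximate normalization, up to terms of order `m + j` in `u`. -/
structure IsApproximateNormalization (m : ℕ) (ψ : MvPowerSeries (Fin 3) ℂ) (j : ℕ)
    (K : FormalMap) (φ : MvPowerSeries (Fin 3) ℂ) : Prop where
  tangent : IsTangentToIdentity K
  real : conjSwap φ = φ
  congr : CongrMod 1 φ ψ
  normal : ∀ k l i, 1 ≤ i → MustVanish m i k l → coeff (exp3 k l i) φ = 0
  dvd : X 2 ^ (m + j) ∣ basicEquation (scaledSeries m ψ) K (scaledSeries m φ)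

/-- The series with prescribed coefficients of `z ^ k χ ^ l`. -/
def ofCoeffs (r : ℕ → ℕ → ℂ) : MvPowerSeries (Fin 3) ℂ :=
  fun e => if e 2 = 0 then r (e 0) (e 1) else 0

theorem coeff_ofCoeffs (r : ℕ → ℕ → ℂ) (k l j : ℕ) :
    coeff (exp3 k l j) (ofCoeffs r) = if j = 0 then r k l else 0 := by
  change (if (exp3 k l j) 2 = 0 then r (exp3 k l j 0) (exp3 k l j 1) else 0) = _
  exact if_congr (by rw [exp3_two]) (by rw [exp3_zero, exp3_one]) rfl

theorem conjSwap_ofCoeffs {r : ℕ → ℕ → ℂ} (hr : ∀ k l, r l k = conj (r k l)) :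
    conjSwap (ofCoeffs r) = ofCoeffs r := by
  refine ext_exp3 fun k l j => ?_
  rw [coeff_conjSwap, coeff_ofCoeffs, coeff_ofCoeffs]
  split_ifs
  · rw [hr l k]
  · simp

/-- The series with prescribed coefficients of `z ^ k`. -/
def ofCoeffs₁ (r : ℕ → ℂ) : MvPowerSeries (Fin 2) ℂ :=
  fun e => if e 1 = 0 then r (e 0) else 0

theorem coeff_ofCoeffs₁ (r : ℕ → ℂ) (k j : ℕ) :
    coeff (exp2 k j) (ofCoeffs₁ r) = if j = 0 then r k else 0 := by
  change (if (exp2 k j) 1 = 0 then r (exp2 k j 0) else 0) = _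
  exact if_congr (by rw [exp2_one]) (by rw [exp2_zero]) rfl

theorem coeff_X_two_pow_mul (i k l j : ℕ) (T : MvPowerSeries (Fin 3) ℂ) :
    coeff (exp3 k l j) (X 2 ^ i * T) = if i ≤ j then coeff (exp3 k l (j - i)) T else 0 := by
  classical
  rw [X_pow_eq, coeff_monomial_mul, one_mul]
  have h : exp3 k l j - Finsupp.single 2 i = exp3 k l (j - i) := by
    ext s
    fin_cases s <;> simp
  simp only [Finsupp.single_le_iff, exp3_two, h]

theorem isTangentToIdentity_X : IsTangentToIdentity X := ⟨by simp, by simp⟩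

theorem imagePoint_X {f : MvPowerSeries (Fin 3) ℂ} (hf : constantCoeff f = 0) :
    imagePoint f X = X := by
  funext i
  fin_cases i
  · exact hol_X_zero hf
  · exact antihol_X_zero hf
  · change C (1 / 2) * (hol f (X 1) + antihol f (X 1)) = X 2
    rw [hol_X_one hf, antihol_X_one hf]
    linear_combination X 2 * C_half_mul_two (σ := Fin 3)

theorem basicEquation_X {f : MvPowerSeries (Fin 3) ℂ} (hf : constantCoeff f = 0)
    (g : MvPowerSeries (Fin 3) ℂ) : basicEquation f X g = f - g := by
  rw [basicEquation, imagePoint_X hf, subst_self, id_eq, hol_X_one hf, antihol_X_one hf]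
  linear_combination f * C_inv_two_I_mul (σ := Fin 3)

/-- The start is the identity map with target `ψ(z, χ, 0)`: this target has no coefficients with
positive powers of `u`, and it differs from `ψ` by a multiple of `u`, which `u^m` turns into
`u^(m+1)`. -/
theorem exists_approximateNormalization_one (hm : 2 ≤ m) (hψ : conjSwap ψ = ψ) :
    ∃ x : FormalMap × MvPowerSeries (Fin 3) ℂ, IsApproximateNormalization m ψ 1 x.1 x.2 := by
  set S : ℕ → ℕ → ℂ := fun k l => coeff (exp3 k l 0) ψ with hS
  have hcongr : CongrMod 1 (ofCoeffs S) ψ := by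
    rw [congrMod_iff]
    intro a b c hc
    obtain rfl : c = 0 := by omega
    rw [coeff_ofCoeffs, if_pos rfl]
  refine ⟨(X, ofCoeffs S), isTangentToIdentity_X, conjSwap_ofCoeffs fun k l => ?_, hcongr,
    fun k l i hi _ => by rw [coeff_ofCoeffs, if_neg (by omega)], ?_⟩
  · simp only [hS]
    conv_lhs => rw [← hψ, coeff_conjSwap]
  · rw [basicEquation_X (constantCoeff_scaledSeries hm ψ)]
    have h1 := (CongrMod.pow_mul m (hcongr.symm.mul_left (C (1 / 2))))
    rw [CongrMod, ← mul_assoc, ← mul_assoc, mul_comm (X 2 ^ m)] at h1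
    exact h1

/-- The homological equation, with the leading error as right-hand side, provides the correction of
the map. Whatever it leaves over sits at indices that the normal form leaves free and is absorbed by
the target. -/
theorem IsApproximateNormalization.exists_succ {ε : ℂ} (hm : 2 ≤ m) (hψ : conjSwap ψ = ψ)
    (hS : IsAdmissibleJet ε fun k l => coeff (exp3 k l 0) ψ)
    (hN : IsNonresonantJet ε fun k l => coeff (exp3 k l 0) ψ) {j : ℕ} (hj : 1 ≤ j) {K : FormalMap}
    {φ : MvPowerSeries (Fin 3) ℂ} (h : IsApproximateNormalization m ψ j K φ) :
    ∃ y : FormalMap × MvPowerSeries (Fin 3) ℂ, IsApproximateNormalization m ψ (j + 1) y.1 y.2 ∧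
      (∀ i, X 1 ^ j ∣ y.1 i - K i) ∧ X 2 ^ j ∣ y.2 - φ := by
  have hf := constantCoeff_scaledSeries hm ψ
  obtain ⟨R, hR⟩ := h.dvd
  have hRr : conjSwap R = R := by
    have h1 := conjSwap_basicEquation hf (conjSwap_scaledSeries hψ) h.tangent.constantCoeff
      (conjSwap_scaledSeries (m := m) h.real)
    rw [hR, map_mul, map_pow, conjSwap_X_two] at h1
    exact mul_left_cancel₀ (pow_ne_zero _ X_two_ne_zero) h1
  set S : ℕ → ℕ → ℂ := fun k l => coeff (exp3 k l 0) ψ with hSdef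
  -- The factor `-2` compensates the `½` in front of the linearized equation.
  set r : ℕ → ℕ → ℂ := fun k l => -2 * coeff (exp3 k l 0) R with hrdef
  have hr : ∀ k l, r l k = conj (r k l) := by
    intro k l
    simp only [hrdef, map_mul, map_neg, map_ofNat]
    conv_lhs => rw [← hRr, coeff_conjSwap]
  obtain ⟨κ, f, q, hκ, hκm, hsolve⟩ := homological_surjective hS hN m j hr
  -- At the resonant order `κ` is zero whatever `b` is; the value `0` is an arbitrary choice of the
  -- free parameter.
  set b : ℂ := if j + 1 = m then 0 else κ / ((j : ℂ) + 1 - m) with hb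
  have hbκ : ((j : ℂ) + 1 - m) * b = κ := by
    rw [hb]
    split_ifs with hjm
    · rw [hκm hjm, mul_zero]
    · refine mul_div_cancel₀ _ (fun h0 => hjm ?_)
      have : ((j + 1 : ℕ) : ℂ) = (m : ℂ) := by push_cast; linear_combination h0
      exact_mod_cast this
  have hbr : conj b = b := by
    rw [hb]
    split_ifs
    · simp
    · simp [hκ]
  -- At the indices that must vanish this is zero, because there the homological equation is solved
  -- exactly.
  set η := ofCoeffs fun k l => linearizedCoeff S κ f q k l - r k l with hη
  have hηr : conjSwap η = η := conjSwap_ofCoeffs fun k l => by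
    rw [linearizedCoeff_symm hS hκ k l, hr k l, map_sub]
  set K' : FormalMap := ![K 0 + X 1 ^ j * ofCoeffs₁ f,
    K 1 + (X 1 ^ (j + 1) * C b + X 1 ^ (m + j) * ofCoeffs₁ q)] with hK'
  have h0 : K' 0 = K 0 + X 1 ^ j * ofCoeffs₁ f := rfl
  have h1 : K' 1 = K 1 + (X 1 ^ (j + 1) * C b + X 1 ^ (m + j) * ofCoeffs₁ q) := rfl
  have hd : X 1 ^ (j + 1) ∣ K' 1 - K 1 := by
    rw [h1, add_sub_cancel_left]
    exact dvd_add (dvd_mul_right _ _) ((pow_dvd_pow _ (by omega)).mul_right _)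
  have hd0 : X 1 ^ j ∣ K' 0 - K 0 := by
    rw [h0, add_sub_cancel_left]; exact dvd_mul_right _ _
  have hT : IsTangentToIdentity K' := by
    refine ⟨?_, ?_⟩
    · have := dvd_add ((dvd_pow_self (X 1) (by omega)).trans hd0) h.tangent.zero
      simpa using this
    · have := dvd_add ((pow_dvd_pow (X 1) (by omega)).trans hd) h.tangent.one
      simpa using this
  have key := basicEquation_sub_congr (φ' := φ + X 2 ^ j * η) (p := C b) hm hj h.tangent hT
    h.congr h0 h1 rfl (subst_C b) (by simp [conjSeries, hbr]) (by simp) hbr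
  refine ⟨(K', φ + X 2 ^ j * η), ⟨hT, ?_, ?_, ?_, ?_⟩, ?_, ?_⟩
  · rw [map_add, map_mul, map_pow, conjSwap_X_two, h.real, hηr]
  · have h2 := h.congr.add (congrMod_X_pow_mul hj η)
    rwa [add_zero] at h2
  · intro k l i hi hv
    rw [map_add, h.normal k l i hi hv, coeff_X_two_pow_mul, zero_add]
    split_ifs with hij
    · rw [hη, coeff_ofCoeffs]
      split_ifs with hij'
      · obtain rfl : i = j := by omega
        rw [hsolve k l hv, sub_self]
      · rfl
    · rfl
  · have hΛ : CongrMod 1 (C (1 / 2) * linearizedEquation m j ψ (ofCoeffs₁ f) (ofCoeffs₁ q) b η)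
        (-R) := by
      rw [congrMod_iff]
      intro k l c hc
      obtain rfl : c = 0 := by omega
      rw [coeff_C_mul, coeff_linearizedEquation hm hψ, hbκ, hη, coeff_ofCoeffs, if_pos rfl, map_neg]
      simp only [coeff_ofCoeffs₁, if_true, hrdef]
      ring
    have h2 := key.trans (CongrMod.pow_mul (m + j) hΛ)
    have h3 := h2.add (CongrMod.of_eq (k := m + j + 1) hR)
    rw [sub_add_cancel, mul_neg, neg_add_cancel] at h3
    exact congrMod_zero_iff.mp h3
  · intro i
    fin_cases i
    · exact hd0
    · exact (pow_dvd_pow (X 1) (by omega)).trans hd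
  · simp

/-- The existence of a formal normalization which is tangent to the identity. -/
theorem exists_normalization {ε : ℂ} (hm : 2 ≤ m) (hψ : conjSwap ψ = ψ)
    (hS : IsAdmissibleJet ε fun k l => coeff (exp3 k l 0) ψ)
    (hN : IsNonresonantJet ε fun k l => coeff (exp3 k l 0) ψ) :
    ∃ (K : FormalMap) (φ : MvPowerSeries (Fin 3) ℂ), IsTangentToIdentity K ∧ conjSwap φ = φ ∧
      CongrMod 1 φ ψ ∧ (∀ k l i, 1 ≤ i → MustVanish m i k l → coeff (exp3 k l i) φ = 0) ∧
      basicEquation (scaledSeries m ψ) K (scaledSeries m φ) = 0 := by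
  obtain ⟨x, hx⟩ := exists_approximateNormalization_one hm hψ
  -- The sequence is shifted by one: its term of index `n` is correct modulo `u^(m+n+1)`.
  obtain ⟨s, hs⟩ := exists_seq_of_step
    (p := fun n (x : FormalMap × MvPowerSeries (Fin 3) ℂ) =>
      IsApproximateNormalization m ψ (n + 1) x.1 x.2)
    (r := fun n x y => (∀ i, X 1 ^ (n + 1) ∣ y.1 i - x.1 i) ∧ X 2 ^ (n + 1) ∣ y.2 - x.2)
    hx fun n x hx => hx.exists_succ hm hψ hS hN (by omega)
  choose K hK using fun i => exists_limit 1 (fun n => (s n).1 i)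
    fun n => (pow_dvd_pow _ (by omega)).trans ((hs n).2.1 i)
  obtain ⟨φ, hφ⟩ := exists_limit 2 (fun n => (s n).2)
    fun n => (pow_dvd_pow _ (by omega)).trans (hs n).2.2
  have hT : IsTangentToIdentity K := by
    refine ⟨?_, ?_⟩
    · have := dvd_add (hK 0 1) (by rw [pow_one]; exact (hs 1).1.tangent.zero :
        (X 1 : MvPowerSeries (Fin 2) ℂ) ^ 1 ∣ (s 1).1 0 - X 0)
      rwa [sub_add_sub_cancel, pow_one] at this
    · have := dvd_add (hK 1 2) (hs 2).1.tangent.one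
      rwa [sub_add_sub_cancel] at this
  have hφn : ∀ n, CongrMod n φ (s n).2 := hφ
  refine ⟨K, φ, hT, ?_, (hφn 1).trans (hs 1).1.congr, ?_, ?_⟩
  · refine ext_exp3 fun k l j => ?_
    rw [coeff_conjSwap, (hφn (j + 1)).coeff_eq (Nat.lt_succ_self j),
      (hφn (j + 1)).coeff_eq (Nat.lt_succ_self j), ← coeff_conjSwap, (hs (j + 1)).1.real]
  · intro k l i hi hv
    rw [(hφn (i + 1)).coeff_eq (Nat.lt_succ_self i), (hs (i + 1)).1.normal k l i hi hv]
  · refine eq_zero_of_forall_dvd 2 fun n => ?_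
    have h1 := basicEquation_congr (ψ := ψ) hm hT (hs n).1.tangent (fun i => hK i n) (hφn n)
    exact congrMod_zero_iff.mp
      (h1.trans (congrMod_zero_iff.mpr ((pow_dvd_pow _ (by omega)).trans (hs n).1.dvd)))

end Existence

/-! ### Dilations of the target -/

section Rescaling

variable {m : ℕ} {f φ : MvPowerSeries (Fin 3) ℂ}

/-- Rescaling the target of a formal map. -/
theorem basicEquation_rescale (hf : constantCoeff f = 0) {K : FormalMap}
    (hK : ∀ i, constantCoeff (K i) = 0) {l c : ℂ} (hl : l ≠ 0) (hc : c ≠ 0) (hcr : conj c = c)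
    (hm : 2 ≤ m) :
    basicEquation f ![C l⁻¹ * K 0, C c⁻¹ * K 1]
      (scaledSeries m (C (c ^ (m - 1)) * rescale ![l, conj l, c] φ)) =
      C c⁻¹ * basicEquation f K (scaledSeries m φ) := by
  set K' : FormalMap := ![C l⁻¹ * K 0, C c⁻¹ * K 1] with hK'
  have hK'0 : ∀ i, constantCoeff (K' i) = 0 := by intro i; fin_cases i <;> simp [hK', hK]
  have e0 : hol f (K' 0) = C l⁻¹ * hol f (K 0) := by
    rw [← hol_C (f := f), ← hol_mul hf]; rfl
  have e0' : antihol f (K' 0) = C (conj l)⁻¹ * antihol f (K 0) := by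
    rw [← map_inv₀, ← antihol_C (f := f), ← antihol_mul hf]; rfl
  have e1 : hol f (K' 1) = C c⁻¹ * hol f (K 1) := by
    rw [← hol_C (f := f), ← hol_mul hf]; rfl
  have e1' : antihol f (K' 1) = C c⁻¹ * antihol f (K 1) := by
    have : (C c⁻¹ : MvPowerSeries (Fin 3) ℂ) = antihol f (C c⁻¹) := by
      rw [antihol_C, show conj c⁻¹ = c⁻¹ by rw [map_inv₀, hcr]]
    rw [this, ← antihol_mul hf]; rfl
  have e2 : imagePoint f K' 2 = C c⁻¹ * imagePoint f K 2 := by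
    change C (1 / 2) * (hol f (K' 1) + antihol f (K' 1)) =
      C c⁻¹ * (C (1 / 2) * (hol f (K 1) + antihol f (K 1)))
    rw [e1, e1']; ring
  have hsub : (rescale ![l, conj l, c] φ).subst (imagePoint f K') = φ.subst (imagePoint f K) := by
    rw [rescale_eq_subst, subst_comp_subst_apply (HasSubst.smul_X _)
      (hasSubst_of_zero (imagePoint_zero hf hK'0))]
    congr 1
    funext i
    have hs := hasSubst_of_zero (imagePoint_zero hf hK'0)
    simp only [Pi.smul_apply', smul_eq_C_mul]
    rw [subst_mul hs, subst_C, subst_X hs]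
    fin_cases i
    · change C l * hol f (K' 0) = hol f (K 0)
      rw [e0, ← mul_assoc, C_mul_C_eq_one (mul_inv_cancel₀ hl), one_mul]
    · change C (conj l) * antihol f (K' 0) = antihol f (K 0)
      rw [e0', ← mul_assoc, C_mul_C_eq_one (mul_inv_cancel₀ (by simpa using hl)), one_mul]
    · change C c * imagePoint f K' 2 = imagePoint f K 2
      rw [e2, ← mul_assoc, C_mul_C_eq_one (mul_inv_cancel₀ hc), one_mul]
  rw [basicEquation_scaledSeries f _ hf hK'0, basicEquation_scaledSeries f _ hf hK, e1, e1', e2,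
    subst_mul (hasSubst_of_zero (imagePoint_zero hf hK'0)), hsub, subst_C]
  have hpow : (C c⁻¹ ^ m * C (c ^ (m - 1)) : MvPowerSeries (Fin 3) ℂ) = C c⁻¹ := by
    obtain ⟨n, rfl⟩ := Nat.exists_eq_add_of_le (show 1 ≤ m by omega)
    rw [Nat.add_sub_cancel_left, ← map_pow, ← map_mul]
    congr 1
    rw [pow_add, pow_one, mul_assoc, ← mul_pow, inv_mul_cancel₀ hc, one_pow, mul_one]
  rw [mul_pow]
  linear_combination (-C (1 / 2) * imagePoint f K 2 ^ m * φ.subst (imagePoint f K)) * hpow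

theorem coeff_rescale_exp3 (a : Fin 3 → ℂ) (k l j : ℕ) :
    coeff (exp3 k l j) (rescale a φ) = a 0 ^ k * a 1 ^ l * a 2 ^ j * coeff (exp3 k l j) φ := by
  rw [coeff_rescale, Finsupp.prod_fintype _ _ (by simp), Fin.prod_univ_three, exp3_zero, exp3_one,
    exp3_two]

theorem conjSwap_rescale {l c : ℂ} (hcr : conj c = c) (hφ : conjSwap φ = φ) :
    conjSwap (C (c ^ (m - 1)) * rescale ![l, conj l, c] φ) =
      C (c ^ (m - 1)) * rescale ![l, conj l, c] φ := by
  refine ext_exp3 fun k i j => ?_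
  have h : conj (coeff (exp3 i k j) φ) = coeff (exp3 k i j) φ := by
    conv_rhs => rw [← hφ, coeff_conjSwap]
  rw [coeff_conjSwap, coeff_C_mul, coeff_C_mul, coeff_rescale_exp3, coeff_rescale_exp3]
  simp only [map_mul, map_pow, hcr, h, Complex.conj_conj, Matrix.cons_val]
  ring

end Rescaling

/-! ### Series in normal form -/

section NormalSeries

/-- The series `ε z χ + h` with `½ u ^ m (ε z χ + h)` in normal form. -/
structure IsNormalSeries (m : ℕ) (ε : ℂ) (φ : MvPowerSeries (Fin 3) ℂ) : Prop where
  real : conjSwap φ = φ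
  jet : IsAdmissibleJet ε fun k l => coeff (exp3 k l 0) φ
  vanish : ∀ k l i, 1 ≤ i → MustVanish m i k l → coeff (exp3 k l i) φ = 0

variable {m : ℕ} {ε : ℤˣ} {h φ : MvPowerSeries (Fin 3) ℂ}

theorem coeff_C_mul_X_mul_X (c : ℂ) (k l j : ℕ) :
    coeff (exp3 k l j) (C c * X 0 * X 1 : MvPowerSeries (Fin 3) ℂ) =
      if k = 1 ∧ l = 1 ∧ j = 0 then c else 0 := by
  classical
  have h : (C c * X 0 * X 1 : MvPowerSeries (Fin 3) ℂ) = monomial (exp3 1 1 0) c := by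
    rw [← monomial_zero_eq_C_apply, X, X, monomial_mul_monomial, monomial_mul_monomial]
    congr 1
    · congr 1
      ext s; fin_cases s <;> simp
    · ring
  rw [h, coeff_monomial]
  exact if_congr exp3_inj rfl rfl

theorem conj_unit (ε : ℤˣ) : conj (((ε : ℤ) : ℂ)) = ((ε : ℤ) : ℂ) := by simp

theorem sq_unit (ε : ℤˣ) : (((ε : ℤ) : ℂ)) ^ 2 = 1 := by
  rcases Int.units_eq_one_or ε with rfl | rfl <;> simp

theorem IsAdmissibleTail.jet (hh : IsAdmissibleTail h) (ε : ℤˣ) :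
    conjSwap (C ((ε : ℤ) : ℂ) * X 0 * X 1 + h) = C ((ε : ℤ) : ℂ) * X 0 * X 1 + h ∧
    IsAdmissibleJet ((ε : ℤ) : ℂ)
      fun k l => coeff (exp3 k l 0) (C ((ε : ℤ) : ℂ) * X 0 * X 1 + h) := by
  have hz : ∀ k l j, k < 2 ∨ l < 2 → coeff (exp3 k l j) h = 0 := by
    intro k l j hkl
    by_contra h0
    have := hh.2 k l j h0
    omega
  have hr : conjSwap (C ((ε : ℤ) : ℂ) * X 0 * X 1 + h) = C ((ε : ℤ) : ℂ) * X 0 * X 1 + h := by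
    rw [map_add, map_mul, map_mul, conjSwap_C, conjSwap_X_zero, conjSwap_X_one, conj_unit,
      isRealSeries_iff.mp hh.1]
    ring
  refine ⟨hr, sq_unit ε, conj_unit ε, fun k l => ?_, fun k => ?_, ?_, fun k hk => ?_⟩
  · conv_lhs => rw [← hr, coeff_conjSwap]
  · rw [map_add, coeff_C_mul_X_mul_X, hz _ _ _ (by omega), if_neg (by omega), add_zero]
  · rw [map_add, coeff_C_mul_X_mul_X, hz _ _ _ (by omega), if_pos (by omega), add_zero]
  · rw [map_add, coeff_C_mul_X_mul_X, hz _ _ _ (by omega), if_neg (by omega), add_zero]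

theorem IsAdmissibleTail.isNormalSeries (hh : IsAdmissibleTail h) (hn : IsNormalTail m h)
    (ε : ℤˣ) : IsNormalSeries m ((ε : ℤ) : ℂ) (C ((ε : ℤ) : ℂ) * X 0 * X 1 + h) := by
  refine ⟨(hh.jet ε).1, (hh.jet ε).2, fun k l i hi hv => ?_⟩
  rw [map_add, coeff_C_mul_X_mul_X, if_neg (by omega), zero_add]
  by_contra h0
  have h2 := hh.2 k l i h0
  rcases hv with hv | hv | ⟨rfl, rfl⟩ | ⟨rfl, rfl⟩ | ⟨rfl, rfl⟩ | ⟨rfl, rfl, hv⟩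
  · omega
  · omega
  · exact h0 (hn.1 i hi).1
  · exact h0 (hn.1 i hi).2.1
  · exact h0 (hn.1 i hi).2.2
  · exact h0 (hn.2 i (by omega) hv)

theorem IsNormalSeries.exists_tail (hφ : IsNormalSeries m ((ε : ℤ) : ℂ) φ) :
    ∃ h, admissibleSeries m ε h = scaledSeries m φ ∧ IsAdmissibleTail h ∧ IsNormalTail m h := by
  set h := φ - C ((ε : ℤ) : ℂ) * X 0 * X 1 with hh
  have hz : ∀ k l j, 1 ≤ j → MustVanish m j k l → coeff (exp3 k l j) h = 0 := by
    intro k l j hj hv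
    rw [hh, map_sub, hφ.vanish k l j hj hv, coeff_C_mul_X_mul_X, if_neg (by omega), sub_zero]
  have hk0 : ∀ k l, k < 2 ∨ l < 2 → coeff (exp3 k l 0) φ =
      if k = 1 ∧ l = 1 then ((ε : ℤ) : ℂ) else 0 := by
    intro k l hkl
    split_ifs with h11
    · rw [h11.1, h11.2]; exact hφ.jet.one_one
    · have h4 : k = 0 ∨ l = 0 ∨ (k = 1 ∧ l ≠ 1) ∨ (l = 1 ∧ k ≠ 1) := by omega
      rcases h4 with rfl | rfl | ⟨rfl, h1⟩ | ⟨rfl, h1⟩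
      · exact hφ.jet.zero_left l
      · exact hφ.jet.zero k
      · exact hφ.jet.one_left h1
      · exact hφ.jet.one k h1
  refine ⟨h, ?_, ⟨isRealSeries_iff.mpr ?_, fun k l j h0 => ?_⟩, fun j hj => ?_, fun j hj hm => ?_⟩
  · rw [admissibleSeries, scaledSeries, hh, add_sub_cancel]
  · rw [hh, map_sub, map_mul, map_mul, conjSwap_C, conjSwap_X_zero, conjSwap_X_one, conj_unit,
      hφ.real]
    ring
  · by_contra hkl
    refine h0 ?_
    rcases Nat.eq_zero_or_pos j with rfl | hj
    · rw [hh, map_sub, hk0 k l (by omega), coeff_C_mul_X_mul_X]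
      simp
    · exact hz k l j hj (by unfold MustVanish; omega)
  · exact ⟨hz _ _ _ hj (by unfold MustVanish; omega), hz _ _ _ hj (by unfold MustVanish; omega),
      hz _ _ _ hj (by unfold MustVanish; omega)⟩
  · exact hz _ _ _ (by omega) (by unfold MustVanish; omega)

/-- This is the effect of `w ↦ -w`. The sign `(-1)^(m-1)` is `-1` for even `m`, while powers of `-u`
affect only coefficients with positive powers of `u`. -/
theorem IsNormalSeries.rescale_neg (hm : Even m) (hm2 : 2 ≤ m) {ε : ℂ}
    (hφ : IsNormalSeries m ε φ) :
    IsNormalSeries m (-ε) (C ((-1) ^ (m - 1)) * rescale ![1, conj 1, -1] φ) := by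
  have hp : (-1 : ℂ) ^ (m - 1) = -1 := Odd.neg_one_pow (by
    obtain ⟨n, rfl⟩ := hm
    exact ⟨n - 1, by omega⟩)
  have hc : ∀ k l j, coeff (exp3 k l j) (C ((-1) ^ (m - 1)) * rescale ![1, conj 1, -1] φ) =
      -((-1) ^ j * coeff (exp3 k l j) φ) := by
    intro k l j
    rw [coeff_C_mul, coeff_rescale_exp3, hp]
    simp
  refine ⟨conjSwap_rescale (by simp) hφ.real, ?_, fun k l i hi hv => ?_⟩
  · simp only [hc, pow_zero, one_mul]
    obtain ⟨h1, h2, h3, h4, h5, h6⟩ := hφ.jet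
    refine ⟨by rw [neg_sq, h1], by rw [map_neg, h2], fun k l => ?_, fun k => ?_, ?_, fun k hk => ?_⟩
    · rw [h3, map_neg]
    · rw [h4, neg_zero]
    · rw [h5]
    · rw [h6 k hk, neg_zero]
  · rw [hc, hφ.vanish k l i hi hv]
    simp

end NormalSeries

/-! ### Existence of the normal form -/

section ExistenceOfNormalForm

theorem IsInvertibleMap.comp {K A : FormalMap} (hK : IsInvertibleMap K) (hA : IsInvertibleMap A) :
    IsInvertibleMap fun i => (K i).subst A := by
  refine ⟨fun i => by rw [constantCoeff_subst_zero hA.1, hK.1], ?_⟩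
  have h := mul_ne_zero hK.2 hA.2
  simp only [exp2_one_zero, exp2_zero_one, linearCoeff_subst hA.1, Fin.sum_univ_two] at h ⊢
  intro h0
  refine h ?_
  linear_combination h0

theorem IsTangentToIdentity.linearCoeff {K : FormalMap} (hK : IsTangentToIdentity K) :
    coeff (exp2 1 0) (K 0) = 1 ∧ coeff (exp2 1 0) (K 1) = 0 ∧ coeff (exp2 0 1) (K 1) = 1 := by
  have h0 := X_dvd_iff.mp hK.zero (exp2 1 0) (by simp)
  have h1 := X_pow_dvd_iff.mp hK.one (exp2 1 0) (by simp)
  have h2 := X_pow_dvd_iff.mp hK.one (exp2 0 1) (by simp)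
  rw [map_sub, exp2_one_zero, coeff_index_single_self_X] at h0
  rw [map_sub, exp2_one_zero, coeff_index_single_X, if_neg (by decide), sub_zero] at h1
  rw [map_sub, exp2_zero_one, coeff_index_single_self_X] at h2
  rw [exp2_one_zero, exp2_zero_one]
  exact ⟨by linear_combination h0, h1, by linear_combination h2⟩

theorem IsTangentToIdentity.isInvertibleMap {K : FormalMap} (hK : IsTangentToIdentity K) :
    IsInvertibleMap K := by
  refine ⟨hK.constantCoeff, ?_⟩
  obtain ⟨h1, h2, h3⟩ := hK.linearCoeff
  rw [h1, h2, h3]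
  simp

variable {m : ℕ} {P : MvPowerSeries (Fin 4) ℂ}

theorem IsNonresonantPoint.exists_normalForm (hm : 2 ≤ m) (h : IsNonresonantPoint m P) :
    ∃ (H : FormalMap) (ε : ℤˣ) (h : MvPowerSeries (Fin 3) ℂ),
      BringsToNormalForm m P H ε h ∧ (Even m → ε = 1) := by
  obtain ⟨A, ε, h, Θ, Φ, hA, hΘ, hΦ, hN⟩ := h
  set ψ := C ((ε : ℤ) : ℂ) * X 0 * X 1 + h with hψ
  have hadm : admissibleSeries m ε h = scaledSeries m ψ := rfl
  obtain ⟨hr, hS⟩ := hA.admissible.jet ε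
  rw [hadm] at hΘ
  have hNS := hN.isNonresonantJet hm hS hΘ hΦ
  obtain ⟨K, φ, hK, hφr, hφψ, hv, heq⟩ := exists_normalization hm hr hS hNS
  have hf := constantCoeff_scaledSeries hm ψ
  have hφ : IsNormalSeries m ((ε : ℤ) : ℂ) φ := by
    refine ⟨hφr, ?_, hv⟩
    have : (fun k l => coeff (exp3 k l 0) φ) = fun k l => coeff (exp3 k l 0) ψ := by
      funext k l; exact hφψ.coeff_eq (by norm_num)
    rw [this]; exact hS
  have hmaps : MapsToGraph A P (scaledSeries m ψ) := hA.maps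
  have conclude : ∀ (ε' : ℤˣ) (φ' : MvPowerSeries (Fin 3) ℂ) (K' : FormalMap),
      IsInvertibleMap K' → IsNormalSeries m ((ε' : ℤ) : ℂ) φ' →
      basicEquation (scaledSeries m ψ) K' (scaledSeries m φ') = 0 → (Even m → ε' = 1) →
      ∃ (H : FormalMap) (ε : ℤˣ) (h : MvPowerSeries (Fin 3) ℂ),
        BringsToNormalForm m P H ε h ∧ (Even m → ε = 1) := by
    intro ε' φ' K' hK' hφ' he hε'
    obtain ⟨h', h1, h2, h3⟩ := hφ'.exists_tail
    refine ⟨fun i => (K' i).subst A, ε', h', ⟨hK'.comp hA.invertible, h2, h3, ?_⟩, hε'⟩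
    rw [h1]
    exact MapsToGraph.comp hK'.1 hA.invertible.1 hmaps ((mapsToGraph_graphSeries_iff hf hK'.1).mpr he)
  -- Only for even `m` and sign `-1` does the normalization have to be followed by `w ↦ -w`.
  by_cases hcase : Even m ∧ ε = -1
  · obtain ⟨hev, rfl⟩ := hcase
    refine conclude 1 (C ((-1) ^ (m - 1)) * rescale ![1, conj 1, -1] φ)
      ![C 1⁻¹ * K 0, C (-1)⁻¹ * K 1] ?_ ?_ ?_ fun _ => rfl
    · refine ⟨fun i => by fin_cases i <;> simp [hK.constantCoeff], ?_⟩
      have := hK.isInvertibleMap.2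
      simp only [Matrix.cons_val_zero, Matrix.cons_val_one, coeff_C_mul]
      intro h0
      refine this ?_
      norm_num at h0
      linear_combination -h0
    · have := hφ.rescale_neg hev hm
      simpa using this
    · rw [basicEquation_rescale hf hK.constantCoeff one_ne_zero (by norm_num) (by simp) hm, heq,
        mul_zero]
  · refine conclude ε φ K hK.isInvertibleMap hφ heq fun hev => ?_
    rcases Int.units_eq_one_or ε with h1 | h1
    · exact h1
    · exact absurd ⟨hev, h1⟩ hcase

end ExistenceOfNormalForm

/-! ### Restriction to `χ = 0` -/

section Segre

variable {m : ℕ} {f φ φ' : MvPowerSeries (Fin 3) ℂ}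

/-- The restriction of the conjugate of a holomorphic series to `χ = 0`. -/
def conjAtZero (g : MvPowerSeries (Fin 2) ℂ) : MvPowerSeries (Fin 2) ℂ :=
  rescale ![0, 1] (conjSeries g)

theorem coeff_conjAtZero (g : MvPowerSeries (Fin 2) ℂ) (a k : ℕ) :
    coeff (exp2 a k) (conjAtZero g) = if a = 0 then conj (coeff (exp2 0 k) g) else 0 := by
  rw [conjAtZero, coeff_rescale, Finsupp.prod_fintype _ _ (by simp), Fin.prod_univ_two, exp2_zero,
    exp2_one, conjSeries, coeff_map]
  split_ifs with h
  · simp [h]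
  · simp [h]

theorem rescale_zero_one_eq_subst (g : MvPowerSeries (Fin 2) ℂ) :
    rescale ![0, 1] g = g.subst (![0, X 1] : Fin 2 → MvPowerSeries (Fin 2) ℂ) := by
  rw [rescale_eq_subst]
  congr 1
  funext i
  fin_cases i <;> simp

theorem conjAtZero_sub (g g' : MvPowerSeries (Fin 2) ℂ) :
    conjAtZero (g - g') = conjAtZero g - conjAtZero g' := by
  simp [conjAtZero, conjSeries]

theorem X_one_pow_dvd_iff {n : ℕ} {g : MvPowerSeries (Fin 2) ℂ} :
    X 1 ^ n ∣ g ↔ ∀ a k, k < n → coeff (exp2 a k) g = 0 := by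
  rw [X_pow_dvd_iff]
  refine ⟨fun h a k hk => h _ (by simpa using hk), fun h e he => ?_⟩
  rw [eq_exp2 e]
  exact h _ _ he

theorem X_pow_dvd_conjAtZero {n : ℕ} {g : MvPowerSeries (Fin 2) ℂ} (h : X 1 ^ n ∣ g) :
    X 1 ^ n ∣ conjAtZero g := by
  rw [X_one_pow_dvd_iff] at h ⊢
  intro a k hk
  rw [coeff_conjAtZero, h 0 k hk]
  simp

theorem X_dvd_conjAtZero {g : MvPowerSeries (Fin 2) ℂ} (h : constantCoeff g = 0) :
    X 1 ∣ conjAtZero g := by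
  rw [← pow_one (X 1), X_one_pow_dvd_iff]
  intro a k hk
  obtain rfl : k = 0 := by omega
  rw [coeff_conjAtZero, exp2_zero_eq, coeff_zero_eq_constantCoeff_apply, h]
  simp

/-- The restriction to `χ = 0` of the coordinates of the image point. -/
def segrePoint (K : FormalMap) : Fin 3 → MvPowerSeries (Fin 2) ℂ :=
  ![K 0, conjAtZero (K 0), C (1 / 2) * (K 1 + conjAtZero (K 1))]

theorem segrePoint_zero {K : FormalMap} (hK : ∀ i, constantCoeff (K i) = 0) (i : Fin 3) :
    constantCoeff (segrePoint K i) = 0 := by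
  have h : ∀ i, constantCoeff (conjAtZero (K i)) = 0 := fun i =>
    constantCoeff_eq_zero_of_dvd (X_dvd_conjAtZero (hK i))
  fin_cases i
  · exact hK 0
  · exact h 0
  · change constantCoeff (C (1 / 2) * (K 1 + conjAtZero (K 1))) = 0
    rw [map_mul, map_add, hK, h, add_zero, mul_zero]

/-- The restriction of the basic equation to `χ = 0`. -/
theorem segre_equation (hf : constantCoeff f = 0) (hf1 : X 1 ∣ f) {K : FormalMap}
    (hK : ∀ i, constantCoeff (K i) = 0) {g : MvPowerSeries (Fin 3) ℂ}
    (h : basicEquation f K g = 0) :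
    C (1 / (2 * Complex.I)) * (K 1 - conjAtZero (K 1)) = g.subst (segrePoint K) := by
  -- On `χ = 0` the series `f` vanishes, so `w` and `w̄` both reduce to `u`.
  set σ : Fin 3 → MvPowerSeries (Fin 2) ℂ := ![X 0, 0, X 1] with hσ
  have hσ0 : ∀ i, constantCoeff (σ i) = 0 := by intro i; fin_cases i <;> simp [hσ]
  have hs := hasSubst_of_zero hσ0
  have hfσ : f.subst σ = 0 := by
    obtain ⟨f', rfl⟩ := hf1
    rw [subst_mul hs, subst_X hs]
    simp [hσ]
  have h1 : ∀ k, (hol f k).subst σ = k := by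
    intro k
    rw [hol, subst_comp_subst_apply (hasSubst_of_zero (hol_args_zero hf)) hs]
    have : (fun s => ((![X 0, X 2 + C Complex.I * f] : Fin 2 → MvPowerSeries (Fin 3) ℂ) s).subst σ)
        = X := by
      funext i
      fin_cases i
      · exact subst_X hs 0
      · change (X 2 + C Complex.I * f).subst σ = X 1
        rw [subst_add hs, subst_mul hs, hfσ, subst_X hs, mul_zero, add_zero]
        rfl
    rw [this, subst_self, id_eq]
  have h2 : ∀ k, (antihol f k).subst σ = conjAtZero k := by
    intro k
    rw [antihol, subst_comp_subst_apply (hasSubst_of_zero (antihol_args_zero hf)) hs, conjAtZero,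
      rescale_zero_one_eq_subst]
    congr 1
    funext i
    fin_cases i
    · exact subst_X hs 1
    · change (X 2 - C Complex.I * f).subst σ = X 1
      rw [subst_sub hs, subst_mul hs, hfσ, subst_X hs, mul_zero, sub_zero]
      rfl
  have h3 := congrArg (subst σ) h
  rw [basicEquation, subst_sub hs, subst_mul hs, subst_C, subst_sub hs, h1, h2,
    subst_comp_subst_apply (hasSubst_of_zero (imagePoint_zero hf hK)) hs] at h3
  have h4 : (fun s => (imagePoint f K s).subst σ) = segrePoint K := by
    funext i
    fin_cases i
    · exact h1 _
    · exact h2 _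
    · change (C (1 / 2) * (hol f (K 1) + antihol f (K 1))).subst σ = _
      rw [subst_mul hs, subst_C, subst_add hs, h1, h2]
      rfl
  have h0 : (0 : MvPowerSeries (Fin 3) ℂ).subst σ = 0 := by
    rw [← coe_substAlgHom hs]; exact map_zero _
  rw [h4, h0] at h3
  exact sub_eq_zero.mp h3

theorem scaledSeries_subst {τ : Type*} [Finite τ] {a : Fin 3 → MvPowerSeries τ ℂ}
    (ha : ∀ i, constantCoeff (a i) = 0) :
    (scaledSeries m φ).subst a = C (1 / 2) * (a 2 ^ m * φ.subst a) := by
  have hs := hasSubst_of_zero ha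
  rw [scaledSeries, subst_mul hs, subst_mul hs, subst_C, subst_pow hs, subst_X hs, mul_assoc]

theorem dvd_of_C_mul_dvd {σ : Type*} {a : ℂ} (ha : a ≠ 0) {d x : MvPowerSeries σ ℂ}
    (h : d ∣ C a * x) : d ∣ x := by
  have h1 := h.mul_left (C a⁻¹)
  rwa [← mul_assoc, C_mul_C_eq_one (inv_mul_cancel₀ ha), one_mul] at h1

theorem two_I_ne_zero : 1 / (2 * Complex.I) ≠ 0 := by simp

/-- A map between hypersurfaces of infinite type preserves the complex locus `w = 0`, and its
transverse component is real and independent of `z` up to order `m`. -/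
theorem transverse_component (hf : constantCoeff f = 0) (hf1 : X 1 ∣ f)
    (hφ : X 1 ∣ φ) {K : FormalMap} (hK : ∀ i, constantCoeff (K i) = 0)
    (h : basicEquation f K (scaledSeries m φ) = 0) :
    X 1 ∣ K 1 ∧ X 1 ^ (m + 1) ∣ K 1 - conjAtZero (K 1) := by
  have hp := segrePoint_zero hK
  have hs := hasSubst_of_zero hp
  have h1 := segre_equation hf hf1 hK h
  obtain ⟨φ₁, rfl⟩ := hφ
  rw [scaledSeries_subst hp, subst_mul hs, subst_X hs] at h1
  -- A bootstrap: `F̄(0, u)` is divisible by `u`, which gives divisibility of `G - Ḡ(0, u)` and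
  -- hence of `G` by `u`. Then `(Re G)^m` contributes `m` further factors.
  have h2 : X 1 ∣ segrePoint K 1 := X_dvd_conjAtZero (hK 0)
  have h3 : X 1 ∣ K 1 - conjAtZero (K 1) := by
    refine dvd_of_C_mul_dvd two_I_ne_zero ?_
    rw [h1]
    exact ((h2.mul_right _).mul_left _).mul_left _
  have h4 : X 1 ∣ K 1 := (dvd_iff_dvd_of_dvd_sub h3).mpr (X_dvd_conjAtZero (hK 1))
  refine ⟨h4, dvd_of_C_mul_dvd two_I_ne_zero ?_⟩
  rw [h1, pow_succ]
  have h5 : X 1 ∣ segrePoint K 2 := (dvd_add h4 (X_dvd_conjAtZero (hK 1))).mul_left _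
  exact (mul_dvd_mul (pow_dvd_pow_of_dvd h5 m) (h2.mul_right _)).mul_left _

/-- The difference of the transverse components of two maps which agree up to order `j`. -/
theorem transverse_component_sub (hf : constantCoeff f = 0) (hf1 : X 1 ∣ f)
    {K K' : FormalMap} (hK : ∀ i, constantCoeff (K i) = 0) (hK' : ∀ i, constantCoeff (K' i) = 0)
    (hw : X 1 ∣ K 1) {j : ℕ} (h0 : X 1 ^ j ∣ K' 0 - K 0) (h1 : X 1 ^ (j + 1) ∣ K' 1 - K 1)
    (hφ : CongrMod j φ' φ) (h : basicEquation f K (scaledSeries m φ) = 0)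
    (h' : basicEquation f K' (scaledSeries m φ') = 0) :
    X 1 ^ (m + j) ∣ (K' 1 - K 1) - conjAtZero (K' 1 - K 1) := by
  have hp := segrePoint_zero hK
  have hp' := segrePoint_zero hK'
  have e := segre_equation hf hf1 hK h
  have e' := segre_equation hf hf1 hK' h'
  rw [scaledSeries_subst hp] at e
  rw [scaledSeries_subst hp'] at e'
  set a := segrePoint K with ha
  set a' := segrePoint K' with ha'
  have h2 : X 1 ^ (j + 1) ∣ a' 2 - a 2 := by
    have : a' 2 - a 2 = C (1 / 2) * ((K' 1 - K 1) + conjAtZero (K' 1 - K 1)) := by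
      rw [conjAtZero_sub]
      simp only [ha, ha', segrePoint, Matrix.cons_val]
      ring
    rw [this]
    exact (dvd_add h1 (X_pow_dvd_conjAtZero h1)).mul_left _
  have hsub : ∀ i, X 1 ^ j ∣ a' i - a i := by
    intro i
    fin_cases i
    · exact h0
    · change X 1 ^ j ∣ conjAtZero (K' 0) - conjAtZero (K 0)
      rw [← conjAtZero_sub]
      exact X_pow_dvd_conjAtZero h0
    · exact (pow_dvd_pow _ (by omega)).trans h2
  obtain ⟨y, hy⟩ : X 1 ∣ a 2 := (dvd_add hw (X_dvd_conjAtZero (hK 1))).mul_left _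
  obtain ⟨d, hd⟩ := h2
  have hy' : a' 2 = X 1 * (y + X 1 ^ j * d) := by
    linear_combination hd + hy
  -- Both real parts contain a factor `u` and their cofactors differ in order `j`, so the `m`-th
  -- powers agree through order `m + j - 1`.
  have hpow : X 1 ^ (m + j) ∣ a' 2 ^ m - a 2 ^ m := by
    rw [hy', hy, mul_pow, mul_pow, ← mul_sub, pow_add]
    refine mul_dvd_mul_left _ (dvd_trans ?_ (sub_dvd_pow_sub_pow _ _ m))
    rw [add_sub_cancel_left]
    exact dvd_mul_right _ _
  have hval : X 1 ^ j ∣ φ'.subst a' - φ.subst a := by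
    have s1 := subst_sub_subst_dvd hp' hp hsub φ
    obtain ⟨T, hT⟩ := hφ
    have hs' := hasSubst_of_zero hp'
    have s2 : X 1 ^ j ∣ φ'.subst a' - φ.subst a' := by
      rw [← subst_sub hs', hT, subst_mul hs', subst_pow hs', subst_X hs', hy', mul_pow]
      exact (dvd_mul_right _ _).mul_right _
    have := dvd_add s2 s1
    rwa [sub_add_sub_cancel] at this
  have hfinal : C (1 / (2 * Complex.I)) * ((K' 1 - K 1) - conjAtZero (K' 1 - K 1)) =
      C (1 / 2) * ((a' 2 ^ m - a 2 ^ m) * φ'.subst a' + a 2 ^ m * (φ'.subst a' - φ.subst a)) := by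
    rw [conjAtZero_sub]
    linear_combination e' - e
  refine dvd_of_C_mul_dvd two_I_ne_zero ?_
  rw [hfinal]
  refine (dvd_add (hpow.mul_right _) ?_).mul_left _
  rw [pow_add, hy, mul_pow]
  exact mul_dvd_mul (dvd_mul_right _ _) hval

theorem coeff_X_one_pow_mul (i a k : ℕ) (T : MvPowerSeries (Fin 2) ℂ) :
    coeff (exp2 a k) (X 1 ^ i * T) = if i ≤ k then coeff (exp2 a (k - i)) T else 0 := by
  classical
  rw [X_pow_eq, coeff_monomial_mul, one_mul]
  have h : exp2 a k - Finsupp.single 1 i = exp2 a (k - i) := by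
    ext s
    fin_cases s <;> simp
  simp only [Finsupp.single_le_iff, exp2_one, h]

/-- Below order `n` in `w`, the coefficients of `D` do not involve `z` and are real; they form `p`,
and all the rest goes into `q`. The bound `j + 2 ≤ n` guarantees that the coefficient of `w^(j+1)`
belongs to `p`. -/
theorem exists_real_decomposition {D : MvPowerSeries (Fin 2) ℂ} {n j : ℕ}
    (h : X 1 ^ n ∣ D - conjAtZero D) (hj : X 1 ^ (j + 1) ∣ D) (hn : j + 2 ≤ n) :
    ∃ p q : MvPowerSeries (Fin 2) ℂ, D = X 1 ^ (j + 1) * p + X 1 ^ n * q ∧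
      p.subst (![0, X 1] : Fin 2 → MvPowerSeries (Fin 2) ℂ) = p ∧ conjSeries p = p ∧
      X 1 ∣ p - C (coeff (exp2 0 (j + 1)) D) ∧
      conj (coeff (exp2 0 (j + 1)) D) = coeff (exp2 0 (j + 1)) D := by
  have hD : ∀ a k, k < n → coeff (exp2 a k) D =
      if a = 0 then conj (coeff (exp2 0 k) D) else 0 := by
    intro a k hk
    have := X_one_pow_dvd_iff.mp h a k hk
    rw [map_sub, coeff_conjAtZero] at this
    linear_combination this
  let p : MvPowerSeries (Fin 2) ℂ := fun e =>
    if e 0 = 0 ∧ e 1 + j + 1 < n then coeff (exp2 0 (e 1 + j + 1)) D else 0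
  have hp : ∀ a k, coeff (exp2 a k) p =
      if a = 0 ∧ k + j + 1 < n then coeff (exp2 0 (k + j + 1)) D else 0 := by
    intro a k
    change (if (exp2 a k) 0 = 0 ∧ (exp2 a k) 1 + j + 1 < n then
      coeff (exp2 0 ((exp2 a k) 1 + j + 1)) D else 0) = _
    exact if_congr (by rw [exp2_zero, exp2_one]) (by rw [exp2_one]) rfl
  have hreal : ∀ k, k < n → conj (coeff (exp2 0 k) D) = coeff (exp2 0 k) D := by
    intro k hk
    have := hD 0 k hk
    rw [if_pos rfl] at this
    exact this.symm
  obtain ⟨q, hq⟩ : X 1 ^ n ∣ D - X 1 ^ (j + 1) * p := by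
    rw [X_one_pow_dvd_iff]
    intro a k hk
    rw [map_sub, coeff_X_one_pow_mul]
    split_ifs with hjk
    · rw [hp, show k - (j + 1) + j + 1 = k by omega]
      by_cases ha : a = 0
      · rw [if_pos ⟨ha, hk⟩, ha, sub_self]
      · rw [if_neg fun h => ha h.1, hD a k hk, if_neg ha, sub_zero]
    · rw [X_one_pow_dvd_iff.mp hj a k (by omega), sub_zero]
  refine ⟨p, q, by linear_combination hq, ?_, ?_, ?_, hreal _ (by omega)⟩
  · rw [← rescale_zero_one_eq_subst]
    refine ext_exp2 fun a k => ?_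
    rw [coeff_rescale, Finsupp.prod_fintype _ _ (by simp), Fin.prod_univ_two, exp2_zero, exp2_one,
      hp]
    by_cases ha : a = 0
    · simp [ha]
    · simp [ha]
  · refine ext_exp2 fun a k => ?_
    rw [conjSeries, coeff_map, hp]
    split_ifs with h1
    · exact hreal _ h1.2
    · simp
  · rw [← pow_one (X 1), X_one_pow_dvd_iff]
    intro a k hk
    obtain rfl : k = 0 := by omega
    classical
    rw [map_sub, hp, ← monomial_zero_eq_C_apply, coeff_monomial, ← exp2_zero_eq]
    by_cases ha : a = 0
    · rw [if_pos ⟨ha, by omega⟩, if_pos (by rw [ha]), zero_add, sub_self]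
    · rw [if_neg fun h => ha h.1, if_neg fun h => ha (exp2_inj.mp h).1, sub_zero]

end Segre

/-! ### The leading order of a map to a normal form -/

section LeadingOrder

variable {m : ℕ} {ψ φ : MvPowerSeries (Fin 3) ℂ} {K : FormalMap}

/-- The leading order of the basic equation. -/
theorem basicEquation_leading (hm : 2 ≤ m) (hK : ∀ i, constantCoeff (K i) = 0)
    (hw : X 1 ∣ K 1) (hwr : X 1 ^ (m + 1) ∣ K 1 - conjAtZero (K 1))
    (h : basicEquation (scaledSeries m ψ) K (scaledSeries m φ) = 0) :
    CongrMod 1 (C (coeff (exp2 0 1) (K 1)) * ψ)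
      (C (coeff (exp2 0 1) (K 1) ^ m) * φ.subst (imagePoint (scaledSeries m ψ) K)) ∧
    conj (coeff (exp2 0 1) (K 1)) = coeff (exp2 0 1) (K 1) := by
  obtain ⟨p, q, hD, hp, hpr, hpb, hb⟩ := exists_real_decomposition (j := 0) hwr
    (by rwa [zero_add, pow_one]) (by omega)
  rw [zero_add] at hpb hb
  set c := coeff (exp2 0 1) (K 1) with hc
  refine ⟨?_, hb⟩
  -- The expansion is used with `j = 0`. The remainder begins at `w^(m+1)`, so the role of `q` falls
  -- to a multiple of `w`, which drops out modulo `u`.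
  have hD' : K 1 = X 1 ^ (0 + 1) * p + X 1 ^ (m + 0) * (X 1 * q) := by
    rw [hD]; ring
  have h1 := im_part_congr (j := 0) (q := X 1 * q) (ψ := ψ) hm hp hpr hpb
  rw [← hD'] at h1
  have hq1 : X 2 ^ 1 ∣ hol (scaledSeries m ψ) (X 1 * q) :=
    hol_dvd_of_dvd hm ψ (by rw [pow_one]; exact dvd_mul_right _ _)
  have hq2 : X 2 ^ 1 ∣ antihol (scaledSeries m ψ) (X 1 * q) :=
    antihol_dvd_of_dvd hm ψ (by rw [pow_one]; exact dvd_mul_right _ _)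
  have h2 : CongrMod (m + 1) (hol (scaledSeries m ψ) (K 1) - antihol (scaledSeries m ψ) (K 1))
      (X 2 ^ m * (C Complex.I * C c * ψ)) := by
    refine h1.trans (CongrMod.pow_mul m ?_)
    have h3 := (CongrMod.refl 1 (C Complex.I * C c * ψ)).add (congrMod_zero_iff.mpr
      (dvd_sub hq1 hq2))
    rw [add_zero] at h3
    refine CongrMod.trans (CongrMod.of_eq ?_) h3
    norm_num
  have hY := im_part_dvd (j := 0) (ψ := ψ) hm hD' hpb hb
  obtain ⟨t, ht⟩ := hY
  set Y := C (1 / 2) * (hol (scaledSeries m ψ) (K 1) + antihol (scaledSeries m ψ) (K 1)) with hYdef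
  have hY1 : Y = X 2 * (C c + X 2 * t) := by linear_combination ht
  set T := φ.subst (imagePoint (scaledSeries m ψ) K) with hT
  have hcc : CongrMod 1 ((C c + X 2 * t) ^ m) (C c ^ m) :=
    CongrMod.pow ⟨t, by ring⟩ m
  have h4 : CongrMod (m + 1) (Y ^ m * T) (X 2 ^ m * (C c ^ m * T)) := by
    rw [hY1, mul_pow, mul_assoc]
    exact CongrMod.pow_mul m (hcc.mul_right T)
  rw [basicEquation_scaledSeries _ _ (constantCoeff_scaledSeries hm ψ) hK] at h
  have h5 := (h2.mul_left (C (1 / (2 * Complex.I)))).sub (h4.mul_left (C (1 / 2)))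
  have h6 : C (1 / (2 * Complex.I)) *
      (hol (scaledSeries m ψ) (K 1) - antihol (scaledSeries m ψ) (K 1)) -
      C (1 / 2) * (Y ^ m * T) = 0 := h
  rw [h6] at h5
  have h7 : CongrMod (m + 1) (X 2 ^ m * (C c * ψ)) (X 2 ^ m * (C (c ^ m) * T)) := by
    have h8 := h5.symm.mul_left 2
    rw [mul_zero, congrMod_zero_iff] at h8
    have h9 : 2 * (C (1 / (2 * Complex.I)) * (X 2 ^ m * (C Complex.I * C c * ψ)) -
        C (1 / 2) * (X 2 ^ m * (C c ^ m * T))) =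
        X 2 ^ m * (C c * ψ) - X 2 ^ m * (C (c ^ m) * T) := by
      rw [map_pow]
      linear_combination (X 2 ^ m * (C c * ψ)) * C_inv_two_I_mul (σ := Fin 3) -
        (X 2 ^ m * (C c ^ m * T)) * C_half_mul_two (σ := Fin 3)
    rwa [h9] at h8
  exact CongrMod.of_pow_mul h7

theorem coeff_X_one_pow_mul_exp3 (i k l j : ℕ) (T : MvPowerSeries (Fin 3) ℂ) :
    coeff (exp3 k l j) (X 1 ^ i * T) = if i ≤ l then coeff (exp3 k (l - i) j) T else 0 := by
  classical
  rw [X_pow_eq, coeff_monomial_mul, one_mul]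
  have h : exp3 k l j - Finsupp.single 1 i = exp3 k (l - i) j := by
    ext s
    fin_cases s <;> simp
  simp only [Finsupp.single_le_iff, exp3_one, h]

/-- The restriction of the tangential component to `w = 0` is linear. -/
theorem tangential_component_leading (hm : 2 ≤ m) (hψ : conjSwap ψ = ψ) {ε ε' : ℂ}
    (hS : IsAdmissibleJet ε fun k l => coeff (exp3 k l 0) ψ)
    (hφ : X 1 ^ 2 ∣ φ - C ε' * X 0 * X 1) (hK : ∀ i, constantCoeff (K i) = 0)
    {c : ℂ} (h : CongrMod 1 (C c * ψ)
      (C (c ^ m) * φ.subst (imagePoint (scaledSeries m ψ) K))) (k : ℕ) :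
    c * (if k = 1 then ε else 0) =
      c ^ m * (ε' * conj (coeff (exp2 1 0) (K 0)) * coeff (exp2 k 0) (K 0)) := by
  set f := scaledSeries m ψ with hfdef
  have hf : constantCoeff f = 0 := constantCoeff_scaledSeries hm ψ
  set l := coeff (exp2 1 0) (K 0) with hl
  set a := hol f (K 0) with ha
  set b := antihol f (K 0) with hb
  -- At `u = 0`, `F̄` equals `conj l * χ` up to `χ²`. The coefficients of `z^k χ` in the
  -- leading-order equation therefore involve `φ` only through `ε' z χ`.
  obtain ⟨A, B, hAB⟩ := exists_column_decomposition (s := 1) (t := 2) (by decide) (by decide)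
    (by decide) 2 (b - X 1 ^ 1 * C (conj l))
  have hc0 : column 1 0 (b - X 1 ^ 1 * C (conj l)) = 0 := by
    ext i
    rw [coeff_column_one, map_sub, coeff_X_one_pow_mul_exp3, if_neg (by omega), hb,
      coeff_antihol_scaledSeries hm hψ, exp2_zero_eq, coeff_zero_eq_constantCoeff_apply, hK]
    simp
  have hc1 : column 1 1 (b - X 1 ^ 1 * C (conj l)) = 0 := by
    classical
    ext i
    rw [coeff_column_one, map_sub, coeff_X_one_pow_mul_exp3, if_pos le_rfl, hb,
      coeff_antihol_scaledSeries hm hψ, ← monomial_zero_eq_C_apply, coeff_monomial, ← exp3_zero_eq]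
    simp [exp3_inj, hl]
  rw [Finset.sum_range_succ, Finset.sum_range_succ, Finset.sum_range_zero, hc0, hc1, map_zero] at hAB
  obtain ⟨h2, hh2⟩ := hφ
  have hs := hasSubst_of_zero (imagePoint_zero hf hK)
  set T := h2.subst (imagePoint f K) with hT
  have hsub : φ.subst (imagePoint f K) = C ε' * a * b + b ^ 2 * T := by
    have : φ = C ε' * X 0 * X 1 + X 1 ^ 2 * h2 := by linear_combination hh2
    conv_lhs => rw [this]
    rw [subst_add hs, subst_mul hs, subst_mul hs, subst_mul hs, subst_pow hs, subst_C, subst_X hs,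
      subst_X hs]
    rfl
  have hb' : b = X 1 * (C (conj l) + X 1 * A) + X 2 * B := by linear_combination hAB
  have hexp : φ.subst (imagePoint f K) = X 1 ^ 1 * (C (ε' * conj l) * a) +
      X 1 ^ 2 * (C ε' * a * A + (C (conj l) + X 1 * A) ^ 2 * T) +
      X 2 ^ 1 * (C ε' * a * B + 2 * X 1 * (C (conj l) + X 1 * A) * B * T + X 2 * B ^ 2 * T) := by
    rw [hsub, hb', map_mul]
    ring
  have h3 := h.coeff_eq (a := k) (b := 1) (c := 0) (by norm_num)
  rw [coeff_C_mul, coeff_C_mul, hexp, map_add, map_add, coeff_X_one_pow_mul_exp3,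
    coeff_X_one_pow_mul_exp3, coeff_X_two_pow_mul, if_pos le_rfl, if_neg (by omega),
    if_neg (by omega), coeff_C_mul, ha, coeff_hol_scaledSeries hm, if_pos rfl, add_zero,
    add_zero] at h3
  rw [← h3]
  congr 1
  split_ifs with hk1
  · rw [hk1]; exact hS.one_one.symm
  · exact (hS.one k hk1).symm

end LeadingOrder

/-! ### Uniqueness of a normalization tangent to the identity -/

section Uniqueness

variable {m : ℕ} {ψ φ φ' : MvPowerSeries (Fin 3) ℂ} {K K' : FormalMap}

theorem X_one_dvd_of_coeff {F : MvPowerSeries (Fin 2) ℂ} (h : ∀ k, coeff (exp2 k 0) F = 0) :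
    X 1 ∣ F := by
  rw [← pow_one (X 1), X_one_pow_dvd_iff]
  intro a k hk
  obtain rfl : k = 0 := by omega
  exact h a

/-- Normalizations of the same hypersurface which agree up to order `j` agree up to order
`j + 1`. -/
theorem normalization_congr_succ {ε : ℂ} (hm : 2 ≤ m) (hψ : conjSwap ψ = ψ) (hψ1 : X 1 ∣ ψ)
    (hS : IsAdmissibleJet ε fun k l => coeff (exp3 k l 0) ψ)
    (hN : IsNonresonantJet ε fun k l => coeff (exp3 k l 0) ψ)
    (hK : IsTangentToIdentity K) (hK' : IsTangentToIdentity K') (hφ : CongrMod 1 φ ψ)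
    (hv : ∀ k l i, 1 ≤ i → MustVanish m i k l → coeff (exp3 k l i) φ = 0)
    (hv' : ∀ k l i, 1 ≤ i → MustVanish m i k l → coeff (exp3 k l i) φ' = 0)
    (h : basicEquation (scaledSeries m ψ) K (scaledSeries m φ) = 0)
    (h' : basicEquation (scaledSeries m ψ) K' (scaledSeries m φ') = 0)
    (hcoef : X 1 ^ m ∣ K' 1 - K 1 → coeff (exp2 0 m) (K' 1) = coeff (exp2 0 m) (K 1))
    {j : ℕ} (hj : 1 ≤ j) (h0 : X 1 ^ j ∣ K' 0 - K 0) (h1 : X 1 ^ (j + 1) ∣ K' 1 - K 1)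
    (hη : CongrMod j φ' φ) :
    X 1 ^ (j + 1) ∣ K' 0 - K 0 ∧ X 1 ^ (j + 2) ∣ K' 1 - K 1 ∧ CongrMod (j + 1) φ' φ := by
  have hf := constantCoeff_scaledSeries hm ψ
  have hf1 : X 1 ∣ scaledSeries m ψ := hψ1.mul_left _
  have hw : X 1 ∣ K 1 :=
    (dvd_iff_dvd_of_dvd_sub ((dvd_pow_self (X 1) two_ne_zero).trans hK.one)).mpr dvd_rfl
  have hreal := transverse_component_sub hf hf1 hK.constantCoeff hK'.constantCoeff hw h0 h1 hη h h'
  obtain ⟨p, q, hD, hp, hpr, hpb, hb⟩ := exists_real_decomposition hreal h1 (by omega)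
  set b := coeff (exp2 0 (j + 1)) (K' 1 - K 1) with hbdef
  obtain ⟨F, hF⟩ := h0
  obtain ⟨η, hη'⟩ := hη
  have key := basicEquation_sub_congr (φ' := φ') (F := F) (q := q) (η := η) hm hj hK hK' hφ (by linear_combination hF)
    (by linear_combination hD) (by linear_combination hη') hp hpr hpb hb
  rw [h, h', sub_zero] at key
  have hΛ : CongrMod 1 0 (C (1 / 2) * linearizedEquation m j ψ F q b η) :=
    CongrMod.of_pow_mul (i := m + j) (by rwa [mul_zero])
  set S : ℕ → ℕ → ℂ := fun k l => coeff (exp3 k l 0) ψ with hSdef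
  set κ := ((j : ℂ) + 1 - m) * b with hκdef
  have hlin : ∀ k l, linearizedCoeff S κ (fun k => coeff (exp2 k 0) F)
      (fun k => coeff (exp2 k 0) q) k l = coeff (exp3 k l 0) η := by
    intro k l
    have h2 := hΛ.coeff_eq (a := k) (b := l) (c := 0) (by norm_num)
    rw [coeff_C_mul, coeff_linearizedEquation hm hψ, map_zero] at h2
    linear_combination -2 * h2
  have hηz : ∀ k l, MustVanish m j k l → coeff (exp3 k l 0) η = 0 := by
    intro k l hkl
    have h2 := congrArg (coeff (exp3 k l j)) hη'
    rw [map_sub, hv k l j hj hkl, hv' k l j hj hkl, coeff_X_two_pow_mul, if_pos le_rfl,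
      Nat.sub_self, sub_zero] at h2
    exact h2.symm
  have hκr : conj κ = κ := by simp [hκdef, hb]
  have hκm : j + 1 = m → κ = 0 := by
    intro hjm
    rw [hκdef, ← hjm]
    push_cast
    ring
  obtain ⟨hκ0, hF0⟩ := homological_injective hS hN hκr hκm fun k l hkl => by
    rw [hlin, hηz k l hkl]
  -- For `j + 1 = m` the equation `κ = 0` carries no information on `b`; this is the only order at
  -- which the prescribed coefficient of `w^m` is needed.
  have hb0 : b = 0 := by
    by_cases hjm : j + 1 = m
    · rw [hbdef, hjm, map_sub, hcoef (by rwa [← hjm]), sub_self]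
    · refine (mul_eq_zero.mp hκ0).resolve_left fun h2 => hjm ?_
      have : ((j + 1 : ℕ) : ℂ) = (m : ℂ) := by push_cast; linear_combination h2
      exact_mod_cast this
  refine ⟨?_, ?_, ?_⟩
  · rw [hF, pow_succ]
    exact mul_dvd_mul_left _ (X_one_dvd_of_coeff hF0)
  · rw [hb0, map_zero, sub_zero] at hpb
    rw [hD]
    refine dvd_add ?_ ((pow_dvd_pow _ (by omega)).mul_right _)
    rw [pow_succ (X 1) (j + 1)]
    exact mul_dvd_mul_left _ hpb
  · rw [CongrMod, hη', pow_succ]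
    refine mul_dvd_mul_left _ ?_
    rw [← pow_one (X 2)]
    refine congrMod_zero_iff.mp (congrMod_iff.mpr fun k l i hi => ?_)
    obtain rfl : i = 0 := by omega
    rw [map_zero]
    -- For `k, l ≥ 2` the series `q` does not enter the equation, so `κ = 0` and `f = 0` force the
    -- increment of the target to vanish also at the indices left free.
    by_cases hkl : k < 2 ∨ l < 2
    · exact hηz k l (by unfold MustVanish; omega)
    · rw [← hlin, hκ0]
      simp [linearizedCoeff, fieldCoeff, hF0, show k ≠ 0 by omega, show l ≠ 0 by omega]

/-- A normalization which is tangent to the identity is determined by one real parameter. -/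
theorem normalization_unique {ε : ℂ} (hm : 2 ≤ m) (hψ : conjSwap ψ = ψ) (hψ1 : X 1 ∣ ψ)
    (hS : IsAdmissibleJet ε fun k l => coeff (exp3 k l 0) ψ)
    (hN : IsNonresonantJet ε fun k l => coeff (exp3 k l 0) ψ)
    (hK : IsTangentToIdentity K) (hK' : IsTangentToIdentity K') (hφ : CongrMod 1 φ ψ)
    (hφ' : CongrMod 1 φ' ψ)
    (hv : ∀ k l i, 1 ≤ i → MustVanish m i k l → coeff (exp3 k l i) φ = 0)
    (hv' : ∀ k l i, 1 ≤ i → MustVanish m i k l → coeff (exp3 k l i) φ' = 0)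
    (h : basicEquation (scaledSeries m ψ) K (scaledSeries m φ) = 0)
    (h' : basicEquation (scaledSeries m ψ) K' (scaledSeries m φ') = 0)
    (hcoef : X 1 ^ m ∣ K' 1 - K 1 → coeff (exp2 0 m) (K' 1) = coeff (exp2 0 m) (K 1)) :
    K' = K := by
  have hind : ∀ n : ℕ, X 1 ^ (n + 1) ∣ K' 0 - K 0 ∧ X 1 ^ (n + 2) ∣ K' 1 - K 1 ∧
      CongrMod (n + 1) φ' φ := by
    intro n
    induction n with
    | zero =>
      refine ⟨?_, ?_, hφ'.trans hφ.symm⟩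
      · have := dvd_sub hK'.zero hK.zero
        rwa [sub_sub_sub_cancel_right, ← pow_one (X 1)] at this
      · have := dvd_sub hK'.one hK.one
        rwa [sub_sub_sub_cancel_right] at this
    | succ n ih =>
      exact normalization_congr_succ hm hψ hψ1 hS hN hK hK' hφ hv hv' h h' hcoef (by omega) ih.1
        ih.2.1 ih.2.2
  funext i
  refine sub_eq_zero.mp (eq_zero_of_forall_dvd 1 fun n => ?_)
  fin_cases i
  · exact (pow_dvd_pow _ (by omega)).trans (hind n).1
  · exact (pow_dvd_pow _ (by omega)).trans (hind n).2.1

end Uniqueness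

/-! ### Directional derivatives of order `m` -/

section DirectionalCoefficient

theorem directionalCoeff_sub (m : ℕ) (g g' : MvPowerSeries (Fin 2) ℂ) (t : Fin 2 → ℂ) :
    directionalCoeff m (g - g') t = directionalCoeff m g t - directionalCoeff m g' t := by
  simp only [directionalCoeff, map_sub, sub_mul, Finset.sum_sub_distrib]

theorem directionalCoeff_add (m : ℕ) (g g' : MvPowerSeries (Fin 2) ℂ) (t : Fin 2 → ℂ) :
    directionalCoeff m (g + g') t = directionalCoeff m g t + directionalCoeff m g' t := by
  simp only [directionalCoeff, map_add, add_mul, Finset.sum_add_distrib]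

theorem coeff_X_zero_mul (a k : ℕ) (T : MvPowerSeries (Fin 2) ℂ) :
    coeff (exp2 a k) (X 0 * T) = if 1 ≤ a then coeff (exp2 (a - 1) k) T else 0 := by
  classical
  rw [X, coeff_monomial_mul, one_mul]
  have h : exp2 a k - Finsupp.single 0 1 = exp2 (a - 1) k := by
    ext s
    fin_cases s <;> simp
  simp only [Finsupp.single_le_iff, exp2_zero, h]

theorem coeff_X_one_mul (a k : ℕ) (T : MvPowerSeries (Fin 2) ℂ) :
    coeff (exp2 a k) (X 1 * T) = if 1 ≤ k then coeff (exp2 a (k - 1)) T else 0 := by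
  rw [← pow_one (X 1), coeff_X_one_pow_mul]

theorem directionalCoeff_X_zero_mul (n : ℕ) (g : MvPowerSeries (Fin 2) ℂ) (t : Fin 2 → ℂ) :
    directionalCoeff (n + 1) (X 0 * g) t = t 0 * directionalCoeff n g t := by
  rw [directionalCoeff, Finset.sum_range_succ', directionalCoeff, Finset.mul_sum]
  simp only [coeff_X_zero_mul]
  simp only [Nat.le_add_left, if_true, Nat.add_sub_cancel, Nat.add_sub_add_right]
  simp only [nonpos_iff_eq_zero, one_ne_zero, if_false, zero_mul, add_zero]
  exact Finset.sum_congr rfl fun a _ => by ring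

theorem directionalCoeff_X_one_mul (n : ℕ) (g : MvPowerSeries (Fin 2) ℂ) (t : Fin 2 → ℂ) :
    directionalCoeff (n + 1) (X 1 * g) t = t 1 * directionalCoeff n g t := by
  rw [directionalCoeff, Finset.sum_range_succ, directionalCoeff, Finset.mul_sum, coeff_X_one_mul,
    if_neg (by omega), zero_mul, zero_mul, add_zero]
  refine Finset.sum_congr rfl fun a ha => ?_
  rw [Finset.mem_range] at ha
  rw [coeff_X_one_mul, if_pos (by omega), show n + 1 - a = n - a + 1 by omega,
    Nat.add_sub_cancel]
  ring

theorem exists_linear_decomposition {a : MvPowerSeries (Fin 2) ℂ} (ha : constantCoeff a = 0) :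
    ∃ a0 a1, a = X 0 * a0 + X 1 * a1 ∧ constantCoeff a0 = coeff (exp2 1 0) a ∧
      constantCoeff a1 = coeff (exp2 0 1) a := by
  let T : MvPowerSeries (Fin 2) ℂ := fun e => if e 1 = 0 then coeff e a else 0
  have hT : ∀ e, coeff e T = if e 1 = 0 then coeff e a else 0 := fun e => rfl
  obtain ⟨a0, h0⟩ : X 0 ∣ T := X_dvd_iff.mpr fun e he => by
    rw [hT]
    split_ifs with h
    · rw [eq_exp2 e, he, h, exp2_zero_eq, coeff_zero_eq_constantCoeff_apply, ha]
    · rfl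
  obtain ⟨a1, h1⟩ : X 1 ∣ a - T := X_dvd_iff.mpr fun e he => by
    rw [map_sub, hT, if_pos he, sub_self]
  have h : a = X 0 * a0 + X 1 * a1 := by linear_combination h0 + h1
  refine ⟨a0, a1, h, ?_, ?_⟩
  · rw [h, map_add, coeff_X_zero_mul, coeff_X_one_mul]
    simp [exp2_zero_eq]
  · rw [h, map_add, coeff_X_zero_mul, coeff_X_one_mul]
    simp [exp2_zero_eq]

/-- The lowest-order directional coefficient of a multiple of a power. -/
theorem directionalCoeff_pow_mul {a : MvPowerSeries (Fin 2) ℂ} (ha : constantCoeff a = 0)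
    (t : Fin 2 → ℂ) (n : ℕ) (g : MvPowerSeries (Fin 2) ℂ) :
    directionalCoeff n (a ^ n * g) t = differential a t ^ n * constantCoeff g := by
  obtain ⟨a0, a1, h, h0, h1⟩ := exists_linear_decomposition ha
  induction n generalizing g with
  | zero => simp [directionalCoeff, exp2_zero_eq]
  | succ n ih =>
    -- One of the factors `a` is split into its `X 0` and `X 1` parts; the remaining `n` factors are
    -- left to the induction hypothesis.
    have e : a ^ (n + 1) * g = X 0 * (a ^ n * (a0 * g)) + X 1 * (a ^ n * (a1 * g)) := by
      conv_lhs => rw [pow_succ, mul_assoc]; arg 2; rw [h]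
      ring
    rw [e, directionalCoeff_add, directionalCoeff_X_zero_mul, directionalCoeff_X_one_mul, ih, ih,
      map_mul, map_mul, h0, h1, differential]
    ring

end DirectionalCoefficient

/-! ### Transport to a coordinate system -/

section Transport

variable {P : MvPowerSeries (Fin 4) ℂ} {f g : MvPowerSeries (Fin 3) ℂ} {A B H : FormalMap}

theorem IsInvertibleMap.linearCoeff_ne_zero (hA : IsInvertibleMap A) :
    coeff (exp2 1 0) (A 1) ≠ 0 ∨ coeff (exp2 0 1) (A 1) ≠ 0 := by
  by_contra! h
  refine hA.2 ?_
  rw [h.1, h.2]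
  ring

/-- By the chain rule the Jacobian matrices multiply to the identity, so a vanishing determinant
would give `1 = 0`. -/
theorem IsInvertibleMap.of_subst_eq_X (hB : ∀ i, constantCoeff (B i) = 0)
    (h : ∀ i, (A i).subst B = X i) : IsInvertibleMap B := by
  refine ⟨hB, fun h0 => ?_⟩
  have e : ∀ i j, ∑ s, coeff (Finsupp.single s 1) (A i) * coeff (Finsupp.single j 1) (B s) =
      if j = i then 1 else 0 := by
    intro i j
    classical
    rw [← linearCoeff_subst hB, h, coeff_index_single_X]
  have e00 := e 0 0
  have e01 := e 0 1
  have e10 := e 1 0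
  have e11 := e 1 1
  simp only [Fin.sum_univ_two, if_true] at e00 e11
  rw [Fin.sum_univ_two, if_neg (by decide)] at e01 e10
  rw [exp2_one_zero, exp2_zero_one] at h0
  set a00 := coeff (Finsupp.single 0 1) (A 0)
  set a01 := coeff (Finsupp.single 1 1) (A 0)
  set a10 := coeff (Finsupp.single 0 1) (A 1)
  set a11 := coeff (Finsupp.single 1 1) (A 1)
  set b00 := coeff (Finsupp.single 0 1) (B 0)
  set b01 := coeff (Finsupp.single 1 1) (B 0)
  set b10 := coeff (Finsupp.single 0 1) (B 1)
  set b11 := coeff (Finsupp.single 1 1) (B 1)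
  have : (1 : ℂ) = 0 := by
    linear_combination (a00 * a11 - a01 * a10) * h0 - e00 * (a10 * b01 + a11 * b11) - e11 +
      e01 * (a10 * b00 + a11 * b10)
  exact one_ne_zero this

/-- The defining series is equivalent to the one given by the coordinates `A`. -/
theorem MapsToGraph.dvd_defining (hP : constantCoeff P = 0)
    (hf : ∀ i, coeff (Finsupp.single i 1) f = 0) (hA : IsInvertibleMap A)
    (h : MapsToGraph A P f) : (graphSeries f).subst (complexify A) ∣ P := by
  obtain ⟨h1, h2⟩ := linearCoeff_graphSeries_subst_complexify hf hA.1
  rcases hA.linearCoeff_ne_zero with hA1 | hA1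
  · refine dvd_of_dvd_of_linearCoeff_ne_zero hP h (i := 0) ?_
    rw [← exp4_first, h1]
    exact mul_ne_zero (by simp) hA1
  · refine dvd_of_dvd_of_linearCoeff_ne_zero hP h (i := 1) ?_
    rw [← exp4_second, h2]
    exact mul_ne_zero (by simp) hA1

/-- The series `P` and the pulled-back defining series generate the same ideal, so the divisibility
defining `H` can be carried to the coordinates `A` by substituting their inverse `B`. -/
theorem MapsToGraph.basicEquation_eq_zero (hP : constantCoeff P = 0)
    (hf0 : constantCoeff f = 0) (hf : ∀ i, coeff (Finsupp.single i 1) f = 0)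
    (hA : IsInvertibleMap A) (h : MapsToGraph A P f) (hB : ∀ i, constantCoeff (B i) = 0)
    (hAB : ∀ i, (A i).subst B = X i) (hH : ∀ i, constantCoeff (H i) = 0)
    (hg : MapsToGraph H P g) : basicEquation f (fun i => (H i).subst B) g = 0 := by
  have hHB : ∀ i, constantCoeff ((H i).subst B) = 0 := fun i => by
    rw [constantCoeff_subst_zero hB, hH]
  rw [← mapsToGraph_graphSeries_iff hf0 hHB]
  obtain ⟨T, hT⟩ := (h.dvd_defining hP hf hA).trans hg
  have hc := hasSubst_of_zero (complexify_zero hB)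
  have h1 := congrArg (subst (complexify B)) hT
  rw [subst_mul hc, subst_comp_subst_apply (hasSubst_of_zero (complexify_zero hH)) hc,
    subst_comp_subst_apply (hasSubst_of_zero (complexify_zero hA.1)) hc, complexify_subst hB,
    complexify_subst hB] at h1
  have h2 : (fun i => (A i).subst B) = X := funext hAB
  rw [h2, complexify_X, subst_self, id_eq] at h1
  exact ⟨_, h1⟩

/-- The complex tangent space in the coordinates `A`. -/
theorem MapsToGraph.mem_holomorphicTangent (hP : constantCoeff P = 0)
    (hf : ∀ i, coeff (Finsupp.single i 1) f = 0)
    (hA : IsInvertibleMap A) (h : MapsToGraph A P f) {v : Fin 2 → ℂ}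
    (hv : differential (A 1) v = 0) : v ∈ holomorphicTangent P := by
  obtain ⟨h1, h2⟩ := linearCoeff_graphSeries_subst_complexify hf hA.1
  obtain ⟨U, hU⟩ := h.dvd_defining hP hf hA
  have hQ0 : constantCoeff ((graphSeries f).subst (complexify A)) = 0 := by
    obtain ⟨T, hT⟩ := h
    rw [hT, map_mul, hP, zero_mul]
  have e1 : coeff (exp4 1 0 0 0) P = 1 / (2 * Complex.I) * coeff (exp2 1 0) (A 1) *
      constantCoeff U := by
    rw [← h1, exp4_first, hU, linearCoeff_mul, hQ0, zero_mul, add_zero]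
  have e2 : coeff (exp4 0 1 0 0) P = 1 / (2 * Complex.I) * coeff (exp2 0 1) (A 1) *
      constantCoeff U := by
    rw [← h2, exp4_second, hU, linearCoeff_mul, hQ0, zero_mul, add_zero]
  change _ = _
  rw [e1, e2]
  rw [differential] at hv
  linear_combination (1 / (2 * Complex.I) * constantCoeff U) * hv

end Transport

/-! ### Reality of the parameter and reduction to maps tangent to the identity -/

section NormalForm

variable {m : ℕ} {P : MvPowerSeries (Fin 4) ℂ}

theorem IsAdmissibleTail.dvd {h : MvPowerSeries (Fin 3) ℂ} (hh : IsAdmissibleTail h) :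
    X 1 ^ 2 ∣ h := by
  rw [X_pow_dvd_iff]
  intro e he
  by_contra h0
  rw [eq_exp3 e] at h0
  have := hh.2 _ _ _ h0
  omega

theorem IsAdmissibleTail.X_one_dvd {h : MvPowerSeries (Fin 3) ℂ} (hh : IsAdmissibleTail h) (c : ℂ) :
    X 1 ∣ C c * X 0 * X 1 + h :=
  dvd_add (dvd_mul_left _ _) ((dvd_pow_self _ two_ne_zero).trans hh.dvd)

/-- The transverse derivative of order `m` is real in normal coordinates. -/
theorem BringsToNormalForm.im_coeff_eq_zero (hP : constantCoeff P = 0)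
    {f : MvPowerSeries (Fin 3) ℂ} (hf : IsNormalCoordinates P X f) {H : FormalMap} {ε : ℤˣ}
    {h : MvPowerSeries (Fin 3) ℂ} (hH : BringsToNormalForm m P H ε h) :
    (coeff (exp2 0 m) (H 1)).im = 0 := by
  have hz : ∀ e : Fin 3 →₀ ℕ, e 0 = 0 ∨ e 1 = 0 → coeff e f = 0 := by
    intro e he
    by_contra h0
    rw [eq_exp3 e] at h0
    have := hf.normal _ _ _ h0
    omega
  have hf0 : constantCoeff f = 0 := by
    rw [← coeff_zero_eq_constantCoeff_apply]; exact hz 0 (by simp)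
  have hf1 : ∀ i, coeff (Finsupp.single i 1) f = 0 := by
    intro i; refine hz _ ?_; fin_cases i <;> simp
  have heq := hf.maps.basicEquation_eq_zero hP hf0 hf1 hf.invertible (B := X) (by simp)
    (fun i => by rw [subst_self, id_eq]) hH.invertible.1 hH.maps
  have hHX : (fun i => (H i).subst (X : Fin 2 → MvPowerSeries (Fin 2) ℂ)) = H := by
    funext i; rw [subst_self, id_eq]
  rw [hHX] at heq
  -- Normality of the source suffices for the restriction to `χ = 0`; the coefficient of `w^m` lies
  -- within the range where `G` and its conjugate agree.
  obtain ⟨-, h2⟩ := transverse_component hf0 (X_dvd_iff.mpr fun e he => hz e (Or.inr he))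
    (hH.admissible.X_one_dvd _) hH.invertible.1 heq
  have h3 := X_one_pow_dvd_iff.mp h2 0 m (Nat.lt_succ_self m)
  rw [map_sub, coeff_conjAtZero, if_pos rfl, sub_eq_zero] at h3
  exact Complex.conj_eq_iff_im.mp h3.symm

theorem coeff_exp2_X_zero (a k : ℕ) :
    coeff (exp2 a k) (X 0 : MvPowerSeries (Fin 2) ℂ) = if a = 1 ∧ k = 0 then 1 else 0 := by
  classical
  rw [coeff_X, ← exp2_one_zero]
  exact if_congr exp2_inj rfl rfl

theorem coeff_exp2_X_one (a k : ℕ) :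
    coeff (exp2 a k) (X 1 : MvPowerSeries (Fin 2) ℂ) = if a = 0 ∧ k = 1 then 1 else 0 := by
  classical
  rw [coeff_X, ← exp2_zero_one]
  exact if_congr exp2_inj rfl rfl

/-- A formal map between a hypersurface in admissible coordinates and one in normal form is, after
rescaling, tangent to the identity. -/
theorem exists_tangent_rescaling {ψ φ : MvPowerSeries (Fin 3) ℂ} (hm : 2 ≤ m)
    (hψ : conjSwap ψ = ψ) (hψ1 : X 1 ∣ ψ) {ε₀ ε : ℂ}
    (hS : IsAdmissibleJet ε₀ fun k l => coeff (exp3 k l 0) ψ)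
    (hφ : IsNormalSeries m ε φ) (hφ1 : X 1 ∣ φ) (hφ2 : X 1 ^ 2 ∣ φ - C ε * X 0 * X 1)
    {K : FormalMap} (hK : IsInvertibleMap K)
    (heq : basicEquation (scaledSeries m ψ) K (scaledSeries m φ) = 0) :
    ∃ l c : ℂ, ∃ φ' : MvPowerSeries (Fin 3) ℂ, l = coeff (exp2 1 0) (K 0) ∧
      c = coeff (exp2 0 1) (K 1) ∧ coeff (exp2 1 0) (K 1) = 0 ∧ l ≠ 0 ∧ c ≠ 0 ∧ conj c = c ∧
      ε₀ = c ^ (m - 1) * (ε * conj l * l) ∧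
      IsTangentToIdentity ![C l⁻¹ * K 0, C c⁻¹ * K 1] ∧ CongrMod 1 φ' ψ ∧
      (∀ k l i, 1 ≤ i → MustVanish m i k l → coeff (exp3 k l i) φ' = 0) ∧
      basicEquation (scaledSeries m ψ) ![C l⁻¹ * K 0, C c⁻¹ * K 1] (scaledSeries m φ') = 0 := by
  have hf := constantCoeff_scaledSeries hm ψ
  have hf1 : X 1 ∣ scaledSeries m ψ := hψ1.mul_left _
  obtain ⟨hw, hwr⟩ := transverse_component hf hf1 hφ1 hK.1 heq
  obtain ⟨hlead, hcr⟩ := basicEquation_leading hm hK.1 hw hwr heq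
  have htan := tangential_component_leading hm hψ hS hφ2 hK.1 hlead
  set l := coeff (exp2 1 0) (K 0) with hl
  set c := coeff (exp2 0 1) (K 1) with hc
  have hK10 : ∀ a, coeff (exp2 a 0) (K 1) = 0 := fun a =>
    X_dvd_iff.mp hw _ (by simp)
  have hdet := hK.2
  -- Because `G(z, 0) = 0`, the Jacobian determinant at the origin is `l c`.
  rw [hK10 1, mul_zero, sub_zero] at hdet
  have hl0 : l ≠ 0 := left_ne_zero_of_mul hdet
  have hc0 : c ≠ 0 := right_ne_zero_of_mul hdet
  have hε : ε ≠ 0 := fun h0 => by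
    have := hφ.jet.sq
    rw [h0] at this
    norm_num at this
  have hcm : c ^ m = c * c ^ (m - 1) := by
    rw [← pow_succ', Nat.sub_add_cancel (by omega)]
  have hT : IsTangentToIdentity ![C l⁻¹ * K 0, C c⁻¹ * K 1] := by
    refine ⟨X_one_dvd_of_coeff fun k => ?_, X_one_pow_dvd_iff.mpr fun a k hk => ?_⟩
    · simp only [Matrix.cons_val_zero, map_sub, coeff_C_mul, coeff_exp2_X_zero]
      by_cases hk : k = 1
      · rw [hk, ← hl, inv_mul_cancel₀ hl0]; simp
      · have h1 := htan k
        rw [if_neg hk, mul_zero, eq_comm, mul_eq_zero, or_iff_right (pow_ne_zero _ hc0),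
          mul_eq_zero, or_iff_right (mul_ne_zero hε (by simpa using hl0))] at h1
        rw [h1, if_neg (by omega)]
        simp
    · simp only [Matrix.cons_val, map_sub, coeff_C_mul, coeff_exp2_X_one]
      interval_cases k
      · rw [hK10, if_neg (by omega)]; simp
      · by_cases ha : a = 0
        · rw [ha, ← hc, inv_mul_cancel₀ hc0]; simp
        · have h1 := X_one_pow_dvd_iff.mp hwr a 1 (by omega)
          rw [map_sub, coeff_conjAtZero, if_neg ha, sub_zero] at h1
          rw [h1, if_neg (by omega)]
          simp
  set K' : FormalMap := ![C l⁻¹ * K 0, C c⁻¹ * K 1] with hK'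
  set φ' := C (c ^ (m - 1)) * rescale ![l, conj l, c] φ with hφ'
  have heq' : basicEquation (scaledSeries m ψ) K' (scaledSeries m φ') = 0 := by
    rw [hK', hφ', basicEquation_rescale hf hK.1 hl0 hc0 hcr hm, heq, mul_zero]
  have hφ'1 : X 1 ∣ φ' := by
    refine dvd_mul_of_dvd_right (X_dvd_iff.mpr fun e he => ?_) _
    rw [eq_exp3 e, coeff_rescale_exp3, X_dvd_iff.mp hφ1 _ (by simpa using he), mul_zero]
  obtain ⟨hw', hwr'⟩ := transverse_component hf hf1 hφ'1 hT.constantCoeff heq'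
  -- For the rescaled map the transverse derivative is `1`, so the leading order now says that the
  -- rescaled target agrees with `ψ` at `u = 0`.
  obtain ⟨hlead', -⟩ := basicEquation_leading hm hT.constantCoeff hw' hwr' heq'
  have hc1 : coeff (exp2 0 1) (K' 1) = 1 := hT.linearCoeff.2.2
  rw [hc1, one_pow, map_one, one_mul, one_mul] at hlead'
  have hsub := CongrMod.subst (k := 1) (b := X) (imagePoint_zero hf hT.constantCoeff) (by simp)
    (hT.imagePoint_congr hm ψ) φ'
  rw [subst_self, id_eq] at hsub
  refine ⟨l, c, φ', rfl, rfl, hK10 1, hl0, hc0, hcr, ?_, hT, (hlead'.trans hsub).symm, ?_, heq'⟩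
  · have h1 := htan 1
    rw [if_pos rfl, hcm, mul_assoc] at h1
    exact mul_left_cancel₀ hc0 h1
  · intro k i j hj hv
    rw [hφ', coeff_C_mul, coeff_rescale_exp3, hφ.vanish k i j hj hv, mul_zero, mul_zero]

end NormalForm

/-! ### Uniqueness of the normalizing transformation -/

section UniquenessOfNormalization

/-- For even `m` the exponent `m - 1` is odd and the power is injective on the reals. Otherwise
absolute values give `r = 1` for the positive ratio `r`. -/
theorem eq_of_scaling_relation {m : ℕ} (hm : 2 ≤ m) {ε ε' : ℤˣ} {x x' : ℝ} (hx' : x' ≠ 0)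
    (h : x ^ (m - 1) * ((ε : ℤ) : ℝ) = x' ^ (m - 1) * ((ε' : ℤ) : ℝ))
    (hs : (Even m ∧ ε = ε') ∨ ∃ r : ℝ, 0 < r ∧ x = r * x') : x = x' := by
  have hne : m - 1 ≠ 0 := by omega
  rcases hs with ⟨hev, rfl⟩ | ⟨r, hr, rfl⟩
  · have hε : ((ε : ℤ) : ℝ) ≠ 0 := by
      rcases Int.units_eq_one_or ε with rfl | rfl <;> simp
    have hodd : Odd (m - 1) := by
      obtain ⟨n, rfl⟩ := hev
      exact ⟨n - 1, by omega⟩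
    exact hodd.strictMono_pow.injective (mul_right_cancel₀ hε h)
  · have habs : ∀ u : ℤˣ, |((u : ℤ) : ℝ)| = 1 := by
      intro u
      rcases Int.units_eq_one_or u with rfl | rfl <;> simp
    have h1 := congrArg abs h
    rw [abs_mul, abs_mul, habs, habs, mul_one, mul_one, abs_pow, abs_pow,
      pow_left_inj₀ (abs_nonneg _) (abs_nonneg _) hne, abs_mul, abs_of_pos hr] at h1
    have h2 : r = 1 := mul_right_cancel₀ (abs_ne_zero.mpr hx') (by rw [h1, one_mul])
    rw [h2, one_mul]

variable {m : ℕ} {P : MvPowerSeries (Fin 4) ℂ}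

/-- Uniqueness of the normalizing transformation. -/
theorem IsNonresonantPoint.normalForm_unique (hm : 2 ≤ m) (hP : constantCoeff P = 0)
    (hres : IsNonresonantPoint m P) {H H' : FormalMap} {ε ε' : ℤˣ}
    {h h' : MvPowerSeries (Fin 3) ℂ} {t : Fin 2 → ℂ} (hH : BringsToNormalForm m P H ε h)
    (hH' : BringsToNormalForm m P H' ε' h')
    (hT : ∀ v ∈ holomorphicTangent P, ∀ i, differential (H i) v = differential (H' i) v)
    (ht : t ∉ holomorphicTangent P)
    (hdir : directionalCoeff m (H 1) t = directionalCoeff m (H' 1) t)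
    (hsign : (Even m ∧ ε = ε') ∨
      ∃ c : ℝ, 0 < c ∧ differential (H 1) t = (c : ℂ) * differential (H' 1) t) : H = H' := by
  obtain ⟨A, ε₀, h₀, Θ, Φ, hA, hΘ, hΦ, hN⟩ := hres
  set ψ := C ((ε₀ : ℤ) : ℂ) * X 0 * X 1 + h₀ with hψdef
  obtain ⟨hψ, hS⟩ := hA.admissible.jet ε₀
  have hNS := hN.isNonresonantJet hm hS hΘ hΦ
  have hψ1 : X 1 ∣ ψ := hA.admissible.X_one_dvd _
  have hmaps : MapsToGraph A P (scaledSeries m ψ) := hA.maps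
  have hf0 := constantCoeff_scaledSeries hm ψ
  have hf1 : ∀ i, coeff (Finsupp.single i 1) (scaledSeries m ψ) = 0 :=
    linearCoeff_admissibleSeries hm ε₀ h₀
  obtain ⟨B, hB, hBA, hAB⟩ := hA.invertible.exists_inverse
  have hBinv : IsInvertibleMap B := IsInvertibleMap.of_subst_eq_X hB hAB
  have tail : ∀ {δ : ℤˣ} {g : MvPowerSeries (Fin 3) ℂ}, IsAdmissibleTail g →
      X 1 ^ 2 ∣ (C ((δ : ℤ) : ℂ) * X 0 * X 1 + g) - C ((δ : ℤ) : ℂ) * X 0 * X 1 := fun hg => by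
    rw [add_sub_cancel_left]; exact hg.dvd
  have data : ∀ {G : FormalMap} {δ : ℤˣ} {g : MvPowerSeries (Fin 3) ℂ},
      BringsToNormalForm m P G δ g → _ := fun {G δ g} hG =>
    exists_tangent_rescaling hm hψ hψ1 hS (hG.admissible.isNormalSeries hG.normal δ)
      (hG.admissible.X_one_dvd _) (tail hG.admissible) (hG.invertible.comp hBinv)
      (hmaps.basicEquation_eq_zero hP hf0 hf1 hA.invertible hB hAB hG.invertible.1 hG.maps)
  obtain ⟨l, c, φ, hl, hc, hK10, hl0, hc0, hcr, hrel, hKt, hφ, hv, heq⟩ := data hH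
  obtain ⟨l', c', φ', hl', hc', hK10', hl0', hc0', hcr', hrel', hKt', hφ', hv', heq'⟩ := data hH'
  set K : FormalMap := fun i => (H i).subst B with hK
  set K' : FormalMap := fun i => (H' i).subst B with hK'
  have back : ∀ (G : FormalMap) i, ((G i).subst B).subst A = G i := by
    intro G i
    rw [subst_comp_subst_apply (hasSubst_of_zero hB) (hasSubst_of_zero hA.invertible.1)]
    have : (fun s => (B s).subst A) = X := funext hBA
    rw [this, subst_self, id_eq]
  -- the first-order data along the complex tangent space
  have hll : l = l' := by
    -- `v` is the image of the first basis vector under the differential of `B`; it is complex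
    -- tangent because the differential of `A 1` annihilates it.
    set v : Fin 2 → ℂ := ![coeff (exp2 1 0) (B 0), coeff (exp2 1 0) (B 1)] with hvdef
    have hval : ∀ g : MvPowerSeries (Fin 2) ℂ, coeff (exp2 1 0) (g.subst B) = differential g v := by
      intro g
      rw [exp2_one_zero, linearCoeff_subst hB, Fin.sum_univ_two, differential, exp2_one_zero,
        exp2_zero_one, hvdef, exp2_one_zero]
      rfl
    have hv0 : differential (A 1) v = 0 := by
      rw [← hval, hAB, coeff_exp2_X_one, if_neg (by omega)]
    have := hT v (hmaps.mem_holomorphicTangent hP hf1 hA.invertible hv0) 0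
    rw [← hval, ← hval] at this
    rw [hl, hl']
    exact this
  have hd0 : differential (A 1) t ≠ 0 := fun h0 =>
    ht (hmaps.mem_holomorphicTangent hP hf1 hA.invertible h0)
  have hdiff : ∀ (G : FormalMap), coeff (exp2 1 0) ((G 1).subst B) = 0 →
      differential (G 1) t = coeff (exp2 0 1) ((G 1).subst B) * differential (A 1) t := by
    intro G hG
    have e : ∀ i, coeff (Finsupp.single i 1) (G 1) =
        coeff (exp2 0 1) ((G 1).subst B) * coeff (Finsupp.single i 1) (A 1) := by
      intro i
      conv_lhs => rw [← back G 1]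
      rw [linearCoeff_subst hA.invertible.1, Fin.sum_univ_two, ← exp2_one_zero, hG, zero_mul,
        zero_add, ← exp2_zero_one]
    rw [differential, differential, exp2_one_zero, exp2_zero_one, e, e, ← exp2_zero_one]
    ring
  -- With `l = l'`, the relations `ε₀ = c^(m-1) ε |l|²` for both maps leave only a sign to be
  -- settled.
  have hcc : c = c' := by
    obtain ⟨x, rfl⟩ := Complex.conj_eq_iff_real.mp hcr
    obtain ⟨x', rfl⟩ := Complex.conj_eq_iff_real.mp hcr'
    have hx' : x' ≠ 0 := fun h0 => hc0' (by rw [h0, Complex.ofReal_zero])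
    congr 1
    refine eq_of_scaling_relation (ε := ε) (ε' := ε') hm hx' ?_ ?_
    · rw [hrel, ← hll] at hrel'
      have hll0 : conj l * l ≠ 0 := mul_ne_zero (by simpa using hl0) hl0
      have h1 : (x : ℂ) ^ (m - 1) * ((ε : ℤ) : ℂ) = (x' : ℂ) ^ (m - 1) * ((ε' : ℤ) : ℂ) :=
        mul_right_cancel₀ hll0 (by linear_combination hrel')
      exact_mod_cast h1
    · refine hsign.imp_right ?_
      rintro ⟨r, hr, h1⟩
      refine ⟨r, hr, ?_⟩
      rw [hdiff H hK10, hdiff H' hK10', ← hc, ← hc', ← mul_assoc] at h1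
      exact_mod_cast mul_right_cancel₀ hd0 h1
  subst hll hcc
  have hKK : ∀ i, K i = K' i := by
    have hu := normalization_unique hm hψ hψ1 hS hNS hKt' hKt hφ' hφ hv' hv heq' heq ?_
    · intro i
      have h1 := congrFun hu i
      have hcancel : ∀ {a : ℂ}, a ≠ 0 → ∀ {x y : MvPowerSeries (Fin 2) ℂ},
          C a⁻¹ * x = C a⁻¹ * y → x = y := by
        intro a ha x y hxy
        have := congrArg (C a * ·) hxy
        simpa only [← mul_assoc, C_mul_C_eq_one (mul_inv_cancel₀ ha), one_mul] using this
      fin_cases i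
      · exact hcancel hl0 h1
      · exact hcancel hc0 h1
    -- Once `K 1 - K' 1` is a multiple `w^m E`, the difference `H 1 - H' 1` is `A 1 ^ m` times `E ∘
    -- A`. Its directional coefficient of order `m` is then a nonzero multiple of `E(0)`, for any
    -- `t` transverse to the complex tangent space.
    · intro hdvd
      simp only [Matrix.cons_val] at hdvd ⊢
      rw [← mul_sub] at hdvd
      obtain ⟨E, hE⟩ := dvd_of_C_mul_dvd (inv_ne_zero hc0) hdvd
      have hcoef : coeff (exp2 0 m) (K 1) - coeff (exp2 0 m) (K' 1) = constantCoeff E := by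
        rw [← map_sub, hE, coeff_X_one_pow_mul, if_pos le_rfl, Nat.sub_self, exp2_zero_eq,
          coeff_zero_eq_constantCoeff_apply]
      have hs := hasSubst_of_zero hA.invertible.1
      have h1 : H 1 - H' 1 = A 1 ^ m * E.subst A := by
        have h2 := congrArg (subst A) hE
        rw [subst_sub hs, subst_mul hs, subst_pow hs, subst_X hs] at h2
        rw [← h2, back H 1, back H' 1]
      have h2 := directionalCoeff_pow_mul (hA.invertible.1 1) t m (E.subst A)
      rw [← h1, directionalCoeff_sub, hdir, sub_self, constantCoeff_subst_zero hA.invertible.1,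
        eq_comm, mul_eq_zero, or_iff_right (pow_ne_zero _ hd0)] at h2
      rw [h2, sub_eq_zero] at hcoef
      rw [coeff_C_mul, coeff_C_mul, hcoef]
  funext i
  rw [← back H i, ← back H' i]
  exact congrArg (subst A) (hKK i)

end UniquenessOfNormalization

end

end FormalCR

theorem mainTheorem2 (m : ℕ) (hm : 2 ≤ m) (M : Set (ℂ × ℂ)) (p : ℂ × ℂ)
    (P : MvPowerSeries (Fin 4) ℂ) (hM : IsDefiningSeries M p P)
    (hinf : IsOfInfiniteType m P) (hres : IsNonresonantPoint m P) :
    -- existence of a normalizing transformation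
    (∃ (H : FormalMap) (ε : ℤˣ) (h : MvPowerSeries (Fin 3) ℂ),
      BringsToNormalForm m P H ε h ∧ (Even m → ε = 1)) ∧
    -- uniqueness, in terms of the restriction of the differential to the complex tangent space and
    -- of the transverse derivative of order `m` of the transverse component
    (∀ (H H' : FormalMap) (ε ε' : ℤˣ) (h h' : MvPowerSeries (Fin 3) ℂ) (t : Fin 2 → ℂ),
      BringsToNormalForm m P H ε h → BringsToNormalForm m P H' ε' h' →
      (∀ v ∈ holomorphicTangent P, ∀ i, differential (H i) v = differential (H' i) v) →
      t ∉ holomorphicTangent P →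
      directionalCoeff m (H 1) t = directionalCoeff m (H' 1) t →
      ((Even m ∧ ε = ε') ∨
        ∃ c : ℝ, 0 < c ∧ differential (H 1) t = (c : ℂ) * differential (H' 1) t) →
      H = H') ∧
    -- reality of the parameter `(1 / m!) ∂ ^ m G / ∂ w ^ m (0)` in normal coordinates
    (∀ (f : MvPowerSeries (Fin 3) ℂ), IsNormalCoordinates P MvPowerSeries.X f →
      ∀ (H : FormalMap) (ε : ℤˣ) (h : MvPowerSeries (Fin 3) ℂ), BringsToNormalForm m P H ε h →
        (MvPowerSeries.coeff (exp2 0 m) (H 1)).im = 0) := by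
  exact ⟨hres.exists_normalForm hm,
    fun _ _ _ _ _ _ _ hH hH' hT ht hdir hsign =>
      hres.normalForm_unique hm hM.zero hH hH' hT ht hdir hsign,
    fun _ hf _ _ _ hH => hH.im_coeff_eq_zero hM.zero hf⟩
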